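/- **Setting.** A function of the security parameter $\lambda$ is negligible if it decays faster than every inverse polynomial. Efficient algorithms are (non-uniform) families of polynomial-size circuits, classical randomized or quantum as indicated; the size of a circuit is its number of wires plus the total cost of its gates. *Encryption.* A public-key untelegraphable encryption (UTPKE) scheme $\Pi=(\mathrm{Gen},\mathrm{Enc},\mathrm{Dec})$ with finite non-empty message spaces $\mathcal M_\lambda$ consists of efficient quantum algorithms: $\mathrm{Gen}(1^\lambda)$ outputs classical keys $(pk,sk)$, $\mathrm{Enc}(pk,m)$ outputs a quantum ciphertext, and $\mathrm{Dec}(sk,\cdot)$ outputs a message. It is *correct* if for some negligible $\varepsilon$ and all $\lambda$ and $m\in\mathcal M_\lambda$, $\Pr[\mathrm{Dec}(sk,\mathrm{Enc}(pk,m))=m]\ge 1-\varepsilon(\lambda)$. *Everlasting one-way game.* An adversary is a pair $(\mathcal A,\mathcal B)$, both possibly inefficient. The challenger samples $(pk,sk)\leftarrow\mathrm{Gen}(1^\lambda)$ and a uniform $m\in\mathcal M_\lambda$ and gives $pk$ and $\mathrm{Enc}(pk,m)$ to $\mathcal A$. The quantum operation $\mathcal A$ outputs a classical string $st$ of polynomial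 length. Then $\mathcal B$ receives $st$ and $sk$ and outputs $m_{\mathcal B}$. The pair wins if $m_{\mathcal B}=m$; its advantage is the probability of winning. *Falsifiable assumptions.* A falsifiable assumption $(\mathcal C,c)$ consists of an efficient interactive (quantum) challenger $\mathcal C$, whose running time is polynomial in $\lambda$ and in the length of the interaction, and a constant $c\in[0,1)$. An algorithm *breaks* $(\mathcal C,c)$ if its probability of making $\mathcal C(1^\lambda)$ output $\mathtt{win}$ is not bounded by $c+\varepsilon(\lambda)$ for any negligible $\varepsilon$. The assumption is *false* if some efficient non-uniform interactive quantum algorithm breaks it. *Black-box reductions.* A black-box reduction showing everlasting one-way security of $\Pi$ based on $(\mathcal C,c)$ is an efficient (non-uniform) interactive quantum oracle algorithm $\mathcal R$ such that, for every $(\mathcal A,\mathcal B)$ with non-negligible advantage, $\mathcal R^{\mathcal A}$ breaks $(\mathcal C,c)$. A query consists of a security parameter $1^\kappa$ and a quantum register that holds a public key and a ciphertext; it is answered with the output string of the (stateless) operation $\mathcal A$ on that register. There is no access to an inverse of $\mathcal A$ or to $\mathcal B$. $\mathcal R$ may depend on the output-length function of $\mathcal A$, and its size is polynomial for every polynomially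 bounded output length. **Theorem.** Let $\delta\in(0,1)$, let $\Pi$ be a correct UTPKE scheme, and let $(\mathcal C,c)$ be a falsifiable assumption. 1. Suppose that there is a classical secret-key encryption scheme with efficient classical randomized algorithms and at least two messages for each security parameter which is correct up to negligible error, which is CPA-secure against quantum adversaries of size $2^{\lambda^\delta}$ (every such adversary family has negligible advantage in distinguishing an oracle that encrypts the first message of each queried pair from one that encrypts the second), and whose ciphertexts of different messages are statistically far apart (for some negligible $\varepsilon$, the distributions of the encryptions of any two different messages under a random key have statistical distance at least $1-\varepsilon(\lambda)$). Then $(\mathcal C,c)$ is false, or there is no black-box reduction showing everlasting one-way security of $\Pi$ based on $(\mathcal C,c)$. 2. Suppose that there is a one-way function family, computable by classical circuits of polynomial size, that quantum adversaries of size $2^{\lambda^\delta}$ invert on a uniformly random input only with negligible probability. Then the same conclusion holds: $(\mathcal C,c)$ is false, or there is no black-box reduction showing everlasting one-way security of $\Pi$ based on $(\mathcal C,c)$. -/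

import Mathlib

open scoped BigOperators ComplexOrder

noncomputable section

namespace Telegraph

/-! ## Asymptotics -/

/-- Negligible functions of the security parameter. -/
def Negligible (f : ℕ → ℝ) : Prop :=
  Asymptotics.SuperpolynomialDecay Filter.atTop (fun n : ℕ => (n : ℝ)) f

/-- Functions bounded by a polynomial. -/
def PolyBounded (f : ℕ → ℕ) : Prop :=
  ∃ p : Polynomial ℕ, ∀ n, f n ≤ p.eval n

/-! ## Qubit registers -/

/-- Bit strings of length `n`. -/
abbrev Bits (n : ℕ) : Type := Fin n → Bool

/-- Operators on a register of qubits whose wires are labelled by `W`; the computational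
basis is indexed by `W → Bool`. -/
abbrev Op (W : Type) : Type := Matrix (W → Bool) (W → Bool) ℂ

section Registers
variable {V W U : Type} [Fintype V] [DecidableEq V] [Fintype W] [DecidableEq W]

/-- The basis state `|x⟩⟨x|`. -/
def basis (x : V → Bool) : Op V := Matrix.single x x 1

/-- The tensor product of two registers. -/
def tensor (ρ : Op V) (σ : Op U) : Op (V ⊕ U) := fun x y =>
  ρ (x ∘ Sum.inl) (y ∘ Sum.inl) * σ (x ∘ Sum.inr) (y ∘ Sum.inr)

/-- The reduced state on the wires selected by `f` (partial trace over all other wires). -/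
def reduce (f : V ↪ W) (ρ : Op W) : Op V := fun x y =>
  ∑ z : W → Bool, if z ∘ f = x then ρ z (Function.extend f y z) else 0

end Registers

/-! ## Gates and circuits -/

/-- Elementary operations on the wires `W`. -/
inductive Gate (W : Type) : Type
  /-- NOT on the target, controlled on all wires of a finite set (NOT, CNOT, Toffoli, ...) -/
  | mcx (ctrl : Finset W) (target : W) (h : target ∉ ctrl)
  /-- the Hadamard gate -/
  | had (i : W)
  /-- the gate `diag(1, exp(i π / 4))` -/
  | tgate (i : W)
  /-- discard the wire and replace it by a fresh `|0⟩` -/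
  | reset (i : W)
  /-- discard the wire and replace it by a uniformly random bit -/
  | coin (i : W)

namespace Gate
variable {V W : Type}

/-- Multiply controlled gates are charged for their controls. -/
def cost : Gate W → ℕ
  | mcx ctrl _ _ => 1 + ctrl.card
  | _ => 1

/-- The gates of classical randomized circuits. -/
def IsClassical : Gate W → Prop
  | mcx _ _ _ => True
  | had _ => False
  | tgate _ => False
  | reset _ => True
  | coin _ => True

/-- Relabelling of wires. -/
def map (f : V ↪ W) : Gate V → Gate W
  | mcx ctrl k h => mcx (ctrl.map f) (f k) (by simpa using h)
  | had i => had (f i)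
  | tgate i => tgate (f i)
  | reset i => reset (f i)
  | coin i => coin (f i)

variable [DecidableEq W]

/-- The action of a multiply controlled NOT on basis states. -/
def flip (ctrl : Finset W) (k : W) (x : W → Bool) : W → Bool :=
  if ∀ i ∈ ctrl, x i = true then Function.update x k (!x k) else x

/-- The action of a gate on density operators. -/
def apply (g : Gate W) (ρ : Op W) : Op W :=
  match g with
  | mcx ctrl k _ => fun x y => ρ (flip ctrl k x) (flip ctrl k y)
  | had i => fun x y => (1 / 2 : ℂ) * ∑ a : Bool, ∑ b : Bool,
      (if x i && a then -1 else 1) * (if y i && b then -1 else 1) *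
        ρ (Function.update x i a) (Function.update y i b)
  | tgate i => fun x y =>
      (if x i then Complex.exp (Real.pi / 4 * Complex.I) else 1) * ρ x y *
        (if y i then Complex.exp (-(Real.pi / 4 * Complex.I)) else 1)
  | reset i => fun x y =>
      if x i = false ∧ y i = false then
        ∑ a : Bool, ρ (Function.update x i a) (Function.update y i a) else 0
  | coin i => fun x y =>
      if x i = y i then
        (1 / 2 : ℂ) * ∑ a : Bool, ρ (Function.update x i a) (Function.update y i a) else 0

end Gate

/-- Apply a list of gates, the head of the list first. -/
def runGates {W : Type} [DecidableEq W] (gs : List (Gate W)) (ρ : Op W) : Op W :=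
  gs.foldl (fun σ g => g.apply σ) ρ

/-- The total cost of a list of gates. -/
def gatesCost {W : Type} (gs : List (Gate W)) : ℕ := (gs.map Gate.cost).sum

/-- A circuit with input wires `V`, `anc` work wires that start in `|0⟩`, and output wires
labelled by `U`; the wires that are not output wires are discarded at the end. -/
structure Circuit (V U : Type) where
  anc : ℕ
  gates : List (Gate (V ⊕ Fin anc))
  out : U ↪ V ⊕ Fin anc

namespace Circuit
variable {V U : Type} [Fintype V] [DecidableEq V]

/-- Number of wires plus cost of the gates. -/
def size (C : Circuit V U) : ℕ := Fintype.card V + C.anc + gatesCost C.gates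

/-- The circuit is a classical randomized circuit. -/
def IsClassical (C : Circuit V U) : Prop := ∀ g ∈ C.gates, g.IsClassical

variable [Fintype U] [DecidableEq U]

/-- The quantum operation computed by the circuit. -/
def run (C : Circuit V U) (ρ : Op V) : Op U :=
  reduce C.out (runGates C.gates (tensor ρ (basis fun _ => false)))

/-- The probability that measuring the output on the classical input `x` gives `y`. -/
def prob (C : Circuit V U) (x : V → Bool) (y : U → Bool) : ℝ := (C.run (basis x) y y).re

end Circuit

/-! ## Oracle circuits -/

/-- The interface of an oracle: for every index `k`, a query consists of a quantum register
with wires `In k`, and the answer is a classical string with positions `Out k`. -/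
structure OracleType where
  Idx : Type
  In : Idx → Type
  Out : Idx → Type
  [inFintype : ∀ k, Fintype (In k)]
  [inDecEq : ∀ k, DecidableEq (In k)]
  [outFintype : ∀ k, Fintype (Out k)]
  [outDecEq : ∀ k, DecidableEq (Out k)]

attribute [instance] OracleType.inFintype OracleType.inDecEq OracleType.outFintype
  OracleType.outDecEq

/-- The empty interface. -/
def OracleType.none : OracleType where
  Idx := Empty
  In := fun _ => Empty
  Out := fun _ => Empty

/-- An oracle: for every index `k` and every answer `s`, the measurement operator of `s`. The
oracle is stateless. -/
abbrev Oracle (T : OracleType) : Type :=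
  ∀ k : T.Idx, (T.Out k → Bool) → Op (T.In k)

/-- The operators of every index form a measurement (POVM), so that the oracle is a quantum
operation with classical output. -/
def Oracle.IsMeasurement {T : OracleType} (O : Oracle T) : Prop :=
  ∀ k, (∀ s, (O k s).PosSemidef) ∧ ∑ s, O k s = 1

/-- The oracle for the empty interface. -/
def Oracle.none : Oracle OracleType.none := fun k => Empty.elim k

/-- An instruction of an oracle circuit: a gate, or a query that hands the register `inp` to
the oracle and receives the answer in the register `ans`. -/
inductive Instr (T : OracleType) (W : Type) : Type
  | gate (g : Gate W)
  | query (k : T.Idx) (inp : T.In k ↪ W) (ans : T.Out k ↪ W) (h : ∀ a b, inp a ≠ ans b)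

namespace Instr
variable {T : OracleType} {V W : Type}

/-- A query has unit cost; its registers are counted in the width of the circuit. -/
def cost : Instr T W → ℕ
  | gate g => g.cost
  | query _ _ _ _ => 1

/-- Relabelling of wires. -/
def map (f : V ↪ W) : Instr T V → Instr T W
  | gate g => gate (g.map f)
  | query k inp ans h => query k (inp.trans f) (ans.trans f) (by simpa using h)

variable [DecidableEq W]

/-- The action of an instruction. A query measures the register `inp` with the oracle's
measurement, after which `inp` is `|0⟩` and `ans` holds the outcome; the previous content of
`ans` is discarded. -/
def apply (O : Oracle T) (i : Instr T W) (ρ : Op W) : Op W :=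
  match i with
  | gate g => g.apply ρ
  | query k inp ans _ => fun x y =>
      if (∀ a, x (inp a) = false) ∧ (∀ a, y (inp a) = false) ∧ x ∘ ans = y ∘ ans then
        ∑ u : T.In k → Bool, ∑ v : T.In k → Bool, ∑ w : T.Out k → Bool,
          O k (x ∘ ans) v u *
            ρ (Function.extend inp u (Function.extend ans w x))
              (Function.extend inp v (Function.extend ans w y))
      else 0

end Instr

/-- Apply a list of instructions, the head of the list first. -/
def runInstrs {T : OracleType} {W : Type} [DecidableEq W] (O : Oracle T)
    (is : List (Instr T W)) (ρ : Op W) : Op W :=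
  is.foldl (fun σ i => i.apply O σ) ρ

/-- The total cost of a list of instructions. -/
def instrsCost {T : OracleType} {W : Type} (is : List (Instr T W)) : ℕ :=
  (is.map Instr.cost).sum

/-- The probability that the wire `i` is measured to be `1`. -/
def probOne {W : Type} [Fintype W] [DecidableEq W] (i : W) (ρ : Op W) : ℝ :=
  ∑ z : W → Bool, if z i = true then (ρ z z).re else 0

/-- A quantum oracle algorithm without input that outputs one bit. -/
structure Distinguisher (T : OracleType) where
  width : ℕ
  instrs : List (Instr T (Fin width))
  out : Fin width

namespace Distinguisher
variable {T : OracleType}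

/-- Number of wires plus cost of the instructions. -/
def size (D : Distinguisher T) : ℕ := D.width + instrsCost D.instrs

/-- The probability of the output `1`. -/
def accept (D : Distinguisher T) (O : Oracle T) : ℝ :=
  probOne D.out (runInstrs O D.instrs (basis fun _ => false))

end Distinguisher

/-! ## Secret-key encryption -/

/-- A (classical) secret-key encryption scheme with message spaces `msg n ⊆ {0,1}^(msgLen n)`;
the algorithms are given as circuit families indexed by the security parameter. -/
structure SKE where
  keyLen : ℕ → ℕ
  msgLen : ℕ → ℕ
  ctLen : ℕ → ℕ
  msg : ∀ n, Finset (Bits (msgLen n))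
  gen : ∀ n, Circuit (Fin 0) (Fin (keyLen n))
  enc : ∀ n, Circuit (Fin (keyLen n) ⊕ Fin (msgLen n)) (Fin (ctLen n))
  dec : ∀ n, Circuit (Fin (keyLen n) ⊕ Fin (ctLen n)) (Fin (msgLen n))

namespace SKE

/-- The algorithms are classical randomized circuits of polynomial size. -/
def Efficient (E : SKE) : Prop :=
  (∀ n, (E.gen n).IsClassical ∧ (E.enc n).IsClassical ∧ (E.dec n).IsClassical) ∧
    PolyBounded fun n => (E.gen n).size + (E.enc n).size + (E.dec n).size

/-- The probability that key generation outputs `sk`. -/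
def genProb (E : SKE) (n : ℕ) (sk : Bits (E.keyLen n)) : ℝ := (E.gen n).prob (fun _ => false) sk

/-- The probability that `ct` is the encryption of `m` under the key `sk`. -/
def encProb (E : SKE) (n : ℕ) (sk : Bits (E.keyLen n)) (m : Bits (E.msgLen n))
    (ct : Bits (E.ctLen n)) : ℝ := (E.enc n).prob (Sum.elim sk m) ct

/-- Correctness, up to a negligible error. -/
def Correct (E : SKE) : Prop :=
  ∃ ε : ℕ → ℝ, Negligible ε ∧ ∀ n, ∀ m ∈ E.msg n,
    1 - ε n ≤ ∑ sk, E.genProb n sk * ∑ ct, E.encProb n sk m ct *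
      (E.dec n).prob (Sum.elim sk ct) m

/-- The interface of the challenger in the CPA game: a query is a pair of messages. -/
def cpaType (E : SKE) (n : ℕ) : OracleType where
  Idx := Unit
  In := fun _ => Fin (E.msgLen n) ⊕ Fin (E.msgLen n)
  Out := fun _ => Fin (E.ctLen n)

/-- The challenger with key `sk` and bit `b`: it answers a pair `(m₀, m₁)` of messages with a
fresh encryption of `m_b`, and any other query with the zero string. -/
def cpaOracle (E : SKE) (n : ℕ) (sk : Bits (E.keyLen n)) (b : Bool) : Oracle (E.cpaType n) :=
  fun _ ct => Matrix.diagonal fun q : Fin (E.msgLen n) ⊕ Fin (E.msgLen n) → Bool =>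
    if q ∘ Sum.inl ∈ E.msg n ∧ q ∘ Sum.inr ∈ E.msg n then
      ((E.encProb n sk (if b then q ∘ Sum.inr else q ∘ Sum.inl) ct : ℝ) : ℂ)
    else if ct = fun _ => false then 1 else 0

/-- The probability that the adversary outputs `1` in the CPA game with bit `b`. -/
def cpaProb (E : SKE) (n : ℕ) (b : Bool) (D : Distinguisher (E.cpaType n)) : ℝ :=
  ∑ sk, E.genProb n sk * D.accept (E.cpaOracle n sk b)

/-- (Post-quantum) CPA security against adversaries of size `2^(n^δ)`. -/
def CPASecure (E : SKE) (δ : ℝ) : Prop :=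
  ∀ D : ∀ n, Distinguisher (E.cpaType n),
    (∀ᶠ n : ℕ in Filter.atTop, ((D n).size : ℝ) ≤ (2 : ℝ) ^ ((n : ℝ) ^ δ)) →
      Negligible fun n => |E.cpaProb n false (D n) - E.cpaProb n true (D n)|

/-- The probability that `ct` is the encryption of `m` under a random key. -/
def ctProb (E : SKE) (n : ℕ) (m : Bits (E.msgLen n)) (ct : Bits (E.ctLen n)) : ℝ :=
  ∑ sk, E.genProb n sk * E.encProb n sk m ct

/-- There are at least two messages, and for any two different messages the statistical
distance of their encryptions (under a random key) is at least `1 - negl`. -/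
def StatisticallyFar (E : SKE) : Prop :=
  (∀ n, 2 ≤ (E.msg n).card) ∧
  ∃ ε : ℕ → ℝ, Negligible ε ∧ ∀ n, ∀ m ∈ E.msg n, ∀ m' ∈ E.msg n, m ≠ m' →
    1 - ε n ≤ (1 / 2) * ∑ ct, |E.ctProb n m ct - E.ctProb n m' ct|

end SKE

/-! ## One-way functions -/

/-- A family of functions on bit strings, indexed by the security parameter. -/
structure FunctionFamily where
  inLen : ℕ → ℕ
  outLen : ℕ → ℕ
  f : ∀ n, Bits (inLen n) → Bits (outLen n)

namespace FunctionFamily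

/-- The functions are computed by classical circuits of polynomial size. -/
def Efficient (F : FunctionFamily) : Prop :=
  ∃ C : ∀ n, Circuit (Fin (F.inLen n)) (Fin (F.outLen n)),
    (∀ n, (C n).IsClassical) ∧ (PolyBounded fun n => (C n).size) ∧
      ∀ n x, (C n).prob x (F.f n x) = 1

/-- The probability that `I` finds a preimage of `f(x)` for a uniformly random `x`. -/
def invertProb (F : FunctionFamily) (n : ℕ)
    (I : Circuit (Fin (F.outLen n)) (Fin (F.inLen n))) : ℝ :=
  (1 / 2 ^ F.inLen n) * ∑ x, ∑ x', if F.f n x' = F.f n x then I.prob (F.f n x) x' else 0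

/-- (Post-quantum) one-wayness against adversaries of size `2^(n^δ)`. -/
def OneWay (F : FunctionFamily) (δ : ℝ) : Prop :=
  ∀ I : ∀ n, Circuit (Fin (F.outLen n)) (Fin (F.inLen n)),
    (∀ᶠ n : ℕ in Filter.atTop, ((I n).size : ℝ) ≤ (2 : ℝ) ^ ((n : ℝ) ^ δ)) →
      Negligible fun n => F.invertProb n (I n)

end FunctionFamily

/-! ## Public-key untelegraphable encryption -/

/-- A public-key encryption scheme with classical keys and quantum ciphertexts, with message
spaces `msg n ⊆ {0,1}^(msgLen n)`. -/
structure UTPKE where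
  pkLen : ℕ → ℕ
  skLen : ℕ → ℕ
  msgLen : ℕ → ℕ
  ctLen : ℕ → ℕ
  msg : ∀ n, Finset (Bits (msgLen n))
  msg_nonempty : ∀ n, (msg n).Nonempty
  gen : ∀ n, Circuit (Fin 0) (Fin (pkLen n) ⊕ Fin (skLen n))
  enc : ∀ n, Circuit (Fin (pkLen n) ⊕ Fin (msgLen n)) (Fin (ctLen n))
  dec : ∀ n, Circuit (Fin (skLen n) ⊕ Fin (ctLen n)) (Fin (msgLen n))

namespace UTPKE

/-- The algorithms are quantum circuits of polynomial size. -/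
def Efficient (S : UTPKE) : Prop :=
  PolyBounded fun n => (S.gen n).size + (S.enc n).size + (S.dec n).size

/-- The probability that key generation outputs the pair `(pk, sk)`. -/
def genProb (S : UTPKE) (n : ℕ) (pk : Bits (S.pkLen n)) (sk : Bits (S.skLen n)) : ℝ :=
  (S.gen n).prob (fun _ => false) (Sum.elim pk sk)

/-- The quantum ciphertext of `m` under `pk`. -/
def encState (S : UTPKE) (n : ℕ) (pk : Bits (S.pkLen n)) (m : Bits (S.msgLen n)) :
    Op (Fin (S.ctLen n)) :=
  (S.enc n).run (basis (Sum.elim pk m))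

/-- The probability that the ciphertext `ρ` is decrypted to `m` with `sk`. -/
def decProb (S : UTPKE) (n : ℕ) (sk : Bits (S.skLen n)) (ρ : Op (Fin (S.ctLen n)))
    (m : Bits (S.msgLen n)) : ℝ :=
  ((S.dec n).run (tensor (basis sk) ρ) m m).re

/-- Correctness, up to a negligible error. -/
def Correct (S : UTPKE) : Prop :=
  ∃ ε : ℕ → ℝ, Negligible ε ∧ ∀ n, ∀ m ∈ S.msg n,
    1 - ε n ≤ ∑ pk, ∑ sk, S.genProb n pk sk * S.decProb n sk (S.encState n pk m) m

/-- The interface of a first-stage adversary (a telegrapher) whose classical output has length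
`ℓ n`: at security parameter `n`, it receives a public key and a ciphertext. -/
def telegrapherType (S : UTPKE) (ℓ : ℕ → ℕ) : OracleType where
  Idx := ℕ
  In := fun n => Fin (S.pkLen n) ⊕ Fin (S.ctLen n)
  Out := fun n => Fin (ℓ n)

/-- A (possibly inefficient) first-stage adversary: at every security parameter an arbitrary
quantum operation from a public key and a ciphertext to a classical string. -/
structure Telegrapher (S : UTPKE) (ℓ : ℕ → ℕ) where
  oracle : Oracle (S.telegrapherType ℓ)
  isMeasurement : oracle.IsMeasurement

/-- A (computationally unbounded) second-stage adversary: from the string of the first stage and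
the secret key it outputs a message. -/
abbrev Receiver (S : UTPKE) (ℓ : ℕ → ℕ) : Type :=
  ∀ n, Bits (ℓ n) → Bits (S.skLen n) → PMF (Bits (S.msgLen n))

/-- The probability that `A` outputs `st` on input `(1^n, pk, ρ)`. -/
def Telegrapher.prob {S : UTPKE} {ℓ : ℕ → ℕ} (A : S.Telegrapher ℓ) (n : ℕ)
    (pk : Bits (S.pkLen n)) (ρ : Op (Fin (S.ctLen n))) (st : Bits (ℓ n)) : ℝ :=
  (Matrix.trace ((show Op (Fin (S.pkLen n) ⊕ Fin (S.ctLen n)) from A.oracle n st) *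
    tensor (basis pk) ρ)).re

/-- The probability that `(A, B)` wins the everlasting one-way security game: keys and a
uniformly random message `m` are sampled, `A` turns the public key and the ciphertext into a
classical string, and `B` has to find `m` from this string and the secret key. -/
def winProb (S : UTPKE) {ℓ : ℕ → ℕ} (A : S.Telegrapher ℓ) (B : S.Receiver ℓ) (n : ℕ) : ℝ :=
  ∑ pk, ∑ sk, S.genProb n pk sk *
    ((1 / ((S.msg n).card : ℝ)) * ∑ m ∈ S.msg n, ∑ st : Bits (ℓ n),
      A.prob n pk (S.encState n pk m) st * (B n st sk m).toReal)

end UTPKE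

/-! ## Falsifiable assumptions -/

/-- An interactive quantum challenger. Besides the security parameter `n` it receives a bound `t`
(in unary) on the length of the interaction, which the other party chooses. The parties
exchange a message register of `msgLen n t` qubits; the challenger moves first and last, with
`rounds n t` moves of the other party in between, and at the end the wire `win` tells whether
the challenger outputs `win`. -/
structure Challenger where
  rounds : ℕ → ℕ → ℕ
  msgLen : ℕ → ℕ → ℕ
  memLen : ℕ → ℕ → ℕ
  circ : ∀ n t, Fin (rounds n t + 1) → List (Gate (Fin (msgLen n t) ⊕ Fin (memLen n t)))
  win : ∀ n t, Fin (memLen n t)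

/-- The challenger runs in polynomial size. -/
def Challenger.Efficient (C : Challenger) : Prop :=
  ∃ p : Polynomial ℕ, ∀ n t,
    C.rounds n t + C.msgLen n t + C.memLen n t + ∑ i, gatesCost (C.circ n t i) ≤ p.eval (n + t)

/-- An interactive quantum algorithm, with queries to an oracle of type `T`, that plays against
the challenger `C`. -/
structure InteractiveAlg (T : OracleType) (C : Challenger) where
  len : ℕ → ℕ
  memLen : ℕ → ℕ
  circ : ∀ n, Fin (C.rounds n (len n)) →
    List (Instr T (Fin (memLen n) ⊕ Fin (C.msgLen n (len n))))

namespace InteractiveAlg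
variable {T : OracleType} {C : Challenger}

/-- The (non-uniform) algorithm has polynomial size. -/
def Efficient (A : InteractiveAlg T C) : Prop :=
  PolyBounded fun n => A.len n + A.memLen n + C.msgLen n (A.len n) +
    ∑ i, instrsCost (A.circ n i)

/-- All qubits of an interaction: the memory of the algorithm, the message register, and the
memory of the challenger. -/
abbrev Wires (A : InteractiveAlg T C) (n : ℕ) : Type :=
  Fin (A.memLen n) ⊕ (Fin (C.msgLen n (A.len n)) ⊕ Fin (C.memLen n (A.len n)))

/-- A move of the challenger. -/
def challengerMove (A : InteractiveAlg T C) (n : ℕ) (i : Fin (C.rounds n (A.len n) + 1))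
    (ρ : Op (A.Wires n)) : Op (A.Wires n) :=
  runGates ((C.circ n (A.len n) i).map (Gate.map Function.Embedding.inr)) ρ

/-- A move of the algorithm with oracle `O`. -/
def algMove (A : InteractiveAlg T C) (O : Oracle T) (n : ℕ) (i : Fin (C.rounds n (A.len n)))
    (ρ : Op (A.Wires n)) : Op (A.Wires n) :=
  runInstrs O ((A.circ n i).map (Instr.map
    (Function.Embedding.sumMap (Function.Embedding.refl _) Function.Embedding.inl))) ρ

/-- The probability that the algorithm with oracle `O` wins against the challenger. -/
def winProb (A : InteractiveAlg T C) (O : Oracle T) (n : ℕ) : ℝ :=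
  probOne (Sum.inr (Sum.inr (C.win n (A.len n))))
    (A.challengerMove n (Fin.last _)
      ((List.finRange (C.rounds n (A.len n))).foldl
        (fun ρ i => A.algMove O n i (A.challengerMove n i.castSucc ρ))
        (basis fun _ => false)))

/-- The algorithm with oracle `O` breaks the assumption `(C, c)`: its winning probability is not
bounded by `c + negl`. -/
def Breaks (A : InteractiveAlg T C) (O : Oracle T) (c : ℝ) : Prop :=
  ¬ ∃ ε : ℕ → ℝ, Negligible ε ∧ ∀ n, A.winProb O n ≤ c + ε n

end InteractiveAlg

/-- The assumption `(C, c)` is false: an efficient (non-uniform) algorithm breaks it. -/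
def AssumptionFalse (C : Challenger) (c : ℝ) : Prop :=
  ∃ A : InteractiveAlg OracleType.none C, A.Efficient ∧ A.Breaks Oracle.none c

/-- `R` is a black-box reduction that shows everlasting one-way security of `S` based on `(C, c)`:
for every adversary `(A, B)` that wins with non-negligible probability, `R` with oracle `A`
breaks the assumption. To be able to read the answers, `R` may depend on the polynomial length
`ℓ` of the classical string that is output by `A`, but not on `A` otherwise. -/
def IsBlackBoxReduction (S : UTPKE) (C : Challenger) (c : ℝ)
    (R : ∀ ℓ : ℕ → ℕ, InteractiveAlg (S.telegrapherType ℓ) C) : Prop :=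
  ∀ ℓ : ℕ → ℕ, PolyBounded ℓ → (R ℓ).Efficient ∧
    ∀ (A : S.Telegrapher ℓ) (B : S.Receiver ℓ),
      ¬ Negligible (S.winProb A B) → (R ℓ).Breaks A.oracle c

end Telegraph

end

noncomputable section

set_option linter.unusedSectionVars false
set_option linter.unusedFintypeInType false
set_option linter.unusedDecidableInType false

/-!
# Black-box reductions for untelegraphable encryption

The oracle given to a reduction is the following telegrapher. It decrypts the ciphertext with a best
secret key for the given public key, draws a random seed, and outputs the seed and the message masked
with the entry of a table at this seed. The receiver knows the table, so that the pair wins the game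
whenever decryption is correct.

For a random table, fresh random strings can replace the answers to queries whose security parameter
is large enough to make collisions of seeds unlikely; the error has a small second moment. The
entries of the table that belong to small security parameters are compiled into the circuits of the
simulation, which is a non-uniform algorithm of polynomial size. By the Borel–Cantelli lemma there is
one table for which the simulation is accurate up to every inverse power of the security parameter.
The adversaries of the game are unbounded, and no computational hardness is used: a falsifiable
assumption with a black-box reduction is false.
-/

namespace Telegraph

/-! ## Reindexing sums over bit strings -/

section Extend
variable {V W U : Type}

/-! The core is that a black-box reduction for `S` can be turned into an efficient attack on the
assumption (`UTPKE.assumptionFalse_of_isBlackBoxReduction`).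

Fix a sequence of tables `ω`, one table of masks for each security parameter. The telegrapher
decrypts the ciphertext with the key that is best for the given public key, draws a seed `x`, and
outputs `x` with the message masked by `ω(x)`. The receiver knows `ω` and removes the mask. On
average over messages the best key decrypts at least as well as the sampled one, so correctness
makes this pair win with probability tending to 1 for every `ω` (`UTPKE.le_winProb_table`). Hence
the reduction with this oracle breaks the assumption for every `ω`.

For a random `ω` the answers are nearly independent uniform strings. The simulator at parameter `n`
answers a query with security parameter `k` by a uniform string if `2 ^ seedLen k > n ^ K`.
Otherwise it runs the true telegrapher, whose tables have size polynomial in `n` and are hardwired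
into the circuit (`UTPKE.simulator_efficient`). Each query is compiled into gates that return their
work wires to zero (`Device.runGates_queryGates`, `InteractiveAlg.winProb_simulate`).

To compare the two runs, note that the seed of an answer is independent of the query. By linearity a
run is therefore a mixture, over seeds and fresh strings drawn in advance, of runs with fixed seeds
and masks (`probOne_runInstrs_tableOracle`), and the comparison becomes a classical statement about
tables. A small mean error over `ω` would not suffice, because a single table must work; the second
moment is bounded instead. Its square is the correlation of two copies of the run that share one
table. If no large seed is repeated among both copies, the masks at large seeds are independent and
uniform and the correlation vanishes on average, so only the probability of a collision is left: at
most `8 q² / n ^ K` for `q` instructions (`integral_tableExpect_sub_sq_le`,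
`UTPKE.integral_simError_sq_le`).

With `K` large in terms of `k`, the squares of `n ^ k` times the error have summable expectations,
and Borel–Cantelli gives an error of at most `n ^ (-k)` eventually, almost surely
(`UTPKE.ae_eventually_simError`). One table serves all the countably many `k`. If the assumption
were not false, each simulator would win with probability at most `c` plus a negligible function;
letting `k` vary, the excess of the reduction over `c` for this table is negligible
(`negligible_of_forall_pow`, `UTPKE.exists_not_breaks`), a contradiction. -/

theorem extend_comp_self (f : U ↪ W) (w : U → Bool) (x : W → Bool) :
    Function.extend f w x ∘ f = w := Function.extend_comp f.injective _ _

theorem extend_extend (f : U ↪ W) (w w' : U → Bool) (x : W → Bool) :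
    Function.extend f w (Function.extend f w' x) = Function.extend f w x := by
  funext k
  by_cases h : ∃ a, f a = k
  · obtain ⟨a, rfl⟩ := h
    simp [f.injective.extend_apply]
  · simp [Function.extend_apply' _ _ _ h]

theorem extend_comp_eq (f : U ↪ W) (x : W → Bool) : Function.extend f (x ∘ f) x = x := by
  funext k
  by_cases h : ∃ a, f a = k
  · obtain ⟨a, rfl⟩ := h
    simp [f.injective.extend_apply]
  · simp [Function.extend_apply' _ _ _ h]

theorem extend_comp_of_disjoint (f : U ↪ W) (g : V ↪ W) (h : ∀ a b, f a ≠ g b) (w : U → Bool)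
    (x : W → Bool) : Function.extend f w x ∘ g = x ∘ g := by
  funext b
  exact Function.extend_apply' _ _ _ fun ⟨a, ha⟩ => h a b ha

theorem extend_trans (f : U ↪ V) (g : V ↪ W) (w : U → Bool) (x : W → Bool) :
    Function.extend (f.trans g) w x = Function.extend g (Function.extend f w (x ∘ g)) x := by
  funext k
  by_cases h : ∃ a, g a = k
  · obtain ⟨a, rfl⟩ := h
    rw [g.injective.extend_apply]
    by_cases h' : ∃ b, f b = a
    · obtain ⟨b, rfl⟩ := h'
      rw [f.injective.extend_apply]
      exact (f.trans g).injective.extend_apply w x b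
    · rw [Function.extend_apply' _ _ _ h', Function.extend_apply']
      · rfl
      · rintro ⟨b, hb⟩
        exact h' ⟨b, g.injective hb⟩
  · rw [Function.extend_apply' _ _ _ h, Function.extend_apply']
    rintro ⟨b, hb⟩
    exact h ⟨f b, hb⟩

variable [Fintype W] [DecidableEq W] [Fintype U] [DecidableEq U]

theorem extend_comm (f : U ↪ W) (g : V ↪ W) (h : ∀ a b, f a ≠ g b) (w : U → Bool) (v : V → Bool)
    (x : W → Bool) : Function.extend f w (Function.extend g v x) =
      Function.extend g v (Function.extend f w x) := by
  funext k
  by_cases h1 : ∃ a, f a = k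
  · obtain ⟨a, rfl⟩ := h1
    rw [f.injective.extend_apply, Function.extend_apply' v, f.injective.extend_apply]
    exact fun ⟨b, hb⟩ => h a b hb.symm
  · rw [Function.extend_apply' w _ _ h1]
    by_cases h2 : ∃ b, g b = k
    · obtain ⟨b, rfl⟩ := h2
      rw [g.injective.extend_apply, g.injective.extend_apply]
    · rw [Function.extend_apply' v _ _ h2, Function.extend_apply' v _ _ h2,
        Function.extend_apply' w _ _ h1]

/-- The map `(x, w) ↦ (extend f w x, x ∘ f)` exchanges `w` with the content of the wires `f`, so it
is an involution of the index set. -/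
theorem sum_sum_extend {M : Type*} [AddCommMonoid M] (f : U ↪ W) (H : (W → Bool) → M) :
    ∑ x, ∑ w : U → Bool, H (Function.extend f w x) = ∑ x, ∑ _w : U → Bool, H x := by
  rw [← Fintype.sum_prod_type', ← Fintype.sum_prod_type']
  let φ : (W → Bool) × (U → Bool) → (W → Bool) × (U → Bool) :=
    fun p => (Function.extend f p.2 p.1, p.1 ∘ f)
  have hφ : Function.Involutive φ := by
    rintro ⟨x, w⟩
    simp only [φ, extend_comp_self, extend_extend, extend_comp_eq]
  exact Fintype.sum_equiv hφ.toPerm _ _ fun p => rfl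

/-- Summing the hypothesis over all `x` counts every term `2 ^ |U|` times on both sides, and this
factor cancels. Trace identities are thereby reduced to the wires on which an operation acts. -/
theorem sum_extend_cancel (f : U ↪ W) {H G : (W → Bool) → ℂ}
    (h : ∀ x, ∑ w : U → Bool, H (Function.extend f w x) =
      ∑ w : U → Bool, G (Function.extend f w x)) : ∑ x, H x = ∑ x, G x := by
  have h1 := sum_sum_extend f H
  have h2 := sum_sum_extend f G
  simp only [h] at h1
  rw [h1] at h2
  simp only [Finset.sum_const, nsmul_eq_mul] at h2
  rw [← Finset.mul_sum, ← Finset.mul_sum] at h2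
  refine mul_left_cancel₀ ?_ h2
  simp

end Extend

section Update
variable {W : Type} [DecidableEq W]

/-- A single wire as an embedding. -/
def wire (i : W) : Unit ↪ W := ⟨fun _ => i, fun _ _ _ => rfl⟩

theorem update_eq_extend (i : W) (a : Bool) (x : W → Bool) :
    Function.update x i a = Function.extend (wire i) (fun _ => a) x := by
  funext k
  by_cases h : k = i
  · subst h
    rw [Function.update_self]
    exact ((wire k).injective.extend_apply (fun _ => a) x ()).symm
  · rw [Function.update_of_ne h, Function.extend_apply']
    rintro ⟨_, rfl⟩
    exact h rfl

variable [Fintype W]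

theorem sum_update_cancel (i : W) {H G : (W → Bool) → ℂ}
    (h : ∀ x, ∑ a : Bool, H (Function.update x i a) = ∑ a : Bool, G (Function.update x i a)) :
    ∑ x, H x = ∑ x, G x := by
  refine sum_extend_cancel (wire i) fun x => ?_
  have e : (Unit → Bool) ≃ Bool := Equiv.funUnique Unit Bool
  have key : ∀ F : (W → Bool) → ℂ, ∑ w : Unit → Bool, F (Function.extend (wire i) w x) =
      ∑ a : Bool, F (Function.update x i a) := fun F =>
    Fintype.sum_equiv (Equiv.funUnique Unit Bool) _ _ fun w => by
      rw [update_eq_extend]; rfl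
  rw [key, key, h]

end Update

/-! ## Linearity -/

section Linear
variable {W : Type} [DecidableEq W]

namespace Gate

theorem apply_add (g : Gate W) (ρ σ : Op W) : g.apply (ρ + σ) = g.apply ρ + g.apply σ := by
  ext x y
  change g.apply (ρ + σ) x y = g.apply ρ x y + g.apply σ x y
  cases g <;> simp only [apply, Matrix.add_apply, Finset.sum_add_distrib, mul_add, add_mul]
  all_goals split_ifs <;> simp

theorem apply_smul (g : Gate W) (c : ℂ) (ρ : Op W) : g.apply (c • ρ) = c • g.apply ρ := by
  ext x y
  change g.apply (c • ρ) x y = c * g.apply ρ x y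
  cases g <;> simp only [apply, Matrix.smul_apply, smul_eq_mul, Fintype.sum_bool]
  · ring
  all_goals split_ifs <;> ring

end Gate

section Query
variable {A B : Type} [Fintype A] [DecidableEq A] [Fintype B] [DecidableEq B]

/-- The action of a query with measurement operators `M`. -/
def queryMap (inp : A ↪ W) (ans : B ↪ W) (M : (B → Bool) → Op A) (ρ : Op W) : Op W := fun x y =>
  if (∀ a, x (inp a) = false) ∧ (∀ a, y (inp a) = false) ∧ x ∘ ans = y ∘ ans then
    ∑ u : A → Bool, ∑ v : A → Bool, ∑ w : B → Bool, M (x ∘ ans) v u *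
      ρ (Function.extend inp u (Function.extend ans w x))
        (Function.extend inp v (Function.extend ans w y))
  else 0

theorem queryMap_add (inp : A ↪ W) (ans : B ↪ W) (M : (B → Bool) → Op A) (ρ σ : Op W) :
    queryMap inp ans M (ρ + σ) = queryMap inp ans M ρ + queryMap inp ans M σ := by
  ext x y
  change queryMap inp ans M (ρ + σ) x y = queryMap inp ans M ρ x y + queryMap inp ans M σ x y
  simp only [queryMap, Matrix.add_apply, mul_add, Finset.sum_add_distrib]
  split_ifs <;> simp

theorem queryMap_smul (inp : A ↪ W) (ans : B ↪ W) (M : (B → Bool) → Op A) (c : ℂ) (ρ : Op W) :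
    queryMap inp ans M (c • ρ) = c • queryMap inp ans M ρ := by
  ext x y
  change queryMap inp ans M (c • ρ) x y = c * queryMap inp ans M ρ x y
  simp only [queryMap, Matrix.smul_apply, smul_eq_mul, mul_left_comm _ c, ← Finset.mul_sum]
  split_ifs <;> simp

end Query

namespace Instr
variable {T : OracleType}

theorem apply_add (O : Oracle T) (i : Instr T W) (ρ σ : Op W) :
    i.apply O (ρ + σ) = i.apply O ρ + i.apply O σ := by
  cases i with
  | gate g => exact g.apply_add ρ σ
  | query k inp ans h => exact queryMap_add inp ans (O k) ρ σ

theorem apply_smul (O : Oracle T) (i : Instr T W) (c : ℂ) (ρ : Op W) :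
    i.apply O (c • ρ) = c • i.apply O ρ := by
  cases i with
  | gate g => exact g.apply_smul c ρ
  | query k inp ans h => exact queryMap_smul inp ans (O k) c ρ

/-- The action of an instruction as a linear map. -/
def toEnd (O : Oracle T) (i : Instr T W) : Module.End ℂ (Op W) where
  toFun := i.apply O
  map_add' := i.apply_add O
  map_smul' := i.apply_smul O

end Instr

/-- The action of a list of gates as a linear map. -/
def runGatesₗ (gs : List (Gate W)) : Op W →ₗ[ℂ] Op W where
  toFun := runGates gs
  map_add' ρ σ := by
    induction gs generalizing ρ σ with
    | nil => rfl
    | cons g gs ih => simpa only [runGates, List.foldl_cons, g.apply_add] using ih _ _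
  map_smul' c ρ := by
    induction gs generalizing ρ with
    | nil => rfl
    | cons g gs ih => simpa only [runGates, List.foldl_cons, g.apply_smul] using ih _

@[simp] theorem runGatesₗ_apply (gs : List (Gate W)) (ρ : Op W) :
    runGatesₗ gs ρ = runGates gs ρ := rfl

theorem runGates_cons (g : Gate W) (gs : List (Gate W)) (ρ : Op W) :
    runGates (g :: gs) ρ = runGates gs (g.apply ρ) := rfl

theorem runGates_append (gs gs' : List (Gate W)) (ρ : Op W) :
    runGates (gs ++ gs') ρ = runGates gs' (runGates gs ρ) := by
  simp [runGates]

theorem runInstrs_append {T : OracleType} (O : Oracle T) (is is' : List (Instr T W)) (ρ : Op W) :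
    runInstrs O (is ++ is') ρ = runInstrs O is' (runInstrs O is ρ) := by
  simp [runInstrs]

theorem runInstrs_gate {T : OracleType} (O : Oracle T) (gs : List (Gate W)) (ρ : Op W) :
    runInstrs O (gs.map Instr.gate) ρ = runGates gs ρ := by
  simp [runInstrs, runGates, List.foldl_map, Instr.apply]

/-- A product in `Module.End` applies its last factor first, while instructions run from the head of
the list; hence the reversal here and in later statements about mixtures. -/
theorem toEnd_prod_reverse {T : OracleType} (O : Oracle T) (is : List (Instr T W)) (ρ : Op W) :
    (is.reverse.map (Instr.toEnd O)).prod ρ = runInstrs O is ρ := by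
  induction is generalizing ρ with
  | nil => rfl
  | cons i is ih =>
    rw [List.reverse_cons, List.map_append, List.prod_append, Module.End.mul_apply, ih]
    simp [Instr.toEnd, runInstrs]

end Linear

/-! ## Positivity -/

theorem half_nonneg_complex : (0 : ℂ) ≤ 1 / 2 := by
  rw [Complex.le_def]
  norm_num

/-- The matrix is `K * M * Kᴴ`, where `K x t` is the sum of `c a x` over all `a` with `f a x = t`.
This is the Kraus form in which the positivity of resets, coins and queries is checked. -/
theorem posSemidef_combine {τ ι n : Type*} [Fintype τ] [DecidableEq τ] [Fintype ι] [Finite n]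
    {M : Matrix τ τ ℂ} (hM : M.PosSemidef) (f : ι → n → τ) (c : ι → n → ℂ) :
    (Matrix.of fun x y => ∑ a, ∑ b, c a x * M (f a x) (f b y) * star (c b y)).PosSemidef := by
  have := Fintype.ofFinite n
  let K : Matrix n τ ℂ := Matrix.of fun x t => ∑ a, if f a x = t then c a x else 0
  have h := hM.mul_mul_conjTranspose_same K
  convert h using 1
  ext x y
  simp only [K, Matrix.mul_apply, Matrix.of_apply, Matrix.conjTranspose_apply, star_sum,
    Finset.sum_mul, Finset.mul_sum, apply_ite star, star_zero, ite_mul, zero_mul, mul_ite, mul_zero]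
  rw [Finset.sum_comm]
  simp [Finset.sum_comm (s := (Finset.univ : Finset τ))]

section Positive
variable {W : Type} [Fintype W] [DecidableEq W]

theorem Gate.apply_posSemidef (g : Gate W) {ρ : Op W} (hρ : ρ.PosSemidef) :
    (g.apply ρ).PosSemidef := by
  cases g with
  | mcx ctrl k h => exact hρ.submatrix (Gate.flip ctrl k)
  | had i =>
    have := posSemidef_combine hρ (fun (a : Bool) x => Function.update x i a)
      (fun a x => if x i && a then -1 else 1)
    convert this.smul half_nonneg_complex using 1
    ext x y
    simp only [Gate.apply, Matrix.smul_apply, Matrix.of_apply, smul_eq_mul, apply_ite star, star_neg,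
      star_one]
    congr 1
    refine Finset.sum_congr rfl fun a _ => Finset.sum_congr rfl fun b _ => ?_
    ring
  | tgate i =>
    have := posSemidef_combine hρ (fun (_ : Unit) x => x)
      (fun _ x => if x i then Complex.exp (Real.pi / 4 * Complex.I) else 1)
    convert this using 1
    ext x y
    simp only [Gate.apply, Matrix.of_apply, Finset.univ_unique, Finset.sum_singleton,
      apply_ite star, star_one]
    congr 2
    simp [← Complex.exp_conj, map_ofNat]
  | reset i =>
    have := Matrix.posSemidef_sum (Finset.univ : Finset Bool) fun a _ =>
      posSemidef_combine hρ (fun (_ : Unit) x => Function.update x i a)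
        (fun _ x => if x i = false then 1 else 0)
    convert this using 1
    ext x y
    simp only [Gate.apply, Matrix.sum_apply, Matrix.of_apply, Finset.univ_unique,
      Finset.sum_singleton, apply_ite star, star_one, star_zero]
    cases x i <;> cases y i <;> simp
  | coin i =>
    -- One Kraus operator for each pair of a discarded value `a` and a new value `b`, with weight
    -- one half.
    have := (Matrix.posSemidef_sum (Finset.univ : Finset Bool) fun b _ =>
      Matrix.posSemidef_sum (Finset.univ : Finset Bool) fun a _ =>
        posSemidef_combine hρ (fun (_ : Unit) x => Function.update x i a)
          (fun _ x => if x i = b then 1 else 0)).smul half_nonneg_complex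
    convert this using 1
    ext x y
    simp only [Gate.apply, Matrix.smul_apply, Matrix.sum_apply, Matrix.of_apply,
      Finset.univ_unique, Finset.sum_singleton, apply_ite star, star_one, star_zero]
    cases x i <;> cases y i <;> simp

/-- Writing each measurement operator as `Rᴴ * R` gives Kraus operators indexed by the outcome `s`,
the discarded content `w` of the answer register, and a row `b` of `R`. -/
theorem queryMap_posSemidef {A B : Type} [Fintype A] [DecidableEq A] [Fintype B] [DecidableEq B]
    (inp : A ↪ W) (ans : B ↪ W) {M : (B → Bool) → Op A} (hM : ∀ s, (M s).PosSemidef)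
    {ρ : Op W} (hρ : ρ.PosSemidef) : (queryMap inp ans M ρ).PosSemidef := by
  have hroot : ∀ s, ∃ R : Op A, M s = R.conjTranspose * R := fun s => by
    open scoped MatrixOrder in
    exact CStarAlgebra.nonneg_iff_eq_star_mul_self.mp (hM s).nonneg
  choose R hR using hroot
  have := Matrix.posSemidef_sum (Finset.univ : Finset (B → Bool)) fun s _ =>
    Matrix.posSemidef_sum (Finset.univ : Finset (B → Bool)) fun w _ =>
    Matrix.posSemidef_sum (Finset.univ : Finset (A → Bool)) fun b _ =>
      posSemidef_combine hρ
        (fun (u : A → Bool) x => Function.extend inp u (Function.extend ans w x))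
        (fun u x => if (∀ a, x (inp a) = false) ∧ x ∘ ans = s then R s b u else 0)
  convert this using 1
  ext x y
  simp only [queryMap, Matrix.sum_apply, Matrix.of_apply, apply_ite star, star_zero]
  rw [Finset.sum_eq_single (x ∘ ans) (fun s _ hs => by simp [hs.symm]) (by simp)]
  by_cases h1 : (∀ a, x (inp a) = false) ∧ (∀ a, y (inp a) = false) ∧ x ∘ ans = y ∘ ans
  · rw [if_pos h1]
    obtain ⟨h1, h2, h3⟩ := h1
    simp only [h1, h2, h3, implies_true, and_self, if_true]
    symm
    rw [Finset.sum_congr rfl fun w _ => Finset.sum_comm, Finset.sum_comm]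
    refine Finset.sum_congr rfl fun u _ => ?_
    rw [Finset.sum_congr rfl fun w _ => Finset.sum_comm, Finset.sum_comm]
    refine Finset.sum_congr rfl fun v _ => Finset.sum_congr rfl fun w _ => ?_
    rw [hR (y ∘ ans), Matrix.mul_apply, Finset.sum_mul]
    refine Finset.sum_congr rfl fun b _ => ?_
    rw [Matrix.conjTranspose_apply]
    ring
  · rw [if_neg h1]
    symm
    refine Finset.sum_eq_zero fun w _ => Finset.sum_eq_zero fun b _ => Finset.sum_eq_zero
      fun u _ => Finset.sum_eq_zero fun v _ => ?_
    by_cases h2 : ∀ a, x (inp a) = false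
    · by_cases h3 : (∀ a, y (inp a) = false) ∧ y ∘ ans = x ∘ ans
      · exact absurd ⟨h2, h3.1, h3.2.symm⟩ h1
      · rw [if_neg h3, mul_zero]
    · rw [if_neg fun h => h2 h.1, zero_mul, zero_mul]

theorem Instr.apply_posSemidef {T : OracleType} {O : Oracle T}
    (hO : ∀ k s, (O k s).PosSemidef) (i : Instr T W) {ρ : Op W} (hρ : ρ.PosSemidef) :
    (i.apply O ρ).PosSemidef := by
  cases i with
  | gate g => exact g.apply_posSemidef hρ
  | query k inp ans h => exact queryMap_posSemidef inp ans (hO k) hρ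

theorem basis_posSemidef (x : W → Bool) : (basis x).PosSemidef := by
  have : basis x = Matrix.diagonal (Pi.single x 1) := by
    rw [Matrix.diagonal_single]; rfl
  rw [this]
  refine Matrix.PosSemidef.diagonal fun y => ?_
  by_cases h : y = x
  · subst h; simp
  · simp [h]

theorem runGates_posSemidef (gs : List (Gate W)) {ρ : Op W} (hρ : ρ.PosSemidef) :
    (runGates gs ρ).PosSemidef := by
  induction gs generalizing ρ with
  | nil => exact hρ
  | cons g gs ih => exact ih (g.apply_posSemidef hρ)

theorem runInstrs_posSemidef {T : OracleType} {O : Oracle T} (hO : ∀ k s, (O k s).PosSemidef)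
    (is : List (Instr T W)) {ρ : Op W} (hρ : ρ.PosSemidef) : (runInstrs O is ρ).PosSemidef := by
  induction is generalizing ρ with
  | nil => exact hρ
  | cons i is ih => exact ih (i.apply_posSemidef hO hρ)

end Positive

/-! ## Preservation of the trace -/

section Trace
variable {W : Type} [Fintype W] [DecidableEq W]

theorem Gate.flip_flip (ctrl : Finset W) (k : W) (h : k ∉ ctrl) (x : W → Bool) :
    Gate.flip ctrl k (Gate.flip ctrl k x) = x := by
  have hne : ∀ i ∈ ctrl, i ≠ k := fun i hi hik => h (hik ▸ hi)
  by_cases hx : ∀ i ∈ ctrl, x i = true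
  · have hx' : ∀ i ∈ ctrl, Function.update x k (!x k) i = true := fun i hi => by
      rw [Function.update_of_ne (hne i hi), hx i hi]
    simp [Gate.flip, if_pos hx, if_pos hx']
  · simp [Gate.flip, if_neg hx]

theorem Gate.trace_apply (g : Gate W) (ρ : Op W) : ∑ x, g.apply ρ x x = ∑ x, ρ x x := by
  cases g with
  | mcx ctrl k h =>
    have hf : Function.Involutive (Gate.flip ctrl k) := Gate.flip_flip ctrl k h
    exact Fintype.sum_equiv hf.toPerm _ _ fun x => rfl
  | had i =>
    refine sum_update_cancel i fun x => ?_
    simp [Gate.apply]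
    ring
  | tgate i =>
    refine Finset.sum_congr rfl fun x _ => ?_
    simp only [Gate.apply]
    split_ifs
    · rw [mul_right_comm, ← Complex.exp_add]
      simp
    · ring
  | reset i =>
    refine sum_update_cancel i fun x => ?_
    simp [Gate.apply]
  | coin i =>
    refine sum_update_cancel i fun x => ?_
    simp [Gate.apply]

theorem runGates_trace (gs : List (Gate W)) (ρ : Op W) :
    ∑ x, runGates gs ρ x x = ∑ x, ρ x x := by
  induction gs generalizing ρ with
  | nil => rfl
  | cons g gs ih => exact (ih (g.apply ρ)).trans (g.trace_apply ρ)

/-- After averaging over the contents of both registers, only the zero content of `inp` survives.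
There the sum over answers replaces the measurement operators by the identity, which keeps exactly
the terms with equal row and column. -/
theorem queryMap_trace {A B : Type} [Fintype A] [DecidableEq A] [Fintype B] [DecidableEq B]
    (inp : A ↪ W) (ans : B ↪ W) (h : ∀ a b, inp a ≠ ans b) {M : (B → Bool) → Op A}
    (hM : ∑ s, M s = 1) (ρ : Op W) : ∑ x, queryMap inp ans M ρ x x = ∑ x, ρ x x := by
  have key : ∀ F : (W → Bool) → ℂ, ∑ x, ∑ p : A → Bool, ∑ q : B → Bool,
      F (Function.extend inp p (Function.extend ans q x)) =
        ∑ _q : B → Bool, ∑ _p : A → Bool, ∑ x, F x := fun F => by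
    rw [Finset.sum_congr rfl fun x _ => Finset.sum_comm,
      sum_sum_extend ans fun y => ∑ p : A → Bool, F (Function.extend inp p y), Finset.sum_comm]
    refine Finset.sum_congr rfl fun q _ => ?_
    rw [sum_sum_extend inp F, Finset.sum_comm]
  have h1 := key fun x => queryMap inp ans M ρ x x
  have h2 := key fun x => ρ x x
  have h3 : ∀ x, ∑ p : A → Bool, ∑ q : B → Bool,
      queryMap inp ans M ρ (Function.extend inp p (Function.extend ans q x))
        (Function.extend inp p (Function.extend ans q x)) =
      ∑ p : A → Bool, ∑ q : B → Bool, ρ (Function.extend inp p (Function.extend ans q x))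
        (Function.extend inp p (Function.extend ans q x)) := fun x => by
    have hin : ∀ (p : A → Bool) (q : B → Bool) (a : A),
        Function.extend inp p (Function.extend ans q x) (inp a) = p a := fun p q a =>
      inp.injective.extend_apply _ _ a
    have hans : ∀ (p : A → Bool) (q : B → Bool),
        Function.extend inp p (Function.extend ans q x) ∘ ans = q := fun p q => by
      rw [extend_comp_of_disjoint inp ans h, extend_comp_self]
    have hext : ∀ (u p : A → Bool) (w q : B → Bool), Function.extend inp u (Function.extend ans w
        (Function.extend inp p (Function.extend ans q x))) =
          Function.extend inp u (Function.extend ans w x) := fun u p w q => by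
      rw [← extend_comm inp ans h, extend_extend, extend_extend]
    rw [Finset.sum_eq_single (fun _ => false)]
    · simp only [queryMap, hin, hans, hext, implies_true, and_self, if_true]
      rw [Finset.sum_comm]
      refine Finset.sum_congr rfl fun u _ => ?_
      rw [Finset.sum_comm]
      have h4 : ∀ v, ∑ q, M q v u = if v = u then 1 else 0 := fun v => by
        have := congrFun (congrFun hM v) u
        rw [Matrix.sum_apply, Matrix.one_apply] at this
        exact this
      have h5 : ∀ v, ∑ q, ∑ w, M q v u * ρ (Function.extend inp u (Function.extend ans w x))
          (Function.extend inp v (Function.extend ans w x)) = if v = u then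
            ∑ w, ρ (Function.extend inp u (Function.extend ans w x))
              (Function.extend inp v (Function.extend ans w x)) else 0 := fun v => by
        refine (Fintype.sum_mul_sum (fun q => M q v u) fun w => ρ (Function.extend inp u
          (Function.extend ans w x)) (Function.extend inp v (Function.extend ans w x))).symm.trans ?_
        rw [h4, ite_mul, one_mul, zero_mul]
      refine (Finset.sum_congr rfl fun v _ => h5 v).trans ?_
      simp
    · intro p _ hp
      refine Finset.sum_eq_zero fun q _ => ?_
      simp only [queryMap, hin]
      rw [if_neg]
      exact fun h => hp (funext h.1)
    · simp
  simp only [h3] at h1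
  rw [h1] at h2
  simp only [Finset.sum_const, nsmul_eq_mul] at h2
  refine mul_left_cancel₀ ?_ (mul_left_cancel₀ ?_ h2) <;> simp

theorem Instr.trace_apply {T : OracleType} {O : Oracle T} (hO : O.IsMeasurement)
    (i : Instr T W) (ρ : Op W) : ∑ x, i.apply O ρ x x = ∑ x, ρ x x := by
  cases i with
  | gate g => exact g.trace_apply ρ
  | query k inp ans h => exact queryMap_trace inp ans h (hO k).2 ρ

theorem runInstrs_trace {T : OracleType} {O : Oracle T} (hO : O.IsMeasurement)
    (is : List (Instr T W)) (ρ : Op W) :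
    ∑ x, runInstrs O is ρ x x = ∑ x, ρ x x := by
  induction is generalizing ρ with
  | nil => rfl
  | cons i is ih => exact (ih (i.apply O ρ)).trans (i.trace_apply hO ρ)

theorem trace_basis (x : W → Bool) : ∑ y, basis x y y = 1 := by
  simp [basis, Matrix.single_apply]

theorem probOne_nonneg (i : W) {ρ : Op W} (hρ : ρ.PosSemidef) : 0 ≤ probOne i ρ := by
  refine Finset.sum_nonneg fun z _ => ?_
  split_ifs
  · exact (Complex.le_def.mp (hρ.diag_nonneg (i := z))).1
  · exact le_rfl

theorem probOne_le_one (i : W) {ρ : Op W} (hρ : ρ.PosSemidef) (h : ∑ x, ρ x x = 1) :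
    probOne i ρ ≤ 1 := by
  have h1 : ∑ x, (ρ x x).re = 1 := by rw [← Complex.re_sum, h, Complex.one_re]
  rw [← h1]
  refine Finset.sum_le_sum fun z _ => ?_
  split_ifs
  · exact le_rfl
  · exact (Complex.le_def.mp (hρ.diag_nonneg (i := z))).1

end Trace

/-! ## Locality -/

section Slice
variable {V W : Type} [DecidableEq V] [DecidableEq W]

/-- The block of an operator on `W` in which the wires outside of the range of `e` are fixed to
their values in `x` and `y`. -/
def slice (e : V ↪ W) (x y : W → Bool) (ρ : Op W) : Op V :=
  fun u v => ρ (Function.extend e u x) (Function.extend e v y)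

theorem slice_comp (e : V ↪ W) (x y : W → Bool) (ρ : Op W) :
    slice e x y ρ (x ∘ e) (y ∘ e) = ρ x y := by
  rw [slice, extend_comp_eq, extend_comp_eq]

theorem update_extend (e : V ↪ W) (u : V → Bool) (x : W → Bool) (i : V) (a : Bool) :
    Function.update (Function.extend e u x) (e i) a =
      Function.extend e (Function.update u i a) x := by
  funext k
  by_cases hk : ∃ j, e j = k
  · obtain ⟨j, rfl⟩ := hk
    rw [e.injective.extend_apply]
    by_cases hj : j = i
    · subst hj; simp
    · rw [Function.update_of_ne (fun h => hj (e.injective h)), Function.update_of_ne hj,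
        e.injective.extend_apply]
  · rw [Function.extend_apply' _ _ _ hk, Function.update_of_ne (fun h => hk ⟨i, h.symm⟩),
      Function.extend_apply' _ _ _ hk]

theorem flip_extend (e : V ↪ W) (ctrl : Finset V) (k : V) (u : V → Bool) (x : W → Bool) :
    Gate.flip (ctrl.map e) (e k) (Function.extend e u x) =
      Function.extend e (Gate.flip ctrl k u) x := by
  have h : (∀ i ∈ ctrl.map e, Function.extend e u x i = true) ↔ ∀ i ∈ ctrl, u i = true := by
    simp [e.injective.extend_apply]
  unfold Gate.flip
  simp only [h, e.injective.extend_apply, update_extend]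
  split_ifs <;> rfl

/-- A gate touches only its own wires, so it commutes with freezing the others, even to different
values in row and column. The off-diagonal blocks matter because they carry the entanglement with
the rest of the register. -/
theorem slice_gate (e : V ↪ W) (x y : W → Bool) (g : Gate V) (ρ : Op W) :
    slice e x y ((g.map e).apply ρ) = g.apply (slice e x y ρ) := by
  ext u v
  cases g <;>
    simp only [slice, Gate.map, Gate.apply, flip_extend, update_extend, e.injective.extend_apply]

theorem slice_runGates (e : V ↪ W) (x y : W → Bool) (gs : List (Gate V)) (ρ : Op W) :
    slice e x y (runGates (gs.map (Gate.map e)) ρ) = runGates gs (slice e x y ρ) := by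
  induction gs generalizing ρ with
  | nil => rfl
  | cons g gs ih => rw [List.map_cons, runGates_cons, runGates_cons, ih, slice_gate]

theorem runGates_map_apply (e : V ↪ W) (gs : List (Gate V)) (ρ : Op W) (x y : W → Bool) :
    runGates (gs.map (Gate.map e)) ρ x y = runGates gs (slice e x y ρ) (x ∘ e) (y ∘ e) := by
  rw [← slice_runGates, slice_comp]

theorem slice_queryMap {A B : Type} [Fintype A] [DecidableEq A] [Fintype B] [DecidableEq B]
    (e : V ↪ W) (inp : A ↪ V) (ans : B ↪ V) (M : (B → Bool) → Op A) (x y : W → Bool) (ρ : Op W) :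
    slice e x y (queryMap (inp.trans e) (ans.trans e) M ρ) =
      queryMap inp ans M (slice e x y ρ) := by
  ext u v
  have h1 : ∀ (u : V → Bool) (x : W → Bool) (a : A),
      Function.extend e u x ((inp.trans e) a) = u (inp a) := fun u x a =>
    e.injective.extend_apply _ _ _
  have h2 : ∀ (u : V → Bool) (x : W → Bool), Function.extend e u x ∘ (ans.trans e) = u ∘ ans :=
    fun u x => funext fun b => e.injective.extend_apply _ _ _
  have h3 : ∀ (C : Type) (f : C ↪ V) (w : C → Bool) (u : V → Bool) (x : W → Bool),
      Function.extend (f.trans e) w (Function.extend e u x) =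
        Function.extend e (Function.extend f w u) x := fun C f w u x => by
    rw [extend_trans, extend_comp_self, extend_extend]
  simp only [slice, queryMap, h1, h2, h3]

end Slice

/-! ### States padded with wires in the zero state -/

section Pad
variable {V W : Type} [DecidableEq V] [DecidableEq W]

/-- All wires outside of the range of `e` are `0`. -/
def ZeroOff (e : V ↪ W) (x : W → Bool) : Prop := ∀ k, (∀ a, e a ≠ k) → x k = false

open Classical in
/-- The state `ρ` on the wires selected by `e`, all other wires being `|0⟩`. -/
def pad (e : V ↪ W) (ρ : Op V) : Op W :=
  fun x y => if ZeroOff e x ∧ ZeroOff e y then ρ (x ∘ e) (y ∘ e) else 0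

theorem pad_of_zeroOff {e : V ↪ W} {x y : W → Bool} (hx : ZeroOff e x) (hy : ZeroOff e y)
    (ρ : Op V) : pad e ρ x y = ρ (x ∘ e) (y ∘ e) := if_pos ⟨hx, hy⟩

theorem pad_eq_zero {e : V ↪ W} {x y : W → Bool} (h : ¬(ZeroOff e x ∧ ZeroOff e y)) (ρ : Op V) :
    pad e ρ x y = 0 := if_neg h

theorem runGates_zero (gs : List (Gate W)) : runGates gs (0 : Op W) = 0 :=
  (runGatesₗ gs).map_zero

theorem zeroOff_extend (e : V ↪ W) (u : V → Bool) (x : W → Bool) :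
    ZeroOff e (Function.extend e u x) ↔ ZeroOff e x := by
  refine forall₂_congr fun k hk => ?_
  rw [Function.extend_apply' _ _ _ (by simpa using hk)]

theorem slice_pad_self (e : V ↪ W) {x y : W → Bool} (hx : ZeroOff e x) (hy : ZeroOff e y)
    (ρ : Op V) : slice e x y (pad e ρ) = ρ := by
  ext u v
  rw [slice, pad_of_zeroOff ((zeroOff_extend _ _ _).2 hx) ((zeroOff_extend _ _ _).2 hy),
    extend_comp_self, extend_comp_self]

theorem runGates_map_pad (e : V ↪ W) (gs : List (Gate V)) (ρ : Op V) :
    runGates (gs.map (Gate.map e)) (pad e ρ) = pad e (runGates gs ρ) := by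
  ext x y
  rw [runGates_map_apply]
  by_cases h : ZeroOff e x ∧ ZeroOff e y
  · rw [slice_pad_self e h.1 h.2, pad_of_zeroOff h.1 h.2]
  · rw [pad_eq_zero h]
    have : slice e x y (pad e ρ) = 0 := by
      ext u v
      rw [slice, pad_eq_zero]
      · rfl
      · simpa only [zeroOff_extend] using h
    rw [this, runGates_zero]
    rfl

/-- Fresh work wires as in `Circuit.run` become a case of `pad`, so circuits and devices are handled
by the same lemmas. -/
theorem tensor_basis_zero {N : Type} [Fintype N] [DecidableEq N] (ρ : Op V) :
    tensor ρ (basis fun _ : N => false) = pad Function.Embedding.inl ρ := by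
  have key : ∀ x : V ⊕ N → Bool, ZeroOff Function.Embedding.inl x ↔
      (fun _ => false) = x ∘ Sum.inr := fun x => by
    constructor
    · intro h
      funext n
      exact (h (Sum.inr n) (by simp)).symm
    · rintro h (a | n) hk
      · exact absurd rfl (hk a)
      · exact (congrFun h n).symm
  ext x y
  simp only [tensor, basis, Matrix.single_apply, pad, key]
  split_ifs
  · simp
    rfl
  all_goals simp

theorem pad_basis_zero [Fintype V] [Fintype W] (e : V ↪ W) :
    pad e (basis fun _ => false) = basis fun _ => false := by
  have key : ∀ x : W → Bool, (fun _ => false) = x ↔ ZeroOff e x ∧ (fun _ => false) = x ∘ e := by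
    intro x
    constructor
    · rintro rfl
      exact ⟨fun _ _ => rfl, rfl⟩
    · rintro ⟨h1, h2⟩
      funext k
      by_cases hk : ∃ a, e a = k
      · obtain ⟨a, rfl⟩ := hk
        exact congrFun h2 a
      · exact (h1 k (by simpa using hk)).symm
  ext x y
  have hx := key x
  have hy := key y
  simp only [basis, Matrix.single_apply, pad]
  split_ifs <;> first | rfl | (exfalso; tauto)

variable [Fintype V] [Fintype W]

theorem sum_zeroOff (e : V ↪ W) (F : (W → Bool) → ℂ) (G : (V → Bool) → ℂ)
    (h0 : ∀ x, ¬ZeroOff e x → F x = 0) (h1 : ∀ x, ZeroOff e x → F x = G (x ∘ e)) :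
    ∑ x, F x = ∑ u, G u := by
  symm
  refine Finset.sum_of_injOn (fun u => Function.extend e u fun _ => false) ?_ (by simp) ?_ ?_
  · intro u _ v _ huv
    have := congrArg (· ∘ e) huv
    simpa only [extend_comp_self] using this
  · intro x _ hx
    refine h0 x fun hz => hx ⟨x ∘ e, by simp, ?_⟩
    funext k
    by_cases hk : ∃ a, e a = k
    · obtain ⟨a, rfl⟩ := hk
      exact e.injective.extend_apply _ _ _
    · refine (Function.extend_apply' _ _ _ hk).trans (hz k (by simpa using hk)).symm
  · intro u _
    rw [h1 _ ((zeroOff_extend _ _ _).2 fun _ _ => rfl), extend_comp_self]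

theorem trace_pad (e : V ↪ W) (ρ : Op V) : ∑ x, pad e ρ x x = ∑ u, ρ u u :=
  sum_zeroOff e _ _ (fun _ h => pad_eq_zero (fun h' => h h'.1) _) fun _ h => pad_of_zeroOff h h _

theorem probOne_pad (e : V ↪ W) (i : V) (ρ : Op V) : probOne (e i) (pad e ρ) = probOne i ρ := by
  have h := sum_zeroOff e (fun x => if x (e i) = true then pad e ρ x x else 0)
    (fun u => if u i = true then ρ u u else 0)
    (fun x h => by simp only [pad_eq_zero (fun h' => h h'.1), ite_self])
    fun x h => by simp only [pad_of_zeroOff h h, Function.comp_apply]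
  have h' := congrArg Complex.re h
  simpa only [probOne, Complex.re_sum, apply_ite Complex.re, Complex.zero_re] using h'

end Pad

/-! ### Simulating an operation inside a larger register -/

section Simulate
variable {V W A N : Type} [DecidableEq V] [DecidableEq W] [DecidableEq A] [DecidableEq N]

/-- Gates that implement the operation `Q` on the wires `A` with the help of ancillas `N` can be
used to apply `Q` to some of the wires of a larger register. -/
theorem runGates_simulate (gs : List (Gate (A ⊕ N))) (Q : Op A → Op A) (Q' : Op V → Op V)
    (hgs : ∀ τ, runGates gs (pad Function.Embedding.inl τ) = pad Function.Embedding.inl (Q τ))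
    (j : A ↪ V) (hQ : ∀ x y ρ, slice j x y (Q' ρ) = Q (slice j x y ρ))
    (e : V ↪ W) (f : A ⊕ N ↪ W) (hf : ∀ a, f (Sum.inl a) = e (j a))
    (hdis : ∀ n v, f (Sum.inr n) ≠ e v) (ρ : Op V) :
    runGates (gs.map (Gate.map f)) (pad e ρ) = pad e (Q' ρ) := by
  ext x y
  rw [runGates_map_apply]
  -- The wires that belong neither to the old register nor to the ancillas are zero. They are never
  -- touched, so both sides vanish where this fails.
  let P : (W → Bool) → Prop := fun x =>
    ∀ k, (∀ v, e v ≠ k) → (∀ n, f (Sum.inr n) ≠ k) → x k = false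
  have hoff : ∀ (u : A ⊕ N → Bool) (x : W → Bool), ZeroOff e (Function.extend f u x) ↔
      P x ∧ ZeroOff Function.Embedding.inl u := fun u x => by
    constructor
    · intro h
      refine ⟨fun k h1 h2 => ?_, fun k hk => ?_⟩
      · rw [← h k h1, Function.extend_apply']
        rintro ⟨a | n, ha⟩
        · exact h1 (j a) (by rw [← hf, ha])
        · exact h2 n ha
      · rcases k with a | n
        · exact absurd rfl (hk a)
        · rw [← h (f (Sum.inr n)) fun v hv => hdis n v hv.symm, f.injective.extend_apply]
    · rintro ⟨h1, h2⟩ k hk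
      by_cases hn : ∃ n, f (Sum.inr n) = k
      · obtain ⟨n, rfl⟩ := hn
        rw [f.injective.extend_apply]
        exact h2 _ (by simp)
      · rw [Function.extend_apply']
        · exact h1 k hk (by simpa using hn)
        · rintro ⟨a | n, ha⟩
          · exact hk (j a) (by rw [← hf, ha])
          · exact hn ⟨n, ha⟩
  have hcomp : ∀ (u : A ⊕ N → Bool) (x : W → Bool), Function.extend f u x ∘ e =
      Function.extend j (u ∘ Sum.inl) (x ∘ e) := fun u x => by
    funext v
    by_cases hv : ∃ a, j a = v
    · obtain ⟨a, rfl⟩ := hv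
      rw [j.injective.extend_apply, Function.comp_apply, ← hf, f.injective.extend_apply]
      rfl
    · rw [Function.extend_apply' _ _ _ hv, Function.comp_apply, Function.extend_apply']
      · rfl
      · rintro ⟨a | n, ha⟩
        · exact hv ⟨a, e.injective (by rw [← hf, ha])⟩
        · exact hdis n v ha
  have hx : ∀ x : W → Bool, ZeroOff e x ↔
      P x ∧ ZeroOff Function.Embedding.inl (x ∘ f) := fun x => by
    rw [← hoff, extend_comp_eq]
  have hfe : ∀ x : W → Bool, (x ∘ f) ∘ Function.Embedding.inl = (x ∘ e) ∘ j := fun x =>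
    funext fun a => congrArg x (hf a)
  by_cases h : P x ∧ P y
  -- Seen from the wires `f`, the state is a block of `ρ` with fresh ancillas. Such a block is not a
  -- density operator in general, which is why `hgs` is required for every `τ`.
  · have hs : slice f x y (pad e ρ) =
        pad Function.Embedding.inl (slice j (x ∘ e) (y ∘ e) ρ) := by
      ext u v
      rw [slice]
      by_cases h2 : ZeroOff Function.Embedding.inl u ∧ ZeroOff Function.Embedding.inl v
      · rw [pad_of_zeroOff ((hoff _ _).2 ⟨h.1, h2.1⟩) ((hoff _ _).2 ⟨h.2, h2.2⟩),
          pad_of_zeroOff h2.1 h2.2, hcomp, hcomp]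
        rfl
      · rw [pad_eq_zero h2, pad_eq_zero]
        rw [hoff, hoff]
        tauto
    rw [hs, hgs, ← hQ]
    by_cases h2 : ZeroOff Function.Embedding.inl (x ∘ f) ∧ ZeroOff Function.Embedding.inl (y ∘ f)
    · rw [pad_of_zeroOff h2.1 h2.2, pad_of_zeroOff ((hx x).2 ⟨h.1, h2.1⟩) ((hx y).2 ⟨h.2, h2.2⟩),
        hfe, hfe, slice_comp]
    · rw [pad_eq_zero h2, pad_eq_zero]
      rw [hx, hx]
      tauto
  · have hs : slice f x y (pad e ρ) = 0 := by
      ext u v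
      rw [slice, pad_eq_zero]
      · rfl
      · rw [hoff, hoff]
        tauto
    rw [hs, runGates_zero, pad_eq_zero]
    · rfl
    · rw [hx, hx]
      tauto

end Simulate

/-! ## Operations on whole registers -/

section Registers
variable {U W : Type} [Fintype U] [DecidableEq U] [Fintype W] [DecidableEq W]

/-- Reset the wires selected by `f`. -/
def resetAll (f : U ↪ W) : List (Gate W) := Finset.univ.toList.map fun u => Gate.reset (f u)

/-- Replace the wires selected by `f` by random bits. -/
def coinAll (f : U ↪ W) : List (Gate W) := Finset.univ.toList.map fun u => Gate.coin (f u)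

theorem resetAll_eq_map (f : U ↪ W) :
    resetAll f = (resetAll (Function.Embedding.refl U)).map (Gate.map f) := by
  rw [resetAll, resetAll, List.map_map]; rfl

theorem coinAll_eq_map (f : U ↪ W) :
    coinAll f = (coinAll (Function.Embedding.refl U)).map (Gate.map f) := by
  rw [coinAll, coinAll, List.map_map]; rfl

/-- The disjunction is the invariant of the induction: wire `i` either is still to be reset or has
been cleared already, and resets of other wires keep it cleared. -/
theorem runGates_resets_eq_zero (l : List U) (ρ : Op U) (x y : U → Bool)
    (h : ∃ i, ¬(x i = false ∧ y i = false) ∧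
      (i ∈ l ∨ ∀ x y, ¬(x i = false ∧ y i = false) → ρ x y = 0)) :
    runGates (l.map Gate.reset) ρ x y = 0 := by
  induction l generalizing ρ with
  | nil =>
    obtain ⟨i, hi, h | h⟩ := h
    · simp at h
    · exact h x y hi
  | cons j l ih =>
    rw [List.map_cons, runGates_cons]
    refine ih _ ?_
    obtain ⟨i, hi, h⟩ := h
    refine ⟨i, hi, ?_⟩
    by_cases hij : i = j
    · subst hij
      exact .inr fun x y hxy => if_neg hxy
    · rcases h with h | h
      · exact .inl (List.mem_of_ne_of_mem hij h)
      · refine .inr fun x y hxy => ?_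
        simp only [Gate.apply]
        split_ifs
        · refine Finset.sum_eq_zero fun a _ => h _ _ ?_
          rwa [Function.update_of_ne hij, Function.update_of_ne hij]
        · rfl

/-- Only the entry at zero survives the resets, and preservation of the trace determines it. -/
theorem runGates_resetAll_refl (ρ : Op U) (x y : U → Bool) :
    runGates (resetAll (Function.Embedding.refl U)) ρ x y =
      if ∀ i, x i = false ∧ y i = false then ∑ w, ρ w w else 0 := by
  have hz : ∀ x y : U → Bool, (¬∀ i, x i = false ∧ y i = false) →
      runGates (resetAll (Function.Embedding.refl U)) ρ x y = 0 := fun x y h => by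
    obtain ⟨i, hi⟩ := not_forall.mp h
    exact runGates_resets_eq_zero _ ρ x y ⟨i, hi, .inl (by simp)⟩
  split_ifs with h
  · have hx : x = fun _ => false := funext fun i => (h i).1
    have hy : y = fun _ => false := funext fun i => (h i).2
    rw [← runGates_trace (resetAll (Function.Embedding.refl U)) ρ, hx, hy]
    symm
    refine Fintype.sum_eq_single (fun _ : U => false) fun z hne => hz z z fun h' => ?_
    exact hne (funext fun i => (h' i).1)
  · exact hz x y h

theorem runGates_resetAll (f : U ↪ W) (ρ : Op W) (x y : W → Bool) :
    runGates (resetAll f) ρ x y = if ∀ i, x (f i) = false ∧ y (f i) = false then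
      ∑ w : U → Bool, ρ (Function.extend f w x) (Function.extend f w y) else 0 := by
  rw [resetAll_eq_map, runGates_map_apply, runGates_resetAll_refl]
  rfl

/-- Same invariant as for resets: once wire `i` has been randomized, the diagonal no longer depends
on it, and coins on other wires preserve this. -/
theorem runGates_coins_diag (l : List U) (ρ : Op U) (i : U)
    (h : i ∈ l ∨ ∀ x a, ρ (Function.update x i a) (Function.update x i a) = ρ x x)
    (x : U → Bool) (a : Bool) :
    runGates (l.map Gate.coin) ρ (Function.update x i a) (Function.update x i a) =
      runGates (l.map Gate.coin) ρ x x := by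
  induction l generalizing ρ with
  | nil =>
    rcases h with h | h
    · simp at h
    · exact h x a
  | cons j l ih =>
    rw [List.map_cons, runGates_cons]
    refine ih _ ?_
    by_cases hij : i = j
    · subst hij
      exact .inr fun x a => by simp [Gate.apply]
    · rcases h with h | h
      · exact .inl (List.mem_of_ne_of_mem hij h)
      · refine .inr fun x a => ?_
        simp only [Gate.apply, if_true]
        congr 1
        refine Finset.sum_congr rfl fun b _ => ?_
        rw [Function.update_comm hij, h]

/-- The diagonal does not change when any wire is changed, so it is constant, and the trace gives
the constant. Off-diagonal entries are not needed: later uses read only outcome probabilities. -/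
theorem runGates_coinAll_refl_diag (ρ : Op U) (x : U → Bool) :
    runGates (coinAll (Function.Embedding.refl U)) ρ x x =
      (1 / 2 ^ Fintype.card U : ℂ) * ∑ w, ρ w w := by
  have hinv : ∀ i x a, runGates (coinAll (Function.Embedding.refl U)) ρ
      (Function.update x i a) (Function.update x i a) =
        runGates (coinAll (Function.Embedding.refl U)) ρ x x := fun i x a =>
    runGates_coins_diag _ ρ i (.inl (by simp)) x a
  have hconst : ∀ z, runGates (coinAll (Function.Embedding.refl U)) ρ z z =
      runGates (coinAll (Function.Embedding.refl U)) ρ x x := fun z => by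
    have h : ∀ s : Finset U, runGates (coinAll (Function.Embedding.refl U)) ρ (s.piecewise z x)
        (s.piecewise z x) = runGates (coinAll (Function.Embedding.refl U)) ρ x x := fun s => by
      induction s using Finset.induction_on with
      | empty => simp
      | insert i s hi ih => rw [Finset.piecewise_insert, hinv, ih]
    simpa using h Finset.univ
  have h := runGates_trace (coinAll (Function.Embedding.refl U)) ρ
  simp only [hconst, Finset.sum_const, Finset.card_univ, Fintype.card_fun, Fintype.card_bool,
    nsmul_eq_mul] at h
  rw [← h]
  push_cast
  field_simp

theorem runGates_coinAll_diag (f : U ↪ W) (ρ : Op W) (x : W → Bool) :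
    runGates (coinAll f) ρ x x = (1 / 2 ^ Fintype.card U : ℂ) *
      ∑ w : U → Bool, ρ (Function.extend f w x) (Function.extend f w x) := by
  rw [coinAll_eq_map, runGates_map_apply, runGates_coinAll_refl_diag]
  rfl

theorem gatesCost_append (gs gs' : List (Gate W)) :
    gatesCost (gs ++ gs') = gatesCost gs + gatesCost gs' := by simp [gatesCost]

theorem Gate.cost_map {V : Type} (f : V ↪ W) (g : Gate V) : (g.map f).cost = g.cost := by
  cases g <;> simp [Gate.map, Gate.cost]

theorem gatesCost_map {V : Type} (f : V ↪ W) (gs : List (Gate V)) :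
    gatesCost (gs.map (Gate.map f)) = gatesCost gs := by
  rw [gatesCost, gatesCost, List.map_map]
  congr 1
  exact List.map_congr_left fun g _ => g.cost_map f

theorem gatesCost_resetAll (f : U ↪ W) : gatesCost (resetAll f) = Fintype.card U := by
  simp [gatesCost, resetAll, Function.comp_def, Gate.cost]

theorem gatesCost_coinAll (f : U ↪ W) : gatesCost (coinAll f) = Fintype.card U := by
  simp [gatesCost, coinAll, Function.comp_def, Gate.cost]

end Registers

/-! ## Tables -/

section Table
variable {A B W : Type} [Fintype A] [DecidableEq A] [Fintype B] [DecidableEq B]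
  [Fintype W] [DecidableEq W]

/-- The `b`-th bit of the sum of the monomials in the list `l`, evaluated at `u`. -/
def monomialSum (l : List (Finset A × B)) (u : A → Bool) (b : B) : Bool :=
  l.foldr (fun p acc => xor (decide (p.2 = b ∧ ∀ i ∈ p.1, u i = true)) acc) false

/-- Gates that add a sum of monomials in the wires `c` to the wires `t`. -/
def monomialGates (c : A ↪ W) (t : B ↪ W) (h : ∀ a b, c a ≠ t b) (l : List (Finset A × B)) :
    List (Gate W) :=
  l.map fun p => Gate.mcx (p.1.map c) (t p.2) (by simpa using fun a _ => h a p.2)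

/-- Add the function `g` of the wires `c` to the wires `t`. -/
def addTo (c : A ↪ W) (t : B ↪ W) (g : (A → Bool) → B → Bool) (x : W → Bool) : W → Bool :=
  Function.extend t (fun b => xor (x (t b)) (g (x ∘ c) b)) x

theorem addTo_comp (c : A ↪ W) (t : B ↪ W) (h : ∀ a b, c a ≠ t b) (g : (A → Bool) → B → Bool)
    (x : W → Bool) : addTo c t g x ∘ c = x ∘ c :=
  extend_comp_of_disjoint t c (fun b a hab => h a b hab.symm) _ _

/-- A NOT controlled on a set of wires adds the product of these wires to its target. The controls
are never targets, so the contributions accumulate independently of their order. -/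
theorem runGates_monomialGates (c : A ↪ W) (t : B ↪ W) (h : ∀ a b, c a ≠ t b)
    (l : List (Finset A × B)) (ρ : Op W) (x y : W → Bool) :
    runGates (monomialGates c t h l) ρ x y =
      ρ (addTo c t (monomialSum l) x) (addTo c t (monomialSum l) y) := by
  induction l generalizing ρ with
  | nil =>
    have : ∀ x : W → Bool, addTo c t (monomialSum []) x = x := fun x => by
      simp only [addTo, monomialSum, List.foldr_nil, Bool.xor_false]
      exact extend_comp_eq t x
    rw [this, this]
    rfl
  | cons p l ih =>
    rw [monomialGates, List.map_cons, runGates_cons]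
    refine (ih _).trans ?_
    have key : ∀ x : W → Bool, Gate.flip (p.1.map c) (t p.2) (addTo c t (monomialSum l) x) =
        addTo c t (monomialSum (p :: l)) x := fun x => by
      have h1 : (∀ i ∈ p.1.map c, addTo c t (monomialSum l) x i = true) ↔
          ∀ i ∈ p.1, (x ∘ c) i = true := by
        rw [← addTo_comp c t h (monomialSum l) x]
        simp
      funext k
      by_cases hk : ∃ b, t b = k
      · obtain ⟨b, rfl⟩ := hk
        simp only [Gate.flip, h1]
        by_cases hb : b = p.2
        · subst hb
          by_cases h2 : ∀ i ∈ p.1, (x ∘ c) i = true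
          · rw [if_pos h2, Function.update_self]
            simp only [addTo, t.injective.extend_apply, monomialSum, List.foldr_cons]
            have h5 : decide (True ∧ ∀ i ∈ p.1, (x ∘ c) i = true) = true :=
              decide_eq_true ⟨trivial, h2⟩
            rw [h5, Bool.true_xor, Bool.xor_not]
          · rw [if_neg h2]
            simp only [addTo, t.injective.extend_apply, monomialSum, List.foldr_cons]
            have h5 : decide (True ∧ ∀ i ∈ p.1, (x ∘ c) i = true) = false :=
              decide_eq_false fun h => h2 h.2
            rw [h5, Bool.false_xor]
        · have h3 : (if ∀ i ∈ p.1, (x ∘ c) i = true then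
              Function.update (addTo c t (monomialSum l) x) (t p.2)
                (!addTo c t (monomialSum l) x (t p.2)) else addTo c t (monomialSum l) x) (t b) =
              addTo c t (monomialSum l) x (t b) := by
            split_ifs
            · rw [Function.update_of_ne fun h => hb (t.injective h)]
            · rfl
          rw [h3]
          simp only [addTo, t.injective.extend_apply, monomialSum, List.foldr_cons]
          simp [Ne.symm hb]
      · have hk' : k ≠ t p.2 := fun h => hk ⟨p.2, h.symm⟩
        have h3 : Gate.flip (p.1.map c) (t p.2) (addTo c t (monomialSum l) x) k =
            addTo c t (monomialSum l) x k := by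
          unfold Gate.flip
          split_ifs
          · rw [Function.update_of_ne hk']
          · rfl
        rw [h3, addTo, addTo, Function.extend_apply' _ _ _ hk, Function.extend_apply' _ _ _ hk]
    rw [← key, ← key]
    rfl

/-- Every Boolean function is a sum of monomials. -/
theorem exists_monomials (g : (A → Bool) → Bool) :
    ∃ 𝒮 : Finset (Finset A), ∀ u, g u = true ↔
      ((𝒮.filter fun S => ∀ i ∈ S, u i = true).card : ZMod 2) = 1 := by
  -- This transform takes the coefficients of a multilinear polynomial over `ZMod 2` to its values.
  -- It is triangular for inclusion with ones on the diagonal, hence injective, and by finiteness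
  -- surjective.
  let E : (Finset A → ZMod 2) → Finset A → ZMod 2 := fun c X => ∑ S ∈ X.powerset, c S
  have hE : Function.Injective E := fun c c' h => by
    funext X
    induction X using Finset.strongInduction with
    | H X ih =>
      have hX := congrFun h X
      simp only [E] at hX
      rw [← Finset.sum_erase_add _ _ (Finset.mem_powerset_self X),
        ← Finset.sum_erase_add _ _ (Finset.mem_powerset_self X)] at hX
      rw [Finset.sum_congr rfl fun S hS => ih S ?_] at hX
      · exact add_left_cancel hX
      · rw [Finset.mem_erase, Finset.mem_powerset] at hS
        exact hS.2.ssubset_of_ne hS.1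
  obtain ⟨c, hc⟩ := (Finite.injective_iff_surjective.mp hE) fun X => if g (fun i => decide (i ∈ X)) then 1 else 0
  refine ⟨Finset.univ.filter fun S => c S = 1, fun u => ?_⟩
  have h := congrFun hc (Finset.univ.filter fun i => u i = true)
  simp only [E, Finset.mem_filter, Finset.mem_univ, true_and, Bool.decide_eq_true] at h
  have h01 : ∀ z : ZMod 2, z = if z = 1 then 1 else 0 := by decide
  have h2 : ∑ S ∈ (Finset.univ.filter fun i => u i = true).powerset, c S =
      (((Finset.univ.filter fun S => c S = 1).filter fun S => ∀ i ∈ S, u i = true).card : ZMod 2) := by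
    rw [Finset.sum_congr rfl fun S _ => h01 (c S), ← Finset.sum_filter, Finset.sum_const,
      nsmul_eq_mul, mul_one]
    congr 2
    ext S
    simp [Finset.subset_iff, and_comm]
  rw [← h2, h]
  split_ifs with h3 <;> simp [h3]

/-- The output bits are treated one by one. The length bound counts all pairs of a monomial and an
output bit; it is the source of the factor that is exponential in the number of control wires. -/
theorem exists_monomialSum (g : (A → Bool) → B → Bool) :
    ∃ l : List (Finset A × B), monomialSum l = g ∧
      l.length ≤ Fintype.card B * 2 ^ Fintype.card A := by
  choose 𝒮 h𝒮 using fun b => exists_monomials fun u => g u b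
  let toZ : Bool → ZMod 2 := fun b => if b then 1 else 0
  have hval : ∀ (l : List (Finset A × B)) u b, toZ (monomialSum l u b) =
      (l.map fun p => if p.2 = b ∧ ∀ i ∈ p.1, u i = true then (1 : ZMod 2) else 0).sum := by
    intro l u b
    induction l with
    | nil => rfl
    | cons p l ih =>
      have hx : ∀ a b, toZ (xor a b) = toZ a + toZ b := by decide
      rw [List.map_cons, List.sum_cons, ← ih, monomialSum, List.foldr_cons, hx]
      simp [toZ, monomialSum]
  let F : Finset (Finset A × B) := Finset.univ.filter fun p => p.1 ∈ 𝒮 p.2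
  refine ⟨F.toList, ?_, ?_⟩
  · funext u b
    have h1 := hval F.toList u b
    rw [Finset.sum_map_toList, ← Finset.sum_filter, Finset.sum_const, nsmul_eq_mul, mul_one] at h1
    have h2 : (F.filter fun p => p.2 = b ∧ ∀ i ∈ p.1, u i = true).card =
        ((𝒮 b).filter fun S => ∀ i ∈ S, u i = true).card := by
      symm
      refine Finset.card_bij (fun S _ => (S, b)) ?_ ?_ ?_
      · intro S hS
        simpa [F] using hS
      · intro S _ S' _ h
        exact (Prod.ext_iff.mp h).1
      · rintro ⟨S, b'⟩ hS
        simp only [F, Finset.mem_filter, Finset.mem_univ, true_and] at hS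
        obtain ⟨hS1, rfl, hS2⟩ := hS
        exact ⟨S, by simpa using ⟨hS1, hS2⟩, rfl⟩
    rw [h2] at h1
    have h3 := h𝒮 b u
    rw [← h1] at h3
    have h4 : ∀ a b : Bool, (a = true ↔ toZ b = 1) → b = a := by decide
    exact h4 _ _ h3
  · rw [Finset.length_toList]
    refine (Finset.card_le_univ _).trans ?_
    simp [mul_comm]

/-- Gates that add the function `g` of the wires `c` to the wires `t`. -/
def tableGates (c : A ↪ W) (t : B ↪ W) (h : ∀ a b, c a ≠ t b) (g : (A → Bool) → B → Bool) :
    List (Gate W) :=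
  monomialGates c t h (exists_monomialSum g).choose

theorem runGates_tableGates (c : A ↪ W) (t : B ↪ W) (h : ∀ a b, c a ≠ t b)
    (g : (A → Bool) → B → Bool) (ρ : Op W) (x y : W → Bool) :
    runGates (tableGates c t h g) ρ x y = ρ (addTo c t g x) (addTo c t g y) := by
  rw [tableGates, runGates_monomialGates, (exists_monomialSum g).choose_spec.1]

theorem gatesCost_tableGates (c : A ↪ W) (t : B ↪ W) (h : ∀ a b, c a ≠ t b)
    (g : (A → Bool) → B → Bool) : gatesCost (tableGates c t h g) ≤
      Fintype.card B * 2 ^ Fintype.card A * (1 + Fintype.card A) := by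
  refine le_trans ?_ (Nat.mul_le_mul_right _ (exists_monomialSum g).choose_spec.2)
  rw [tableGates, monomialGates, gatesCost, List.map_map]
  refine (List.sum_le_card_nsmul _ (1 + Fintype.card A) ?_).trans (by simp)
  intro k hk
  simp only [List.mem_map, Function.comp_apply, Gate.cost, Finset.card_map] at hk
  obtain ⟨p, _, rfl⟩ := hk
  exact Nat.add_le_add_left (Finset.card_le_univ _) 1

end Table

/-! ## Measurements that are implemented by circuits -/

/-- A circuit whose work wires are labelled by an arbitrary finite type. -/
structure Device (A B : Type) where
  Anc : Type
  [fintype : Fintype Anc]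
  [decEq : DecidableEq Anc]
  gates : List (Gate (A ⊕ Anc))
  out : B ↪ A ⊕ Anc

attribute [instance] Device.fintype Device.decEq

namespace Device
variable {A B : Type} [Fintype A] [DecidableEq A] [Fintype B] [DecidableEq B]

/-- The final state of all wires. -/
def final (D : Device A B) (ρ : Op A) : Op (A ⊕ D.Anc) :=
  runGates D.gates (pad Function.Embedding.inl ρ)

/-- The probability that measuring the output wires gives `s`, as a linear functional. -/
def weight (D : Device A B) (s : B → Bool) (ρ : Op A) : ℂ :=
  ∑ z, if z ∘ D.out = s then D.final ρ z z else 0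

theorem pad_add {V W : Type} (e : V ↪ W) (ρ σ : Op V) : pad e (ρ + σ) = pad e ρ + pad e σ := by
  ext x y
  change pad e (ρ + σ) x y = pad e ρ x y + pad e σ x y
  simp only [pad, Matrix.add_apply]
  split_ifs <;> simp

theorem pad_smul {V W : Type} (e : V ↪ W) (c : ℂ) (ρ : Op V) : pad e (c • ρ) = c • pad e ρ := by
  ext x y
  change pad e (c • ρ) x y = c * pad e ρ x y
  simp only [pad, Matrix.smul_apply, smul_eq_mul]
  split_ifs <;> simp

theorem pad_posSemidef {V W : Type} [Fintype V] [DecidableEq V] [Fintype W] (e : V ↪ W) {ρ : Op V}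
    (hρ : ρ.PosSemidef) : (pad e ρ).PosSemidef := by
  classical
  have := posSemidef_combine hρ (fun (_ : Unit) (x : W → Bool) => x ∘ e)
    (fun _ x => if ZeroOff e x then 1 else 0)
  convert this using 1
  ext x y
  simp only [pad, Matrix.of_apply, Finset.univ_unique, Finset.sum_singleton, apply_ite star,
    star_one, star_zero]
  by_cases hx : ZeroOff e x <;> by_cases hy : ZeroOff e y <;> simp [hx, hy]

theorem final_add (D : Device A B) (ρ σ : Op A) : D.final (ρ + σ) = D.final ρ + D.final σ := by
  rw [final, pad_add]
  exact (runGatesₗ D.gates).map_add _ _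

theorem final_smul (D : Device A B) (c : ℂ) (ρ : Op A) : D.final (c • ρ) = c • D.final ρ := by
  rw [final, pad_smul]
  exact (runGatesₗ D.gates).map_smul _ _

/-- `Device.weight` as a linear map. -/
def weightₗ (D : Device A B) (s : B → Bool) : Op A →ₗ[ℂ] ℂ where
  toFun := D.weight s
  map_add' ρ σ := by
    simp only [weight, final_add, Matrix.add_apply, ← Finset.sum_add_distrib]
    exact Finset.sum_congr rfl fun z _ => by split_ifs <;> simp
  map_smul' c ρ := by
    simp only [weight, final_smul, Matrix.smul_apply, smul_eq_mul, Finset.mul_sum, RingHom.id_apply]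
    exact Finset.sum_congr rfl fun z _ => by split_ifs <;> simp

/-- The measurement that is performed by a device. -/
def povm (D : Device A B) (s : B → Bool) : Op A := fun x y => D.weight s (Matrix.single y x 1)

/-- Linearity of the weight. The indices in `povm` are swapped so that the right-hand side is the
trace of the product with `ρ`. -/
theorem weight_eq (D : Device A B) (s : B → Bool) (ρ : Op A) :
    D.weight s ρ = ∑ u, ∑ v, D.povm s v u * ρ u v := by
  change D.weightₗ s ρ = _
  conv_lhs => rw [Matrix.matrix_eq_sum_single ρ]
  simp only [map_sum]
  refine Finset.sum_congr rfl fun u _ => Finset.sum_congr rfl fun v _ => ?_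
  have : Matrix.single u v (ρ u v) = ρ u v • Matrix.single u v (1 : ℂ) := by
    rw [Matrix.smul_single, smul_eq_mul, mul_one]
  rw [this, map_smul, smul_eq_mul, mul_comm]
  rfl

theorem weight_nonneg (D : Device A B) (s : B → Bool) {ρ : Op A} (hρ : ρ.PosSemidef) :
    0 ≤ D.weight s ρ := by
  refine Finset.sum_nonneg fun z _ => ?_
  split_ifs
  · exact (runGates_posSemidef D.gates (pad_posSemidef _ hρ)).diag_nonneg
  · exact le_rfl

theorem sum_weight (D : Device A B) (ρ : Op A) : ∑ s, D.weight s ρ = ∑ u, ρ u u := by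
  simp only [weight]
  rw [Finset.sum_comm]
  simp only [Finset.sum_ite_eq, Finset.mem_univ, if_true]
  rw [final, runGates_trace, trace_pad]

theorem sum_povm (D : Device A B) : ∑ s, D.povm s = 1 := by
  ext x y
  rw [Matrix.sum_apply]
  refine (D.sum_weight (Matrix.single y x 1)).trans ?_
  rw [Matrix.one_apply]
  by_cases h : x = y
  · subst h
    simp [Matrix.single_apply]
  · rw [if_neg h]
    refine Finset.sum_eq_zero fun u _ => ?_
    rw [Matrix.single_apply, if_neg]
    exact fun hh => h (hh.2.trans hh.1.symm)

/-- Over `ℂ`, a quadratic form with real values already forces the matrix to be Hermitian. -/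
theorem posSemidef_of_forall_nonneg {n : Type*} [Fintype n] [DecidableEq n] {M : Matrix n n ℂ}
    (h : ∀ ξ : n → ℂ, 0 ≤ star ξ ⬝ᵥ M.mulVec ξ) : M.PosSemidef := by
  rw [← Matrix.isPositive_toEuclideanLin_iff, LinearMap.isPositive_iff_complex]
  intro x
  have hx := h (WithLp.ofLp x)
  have key : inner ℂ (Matrix.toEuclideanLin M x) x =
      star (star (WithLp.ofLp x) ⬝ᵥ M.mulVec (WithLp.ofLp x)) := by
    rw [EuclideanSpace.inner_eq_star_dotProduct, Matrix.star_dotProduct, star_star,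
      dotProduct_comm]
    rfl
  rw [key]
  obtain ⟨h1, h2⟩ := Complex.le_def.mp hx
  refine ⟨?_, ?_⟩
  · apply Complex.ext
    · simp
    · simpa using h2.symm
  · simpa using h1

/-- On the rank-one operator of a vector `ξ`, the quadratic form of the measurement operator is an
outcome weight, hence nonnegative. -/
theorem povm_posSemidef (D : Device A B) (s : B → Bool) : (D.povm s).PosSemidef := by
  refine posSemidef_of_forall_nonneg fun ξ => ?_
  have h := D.weight_nonneg s (Matrix.posSemidef_vecMulVec_self_star ξ)
  rw [weight_eq] at h
  convert h using 1
  simp only [dotProduct, Matrix.mulVec, Matrix.vecMulVec_apply, Finset.mul_sum]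
  rw [Finset.sum_comm]
  refine Finset.sum_congr rfl fun u _ => Finset.sum_congr rfl fun v _ => ?_
  simp only [Pi.star_apply]
  ring

/-- Gates that answer a query to the measurement of a device. -/
def queryGates (D : Device A B) : List (Gate ((A ⊕ B) ⊕ D.Anc)) :=
  let κ : A ⊕ D.Anc ↪ (A ⊕ B) ⊕ D.Anc :=
    Function.Embedding.sumMap Function.Embedding.inl (Function.Embedding.refl _)
  let β : B ↪ (A ⊕ B) ⊕ D.Anc := Function.Embedding.inr.trans Function.Embedding.inl
  resetAll β ++ (D.gates.map (Gate.map κ) ++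
    (monomialGates (D.out.trans κ) β
      (fun b b' => by rcases h : D.out b with a | n <;> simp [h, κ, β])
      (Finset.univ.toList.map fun b => ({b}, b)) ++ resetAll κ))

theorem monomialSum_copy (u : B → Bool) :
    monomialSum (Finset.univ.toList.map fun b : B => ({b}, b)) u = u := by
  funext b
  have key : ∀ l : List B, l.Nodup → monomialSum (l.map fun b : B => ({b}, b)) u b =
      if b ∈ l then u b else false := by
    intro l hl
    induction l with
    | nil => rfl
    | cons b' l ih =>
      rw [List.nodup_cons] at hl
      have h := ih hl.2
      simp only [monomialSum] at h
      rw [List.map_cons, monomialSum, List.foldr_cons, h]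
      by_cases hb : b' = b
      · subst hb
        simp [hl.1]
      · simp [hb, Ne.symm hb]
  rw [key _ (Finset.nodup_toList _)]
  simp

theorem gatesCost_queryGates (D : Device A B) : gatesCost D.queryGates =
    3 * Fintype.card B + gatesCost D.gates + Fintype.card A + Fintype.card D.Anc := by
  simp only [queryGates, gatesCost_append, gatesCost_map, gatesCost_resetAll, Fintype.card_sum]
  simp only [gatesCost, monomialGates, List.map_map, Function.comp_def, Gate.cost]
  simp
  ring

/-- The old answer is discarded, the device runs in place on the query register, its outcome is
copied by CNOTs, and the query register and ancillas are reset. Discarding the original of the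
copied outcome makes the answer classical, which gives the condition that row and column agree on
it. The ancillas end in the zero state, so the next query can use them again. -/
theorem runGates_queryGates (D : Device A B) (τ : Op (A ⊕ B)) :
    runGates D.queryGates (pad Function.Embedding.inl τ) = pad Function.Embedding.inl
      (queryMap Function.Embedding.inl Function.Embedding.inr D.povm τ) := by
  ext x y
  let κ : A ⊕ D.Anc ↪ (A ⊕ B) ⊕ D.Anc :=
    Function.Embedding.sumMap Function.Embedding.inl (Function.Embedding.refl _)
  let β : B ↪ (A ⊕ B) ⊕ D.Anc := Function.Embedding.inr.trans Function.Embedding.inl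
  have hdis : ∀ a b, κ a ≠ β b := by
    rintro (a | n) b <;> simp [κ, β]
  -- The state of the query register once the old answer has been discarded.
  let τ' : Op A := fun u v => ∑ q : B → Bool, τ (Sum.elim u q) (Sum.elim v q)
  simp only [queryGates, runGates_append]
  rw [runGates_resetAll]
  -- Here `w` is the content of the device wires just before the final reset, which sums over it.
  have hstep : ∀ w : A ⊕ D.Anc → Bool,
      runGates (monomialGates (D.out.trans κ) β (fun b b' => hdis _ _)
        (Finset.univ.toList.map fun b => ({b}, b))) (runGates (D.gates.map (Gate.map κ))
          (runGates (resetAll β) (pad Function.Embedding.inl τ)))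
        (Function.extend κ w x) (Function.extend κ w y) =
      if w ∘ D.out = x ∘ β ∧ x ∘ β = y ∘ β then D.final τ' w w else 0 := fun w => by
    have hadd : ∀ x : (A ⊕ B) ⊕ D.Anc → Bool,
        addTo (D.out.trans κ) β (monomialSum (Finset.univ.toList.map fun b : B => ({b}, b)))
          (Function.extend κ w x) =
        Function.extend β (fun b => xor (x (β b)) (w (D.out b))) (Function.extend κ w x) :=
      fun x => by
        rw [addTo, monomialSum_copy]
        congr 1
        funext b
        rw [Function.extend_apply' w x (β b) fun ⟨a, ha⟩ => hdis a b ha]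
        exact congrArg _ (κ.injective.extend_apply _ _ _)
    refine (runGates_monomialGates _ _ (fun b b' => hdis (D.out b) b') _ _ _ _).trans ?_
    rw [runGates_map_apply, hadd, hadd]
    have hcomp : ∀ (v : B → Bool) (x : (A ⊕ B) ⊕ D.Anc → Bool),
        Function.extend β v (Function.extend κ w x) ∘ κ = w := fun v x => by
      rw [extend_comp_of_disjoint β κ fun b a h => hdis a b h.symm, extend_comp_self]
    rw [hcomp, hcomp]
    have hzero : ∀ (x : (A ⊕ B) ⊕ D.Anc → Bool) (u : A ⊕ D.Anc → Bool) (b : B),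
        Function.extend κ u (Function.extend β (fun b => xor (x (β b)) (w (D.out b)))
          (Function.extend κ w x)) (β b) = xor (x (β b)) (w (D.out b)) := fun x u b => by
      rw [Function.extend_apply' _ _ _ fun ⟨a, ha⟩ => hdis a b ha, β.injective.extend_apply]
    have hinl : ∀ (q : B → Bool) (v : B → Bool) (u : A ⊕ D.Anc → Bool)
        (x : (A ⊕ B) ⊕ D.Anc → Bool), Function.extend β q (Function.extend κ u
          (Function.extend β v (Function.extend κ w x))) =
            Sum.elim (Sum.elim (u ∘ Sum.inl) q) (u ∘ Sum.inr) := fun q v u x => by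
      funext k
      rcases k with (a | b) | n
      · rw [Function.extend_apply' _ _ _ (by simp [β])]
        exact κ.injective.extend_apply _ _ (Sum.inl a)
      · exact β.injective.extend_apply _ _ b
      · rw [Function.extend_apply' _ _ _ (by simp [β])]
        exact κ.injective.extend_apply _ _ (Sum.inr n)
    have hoff : ∀ (u : A ⊕ D.Anc → Bool) (q : B → Bool), ZeroOff Function.Embedding.inl
        (Sum.elim (Sum.elim (u ∘ Sum.inl) q) (u ∘ Sum.inr) : (A ⊕ B) ⊕ D.Anc → Bool) ↔
          ZeroOff Function.Embedding.inl u := fun u q => by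
      simp [ZeroOff]
    -- The answer register was zero before the copy, so undoing the copy must give zero: the entry
    -- survives only if its answer equals the outcome.
    have hxor : ∀ x : (A ⊕ B) ⊕ D.Anc → Bool,
        (∀ b, xor (x (β b)) (w (D.out b)) = false) ↔ w ∘ D.out = x ∘ β := fun x => by
      constructor
      · intro h
        funext b
        exact (show x (β b) = w (D.out b) by simpa using h b).symm
      · intro h b
        simpa using (congrFun h b).symm
    have hslice : slice κ
        (Function.extend β (fun b => xor (x (β b)) (w (D.out b))) (Function.extend κ w x))
        (Function.extend β (fun b => xor (y (β b)) (w (D.out b))) (Function.extend κ w y))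
        (runGates (resetAll β) (pad Function.Embedding.inl τ)) =
        if w ∘ D.out = x ∘ β ∧ x ∘ β = y ∘ β then pad Function.Embedding.inl τ' else 0 := by
      ext u v
      rw [slice, runGates_resetAll]
      simp only [hzero, hinl, forall_and, hxor]
      by_cases h : w ∘ D.out = x ∘ β ∧ x ∘ β = y ∘ β
      · rw [if_pos h, if_pos ⟨h.1, h.1.trans h.2⟩]
        by_cases h2 : ZeroOff Function.Embedding.inl u ∧ ZeroOff Function.Embedding.inl v
        · rw [pad_of_zeroOff h2.1 h2.2]
          exact Finset.sum_congr rfl fun q _ =>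
            pad_of_zeroOff ((hoff u q).2 h2.1) ((hoff v q).2 h2.2) τ
        · rw [pad_eq_zero h2]
          refine Finset.sum_eq_zero fun q _ => pad_eq_zero ?_ τ
          rwa [hoff, hoff]
      · rw [if_neg h, if_neg fun h' => h ⟨h'.1, h'.1.symm.trans h'.2⟩]
        rfl
    rw [hslice]
    split_ifs
    · rfl
    · rw [runGates_zero]; rfl
  rw [Finset.sum_congr rfl fun w _ => hstep w]
  have hκ : (∀ i, x (κ i) = false ∧ y (κ i) = false) ↔
      (ZeroOff Function.Embedding.inl x ∧ ZeroOff Function.Embedding.inl y) ∧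
        (∀ a, (x ∘ Function.Embedding.inl) (Function.Embedding.inl a) = false) ∧
        ∀ a, (y ∘ Function.Embedding.inl) (Function.Embedding.inl a) = false := by
    simp [ZeroOff, κ, forall_and]
    tauto
  have hβ : ∀ x : (A ⊕ B) ⊕ D.Anc → Bool,
      (x ∘ Function.Embedding.inl) ∘ Function.Embedding.inr = x ∘ β := fun x => rfl
  have helim : ∀ (u : A → Bool) (q : B → Bool) (z : A ⊕ B → Bool),
      Function.extend (Function.Embedding.inl : A ↪ A ⊕ B) u
        (Function.extend (Function.Embedding.inr : B ↪ A ⊕ B) q z) = Sum.elim u q :=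
    fun u q z => by
      funext k
      rcases k with a | b
      · exact Function.Embedding.inl.injective.extend_apply _ _ a
      · rw [Function.extend_apply' _ _ _ (by simp)]
        exact Function.Embedding.inr.injective.extend_apply _ _ b
  by_cases h0 : ZeroOff Function.Embedding.inl x ∧ ZeroOff Function.Embedding.inl y
  · rw [pad_of_zeroOff h0.1 h0.2]
    simp only [queryMap, helim, hβ]
    by_cases h1 : (∀ a, (x ∘ Function.Embedding.inl) (Function.Embedding.inl a) = false) ∧
        ∀ a, (y ∘ Function.Embedding.inl) (Function.Embedding.inl a) = false
    · rw [if_pos (hκ.2 ⟨h0, h1⟩)]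
      by_cases h2 : x ∘ β = y ∘ β
      · rw [if_pos ⟨h1.1, h1.2, h2⟩]
        simp only [h2, and_true]
        refine (D.weight_eq (y ∘ β) τ').trans ?_
        refine Finset.sum_congr rfl fun u _ => Finset.sum_congr rfl fun v _ => ?_
        exact Finset.mul_sum _ _ _
      · rw [if_neg fun h => h2 h.2.2]
        simp [h2]
    · rw [if_neg fun h => h1 (hκ.1 h).2, if_neg fun h => h1 ⟨h.1, h.2.1⟩]
  · rw [pad_eq_zero h0, if_neg fun h => h0 (hκ.1 h).1]

/-- Implementation of a query inside a larger register. -/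
theorem runGates_queryGates_map {V W : Type} [DecidableEq V] [DecidableEq W] (D : Device A B)
    (inp : A ↪ V) (ans : B ↪ V) (h : ∀ a b, inp a ≠ ans b) (e : V ↪ W)
    (f : (A ⊕ B) ⊕ D.Anc ↪ W) (hA : ∀ a, f (Sum.inl (Sum.inl a)) = e (inp a))
    (hB : ∀ b, f (Sum.inl (Sum.inr b)) = e (ans b)) (hdis : ∀ n v, f (Sum.inr n) ≠ e v)
    (ρ : Op V) : runGates (D.queryGates.map (Gate.map f)) (pad e ρ) =
      pad e (queryMap inp ans D.povm ρ) := by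
  let j : A ⊕ B ↪ V := ⟨Sum.elim inp ans, inp.injective.sumElim ans.injective h⟩
  refine runGates_simulate D.queryGates
    (queryMap Function.Embedding.inl Function.Embedding.inr D.povm) (queryMap inp ans D.povm)
    D.runGates_queryGates j (fun x y ρ => ?_) e f ?_ hdis ρ
  · exact slice_queryMap j Function.Embedding.inl Function.Embedding.inr D.povm x y ρ
  · rintro (a | b)
    · exact hA a
    · exact hB b

end Device

/-! ## Some devices -/

/-! ### Registers split into two groups of wires -/

section Fiber
variable {P Q W : Type} [Fintype P] [DecidableEq P] [Fintype Q] [DecidableEq Q] [Fintype W]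
  [DecidableEq W]

/-- The assignment to the wires `P ⊕ Q ≃ W` with given restrictions. -/
def glue (e : P ⊕ Q ≃ W) (p : P → Bool) (q : Q → Bool) : W → Bool := Sum.elim p q ∘ e.symm

theorem glue_inl (e : P ⊕ Q ≃ W) (p : P → Bool) (q : Q → Bool) (a : P) :
    glue e p q (e (Sum.inl a)) = p a := by simp [glue]

theorem glue_inr (e : P ⊕ Q ≃ W) (p : P → Bool) (q : Q → Bool) (b : Q) :
    glue e p q (e (Sum.inr b)) = q b := by simp [glue]

theorem sum_glue (e : P ⊕ Q ≃ W) (q : Q → Bool) (F : (W → Bool) → ℂ) :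
    ∑ z, (if (fun b => z (e (Sum.inr b))) = q then F z else 0) = ∑ p, F (glue e p q) := by
  have h : ∑ z, (if (fun b => z (e (Sum.inr b))) = q then F z else 0) =
      ∑ pq : (P → Bool) × (Q → Bool), if pq.2 = q then F (glue e pq.1 pq.2) else 0 := by
    refine Fintype.sum_equiv ((Equiv.arrowCongr e.symm (Equiv.refl Bool)).trans
      (Equiv.sumArrowEquivProdArrow P Q Bool)) _ _ fun z => ?_
    have hz : glue e (fun a => z (e (Sum.inl a))) (fun b => z (e (Sum.inr b))) = z := by
      funext k
      obtain ⟨a | b, rfl⟩ := e.surjective k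
      · rw [glue_inl]
      · rw [glue_inr]
    change _ = if (fun b => z (e (Sum.inr b))) = q then
      F (glue e (fun a => z (e (Sum.inl a))) (fun b => z (e (Sum.inr b)))) else 0
    rw [hz]
  rw [h, Fintype.sum_prod_type]
  simp

theorem extend_inl_glue (e : P ⊕ Q ≃ W) (f : P ↪ W) (hf : ∀ a, f a = e (Sum.inl a))
    (p p' : P → Bool) (q : Q → Bool) : Function.extend f p' (glue e p q) = glue e p' q := by
  funext k
  obtain ⟨a | b, rfl⟩ := e.surjective k
  · rw [← hf, f.injective.extend_apply, hf, glue_inl]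
  · rw [Function.extend_apply', glue_inr, glue_inr]
    rintro ⟨a, ha⟩
    simp [hf] at ha

theorem zeroOff_glue (e : P ⊕ Q ≃ W) (f : P ↪ W) (hf : ∀ a, f a = e (Sum.inl a))
    (p : P → Bool) (q : Q → Bool) : ZeroOff f (glue e p q) ↔ ∀ b, q b = false := by
  constructor
  · intro h b
    rw [← glue_inr e p q b]
    exact h _ fun a ha => by simp [hf] at ha
  · intro h k hk
    obtain ⟨a | b, rfl⟩ := e.surjective k
    · exact absurd (hf a) (hk a)
    · rw [glue_inr, h]

theorem glue_comp_inl (e : P ⊕ Q ≃ W) (f : P ↪ W) (hf : ∀ a, f a = e (Sum.inl a))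
    (p : P → Bool) (q : Q → Bool) : glue e p q ∘ f = p :=
  funext fun a => by rw [Function.comp_apply, hf, glue_inl]

end Fiber

theorem pad_trans {U V W : Type} [DecidableEq U] [DecidableEq V] [DecidableEq W] (f : U ↪ V) (e : V ↪ W) (ρ : Op U) :
    pad (f.trans e) ρ = pad e (pad f ρ) := by
  have key : ∀ x : W → Bool, ZeroOff (f.trans e) x ↔ ZeroOff e x ∧ ZeroOff f (x ∘ e) := fun x => by
    constructor
    · intro h
      refine ⟨fun k hk => h k fun a => hk (f a), fun k hk => h (e k) fun a ha => ?_⟩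
      exact hk a (e.injective ha)
    · rintro ⟨h1, h2⟩ k hk
      by_cases hv : ∃ v, e v = k
      · obtain ⟨v, rfl⟩ := hv
        exact h2 v fun a ha => hk a (congrArg e ha)
      · exact h1 k (by simpa using hv)
  ext x y
  by_cases h : ZeroOff e x ∧ ZeroOff e y
  · rw [pad_of_zeroOff h.1 h.2]
    by_cases h2 : ZeroOff f (x ∘ e) ∧ ZeroOff f (y ∘ e)
    · rw [pad_of_zeroOff h2.1 h2.2, pad_of_zeroOff ((key x).2 ⟨h.1, h2.1⟩) ((key y).2 ⟨h.2, h2.2⟩)]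
      rfl
    · rw [pad_eq_zero h2, pad_eq_zero]
      rw [key, key]; tauto
  · rw [pad_eq_zero h, pad_eq_zero]
    rw [key, key]; tauto

namespace Device
variable {A B : Type} [Fintype A] [DecidableEq A] [Fintype B] [DecidableEq B]

/-! ### The uniform distribution -/

/-- The device that outputs a uniformly random string. -/
def uniform (A B : Type) [Fintype A] [DecidableEq A] [Fintype B] [DecidableEq B] : Device A B where
  Anc := B
  gates := coinAll Function.Embedding.inr
  out := Function.Embedding.inr

theorem runGates_coinAll_pad (ρ : Op A) (p : A → Bool) (s : B → Bool) :
    runGates (coinAll (Function.Embedding.inr : B ↪ A ⊕ B)) (pad Function.Embedding.inl ρ)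
      (glue (Equiv.refl (A ⊕ B)) p s) (glue (Equiv.refl (A ⊕ B)) p s) =
        (1 / 2 ^ Fintype.card B : ℂ) * ρ p p := by
  rw [runGates_coinAll_diag]
  congr 1
  have h : ∀ w : B → Bool, Function.extend (Function.Embedding.inr : B ↪ A ⊕ B) w
      (glue (Equiv.refl (A ⊕ B)) p s) = glue (Equiv.refl (A ⊕ B)) p w := fun w => by
    funext k
    rcases k with a | b
    · rw [Function.extend_apply' _ _ _ (by simp)]; rfl
    · exact Function.Embedding.inr.injective.extend_apply _ _ b
  simp only [h]
  rw [Fintype.sum_eq_single fun _ => false]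
  · have hz := (zeroOff_glue (Equiv.refl (A ⊕ B)) (Function.Embedding.inl) (fun _ => rfl) p
      fun _ => false).2 fun _ => rfl
    rw [pad_of_zeroOff hz hz]
    rfl
  · intro w hw
    refine pad_eq_zero ?_ _
    rw [zeroOff_glue (Equiv.refl (A ⊕ B)) _ (fun _ => rfl)]
    exact fun h => hw (funext h.1)

theorem povm_uniform (s : B → Bool) :
    (uniform A B).povm s = (1 / 2 ^ Fintype.card B : ℂ) • (1 : Op A) := by
  have hw : ∀ ρ : Op A, (uniform A B).weight s ρ = (1 / 2 ^ Fintype.card B : ℂ) * ∑ u, ρ u u := by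
    intro ρ
    refine (sum_glue (Equiv.refl (A ⊕ B)) s fun z => (uniform A B).final ρ z z).trans ?_
    rw [Finset.mul_sum]
    exact Finset.sum_congr rfl fun p _ => runGates_coinAll_pad ρ p s
  ext x y
  refine (hw _).trans ?_
  rw [Matrix.smul_apply, Matrix.one_apply, smul_eq_mul]
  congr 1
  by_cases h : x = y
  · subst h
    simp [Matrix.single_apply]
  · rw [if_neg h]
    refine Finset.sum_eq_zero fun u _ => ?_
    rw [Matrix.single_apply, if_neg]
    exact fun hh => h (hh.2.trans hh.1.symm)

/-! ### Masking the output -/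

section Mask
variable {N R M : Type} [Fintype N] [DecidableEq N] [Fintype R] [DecidableEq R] [Fintype M]
  [DecidableEq M]

/-- The wires that determine the mask. -/
def maskControl (R : Type) (o : M ↪ A ⊕ N) : R ⊕ M ↪ A ⊕ (N ⊕ (R ⊕ M)) :=
  ⟨Sum.elim (fun r => Sum.inr (Sum.inr (Sum.inl r)))
    (fun m => Equiv.sumAssoc A N (R ⊕ M) (Sum.inl (o m))), by
      refine Function.Injective.sumElim ?_ ?_ ?_
      · intro a b h; simpa using h
      · intro a b h; simpa using h
      · intro a b; rcases o b with _ | _ <;> simp⟩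

theorem maskControl_ne (o : M ↪ A ⊕ N) (a : R ⊕ M) (b : M) : maskControl R o a ≠
    (Function.Embedding.inr.trans (Function.Embedding.inr.trans Function.Embedding.inr) :
      M ↪ A ⊕ (N ⊕ (R ⊕ M))) b := by
  rcases a with a | a
  · simp [maskControl]
  · rcases h : o a with _ | _ <;> simp [h, maskControl]

/-- Choose a random string `x` and add `g x` to the output of a list of gates. -/
def maskGates (gs : List (Gate (A ⊕ N))) (o : M ↪ A ⊕ N) (g : (R → Bool) → M → Bool) :
    List (Gate (A ⊕ (N ⊕ (R ⊕ M)))) :=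
  gs.map (Gate.map (Function.Embedding.inl.trans (Equiv.sumAssoc A N (R ⊕ M)).toEmbedding)) ++
    (coinAll (Function.Embedding.inl.trans (Function.Embedding.inr.trans Function.Embedding.inr)) ++
      tableGates (maskControl R o)
        (Function.Embedding.inr.trans (Function.Embedding.inr.trans Function.Embedding.inr))
        (maskControl_ne o) (fun u m => xor (u (Sum.inr m)) (g (u ∘ Sum.inl) m)))

/-- Read the circuit backwards. Undoing the table must leave the mask register empty, which says
that `y` is the output plus `g x`; undoing the coins contributes the probability of the seed `x`,
whatever `x` is. -/
theorem runGates_maskGates (gs : List (Gate (A ⊕ N))) (o : M ↪ A ⊕ N) (g : (R → Bool) → M → Bool)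
    (ρ : Op A) (p : A ⊕ N → Bool) (x : R → Bool) (y : M → Bool) :
    runGates (maskGates gs o g) (pad Function.Embedding.inl ρ)
      (glue (Equiv.sumAssoc A N (R ⊕ M)) p (Sum.elim x y))
      (glue (Equiv.sumAssoc A N (R ⊕ M)) p (Sum.elim x y)) =
    (1 / 2 ^ Fintype.card R : ℂ) * if p ∘ o = (fun m => xor (y m) (g x m)) then
      runGates gs (pad Function.Embedding.inl ρ) p p else 0 := by
  let e := Equiv.sumAssoc A N (R ⊕ M)
  let κ : A ⊕ N ↪ A ⊕ (N ⊕ (R ⊕ M)) := Function.Embedding.inl.trans e.toEmbedding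
  have hκ : ∀ a, κ a = e (Sum.inl a) := fun _ => rfl
  have hrun : runGates (gs.map (Gate.map κ)) (pad Function.Embedding.inl ρ) =
        pad κ (runGates gs (pad Function.Embedding.inl ρ)) := by
    rw [← runGates_map_pad κ gs, ← pad_trans]
    rfl
  rw [maskGates, runGates_append, runGates_append, hrun, runGates_tableGates,
    runGates_coinAll_diag]
  congr 1
  have hadd : addTo (maskControl R o) (Function.Embedding.inr.trans
      (Function.Embedding.inr.trans Function.Embedding.inr))
      (fun u m => xor (u (Sum.inr m)) (g (u ∘ Sum.inl) m)) (glue e p (Sum.elim x y)) =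
      glue e p (Sum.elim x fun m => xor (y m) (xor (p (o m)) (g x m))) := by
    funext k
    obtain ⟨a | (r | m), rfl⟩ := e.surjective k
    · rw [glue_inl, addTo, Function.extend_apply', glue_inl]
      rintro ⟨m, hm⟩
      rcases a with a | n <;> simp [e] at hm
    · rw [glue_inr, addTo, Function.extend_apply', glue_inr]
      · rfl
      · rintro ⟨m, hm⟩
        simp [e] at hm
    · rw [glue_inr, addTo]
      refine (Function.Embedding.injective _ |>.extend_apply _ _ m).trans ?_
      have h1 : (glue e p (Sum.elim x y) ∘ maskControl R o) (Sum.inr m) = p (o m) :=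
        glue_inl e p _ (o m)
      have h2 : (glue e p (Sum.elim x y) ∘ maskControl R o) ∘ Sum.inl = x :=
        funext fun r => glue_inr e p (Sum.elim x y) (Sum.inl r)
      rw [h1, h2]
      exact congrArg (fun b => xor b _) (glue_inr e p (Sum.elim x y) (Sum.inr m))
  have hext : ∀ (w : R → Bool) (y' : M → Bool), Function.extend
      (Function.Embedding.inl.trans (Function.Embedding.inr.trans Function.Embedding.inr) :
        R ↪ A ⊕ (N ⊕ (R ⊕ M))) w (glue e p (Sum.elim x y')) = glue e p (Sum.elim w y') := by
    intro w y'
    funext k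
    obtain ⟨a | (r | m), rfl⟩ := e.surjective k
    · rw [Function.extend_apply', glue_inl, glue_inl]
      rintro ⟨m, hm⟩
      rcases a with a | n <;> simp [e] at hm
    · rw [glue_inr]
      exact Function.Embedding.injective _ |>.extend_apply _ _ r
    · rw [Function.extend_apply', glue_inr, glue_inr]
      · rfl
      · rintro ⟨m, hm⟩
        simp [e] at hm
  rw [hadd]
  simp only [hext]
  have hoff : ∀ (w : R → Bool) (y' : M → Bool), ZeroOff κ (glue e p (Sum.elim w y')) ↔
      (∀ r, w r = false) ∧ ∀ m, y' m = false := fun w y' => by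
    rw [zeroOff_glue e κ hκ]
    simp
  have hy : (∀ m, xor (y m) (xor (p (o m)) (g x m)) = false) ↔
      p ∘ o = fun m => xor (y m) (g x m) := by
    rw [funext_iff]
    refine forall_congr' fun m => ?_
    simp only [Function.comp_apply]
    cases y m <;> cases p (o m) <;> cases g x m <;> simp
  rw [Fintype.sum_eq_single fun _ => false]
  · by_cases h : p ∘ o = fun m => xor (y m) (g x m)
    · have hz := (hoff (fun _ => false) _).2 ⟨fun _ => rfl, hy.2 h⟩
      rw [if_pos h, pad_of_zeroOff hz hz, glue_comp_inl e κ hκ]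
    · rw [if_neg h]
      refine pad_eq_zero ?_ _
      rw [hoff, hy]
      tauto
  · intro w hw
    refine pad_eq_zero ?_ _
    rw [hoff]
    exact fun h => hw (funext h.1.1)

/-- Choose a random string `x`, run the device `D` and output `x` together with the sum of the
output of `D` and `g x`. -/
def mask (D : Device A M) (g : (R → Bool) → M → Bool) : Device A (R ⊕ M) where
  Anc := D.Anc ⊕ (R ⊕ M)
  gates := maskGates D.gates D.out g
  out := Function.Embedding.inr.trans Function.Embedding.inr

theorem weight_mask (D : Device A M) (g : (R → Bool) → M → Bool) (x : R → Bool) (y : M → Bool)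
    (ρ : Op A) : (D.mask g).weight (Sum.elim x y) ρ =
      (1 / 2 ^ Fintype.card R : ℂ) * D.weight (fun m => xor (y m) (g x m)) ρ := by
  refine (sum_glue (Equiv.sumAssoc A D.Anc (R ⊕ M)) (Sum.elim x y)
    fun z => (D.mask g).final ρ z z).trans ?_
  rw [weight, Finset.mul_sum]
  exact Finset.sum_congr rfl fun p _ => runGates_maskGates D.gates D.out g ρ p x y

theorem povm_mask (D : Device A M) (g : (R → Bool) → M → Bool) (x : R → Bool) (y : M → Bool) :
    (D.mask g).povm (Sum.elim x y) =
      (1 / 2 ^ Fintype.card R : ℂ) • D.povm (fun m => xor (y m) (g x m)) := by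
  ext u v
  exact weight_mask D g x y _

end Mask

/-! ### Decryption with a key that depends on the public key -/

section Decoder
variable {PK SK CT M : Type} [Fintype PK] [DecidableEq PK] [Fintype SK] [DecidableEq SK]
  [Fintype CT] [DecidableEq CT] [Fintype M] [DecidableEq M]

/-- The wires of the decoder. -/
def decoderEquiv (PK SK CT N : Type) : ((SK ⊕ CT) ⊕ N) ⊕ PK ≃ (PK ⊕ CT) ⊕ (SK ⊕ N) where
  toFun := Sum.elim (Sum.elim (Sum.elim (fun s => .inr (.inl s)) fun c => .inl (.inr c))
    fun n => .inr (.inr n)) fun p => .inl (.inl p)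
  invFun := Sum.elim (Sum.elim (fun p => .inr p) fun c => .inl (.inl (.inr c)))
    (Sum.elim (fun s => .inl (.inl (.inl s))) fun n => .inl (.inr n))
  left_inv := by rintro (((_ | _) | _) | _) <;> rfl
  right_inv := by rintro ((_ | _) | (_ | _)) <;> rfl

/-- Look up the key and decrypt. -/
def decoderGates {N : Type} [Fintype N] [DecidableEq N] (gs : List (Gate ((SK ⊕ CT) ⊕ N))) (k : (PK → Bool) → SK → Bool) :
    List (Gate ((PK ⊕ CT) ⊕ (SK ⊕ N))) :=
  tableGates (Function.Embedding.inl.trans Function.Embedding.inl)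
      (Function.Embedding.inl.trans Function.Embedding.inr) (by simp) k ++
    gs.map (Gate.map (Function.Embedding.inl.trans (decoderEquiv PK SK CT N).toEmbedding))

/-- The device that decrypts a ciphertext with the key `k pk`. -/
def decoder (dec : Circuit (SK ⊕ CT) M) (k : (PK → Bool) → SK → Bool) : Device (PK ⊕ CT) M where
  Anc := SK ⊕ Fin dec.anc
  gates := decoderGates dec.gates k
  out := dec.out.trans (Function.Embedding.inl.trans
    (decoderEquiv PK SK CT (Fin dec.anc)).toEmbedding)

/-- For a classical public key the lookup places `k pk` next to the ciphertext, and the decryption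
gates act on this pair. The public key stays in its register, so entries with another value vanish.
-/
theorem runGates_decoderGates {N : Type} [Fintype N] [DecidableEq N]
    (gs : List (Gate ((SK ⊕ CT) ⊕ N))) (k : (PK → Bool) → SK → Bool) (pk pk' : PK → Bool)
    (ρ : Op CT) (p : (SK ⊕ CT) ⊕ N → Bool) :
    runGates (decoderGates gs k) (pad Function.Embedding.inl (tensor (basis pk) ρ))
      (glue (decoderEquiv PK SK CT N) p pk') (glue (decoderEquiv PK SK CT N) p pk') =
    if pk' = pk then
      runGates gs (pad Function.Embedding.inl (tensor (basis (k pk)) ρ)) p p else 0 := by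
  let e := decoderEquiv PK SK CT N
  let κ : (SK ⊕ CT) ⊕ N ↪ (PK ⊕ CT) ⊕ (SK ⊕ N) := Function.Embedding.inl.trans e.toEmbedding
  have hκ : ∀ a, κ a = e (Sum.inl a) := fun _ => rfl
  rw [decoderGates, runGates_append, runGates_map_apply]
  have hadd : ∀ u : (SK ⊕ CT) ⊕ N → Bool, addTo (Function.Embedding.inl.trans
      Function.Embedding.inl) (Function.Embedding.inl.trans Function.Embedding.inr) k
        (glue e u pk') = Sum.elim (Sum.elim pk' fun c => u (.inl (.inr c)))
          (Sum.elim (fun s => xor (u (.inl (.inl s))) (k pk' s)) fun n => u (.inr n)) := fun u => by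
    funext i
    have hpk : glue e u pk' ∘ (Function.Embedding.inl.trans Function.Embedding.inl :
        PK ↪ (PK ⊕ CT) ⊕ (SK ⊕ N)) = pk' := rfl
    rcases i with (i | i) | (i | i)
    · rw [addTo, Function.extend_apply' _ _ _ (by simp)]; rfl
    · rw [addTo, Function.extend_apply' _ _ _ (by simp)]; rfl
    · rw [addTo, hpk]
      exact Function.Embedding.injective _ |>.extend_apply _ _ i
    · rw [addTo, Function.extend_apply' _ _ _ (by simp)]; rfl
  have hslice : slice κ (glue e p pk') (glue e p pk') (runGates (tableGates
      (Function.Embedding.inl.trans Function.Embedding.inl)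
      (Function.Embedding.inl.trans Function.Embedding.inr) (by simp) k)
        (pad Function.Embedding.inl (tensor (basis pk) ρ))) =
      if pk' = pk then pad Function.Embedding.inl (tensor (basis (k pk)) ρ) else 0 := by
    ext u v
    rw [slice, extend_inl_glue e κ hκ, extend_inl_glue e κ hκ, runGates_tableGates, hadd, hadd]
    have hoff : ∀ u : (SK ⊕ CT) ⊕ N → Bool, ZeroOff Function.Embedding.inl
        (Sum.elim (Sum.elim pk' fun c => u (.inl (.inr c)))
          (Sum.elim (fun s => xor (u (.inl (.inl s))) (k pk' s)) fun n => u (.inr n)) :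
            (PK ⊕ CT) ⊕ (SK ⊕ N) → Bool) ↔
        k pk' = (u ∘ Function.Embedding.inl) ∘ Sum.inl ∧ ZeroOff Function.Embedding.inl u :=
      fun u => by
        have h1 : (∀ s, xor (u (.inl (.inl s))) (k pk' s) = false) ↔
            k pk' = (u ∘ Function.Embedding.inl) ∘ Sum.inl := by
          rw [funext_iff]
          refine forall_congr' fun s => ?_
          simp only [Function.comp_apply, Function.Embedding.inl_apply]
          cases u (.inl (.inl s)) <;> cases k pk' s <;> simp
        rw [← h1]
        simp [ZeroOff]
    by_cases hpk : pk' = pk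
    · subst hpk
      rw [if_pos rfl]
      by_cases h : ZeroOff Function.Embedding.inl u ∧ ZeroOff Function.Embedding.inl v
      · rw [pad_of_zeroOff h.1 h.2]
        simp only [pad, hoff, h, and_true, tensor, basis, Matrix.single_apply]
        have h3 : ∀ u : (SK ⊕ CT) ⊕ N → Bool, (Sum.elim (Sum.elim pk' fun c => u (.inl (.inr c)))
          (Sum.elim (fun s => xor (u (.inl (.inl s))) (k pk' s)) fun n => u (.inr n)) ∘
            Function.Embedding.inl) ∘ Sum.inl = pk' := fun u => rfl
        simp only [h3, and_self, if_true, one_mul]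
        rw [ite_mul, one_mul, zero_mul]
        rfl
      · rw [pad_eq_zero h, pad_eq_zero]
        rw [hoff, hoff]
        tauto
    · rw [if_neg hpk]
      have h3 : (basis pk : Op PK) pk' pk' = 0 := by
        rw [basis, Matrix.single_apply, if_neg fun h => hpk h.1.symm]
      simp only [pad]
      split_ifs
      · exact (congrArg (· * _) h3).trans (zero_mul _)
      · rfl
  rw [hslice, glue_comp_inl e κ hκ]
  split_ifs
  · rfl
  · rw [runGates_zero]; rfl

/-- This is needed only for the classical public keys of the game. On superpositions of public keys,
which a reduction may submit, the oracle is by definition the measurement of the device. -/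
theorem weight_decoder (dec : Circuit (SK ⊕ CT) M) (k : (PK → Bool) → SK → Bool)
    (pk : PK → Bool) (ρ : Op CT) (m : M → Bool) :
    (decoder dec k).weight m (tensor (basis pk) ρ) =
      dec.run (tensor (basis (k pk)) ρ) m m := by
  let e := decoderEquiv PK SK CT (Fin dec.anc)
  let F : ((PK ⊕ CT) ⊕ (SK ⊕ Fin dec.anc) → Bool) → ℂ := fun z =>
    if (fun b => z (e (Sum.inl (dec.out b)))) = m then runGates (decoderGates dec.gates k)
      (pad Function.Embedding.inl (tensor (basis pk) ρ)) z z else 0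
  have h1 : (decoder dec k).weight m (tensor (basis pk) ρ) = ∑ z, F z := rfl
  have h2 : ∑ z, F z = ∑ q, ∑ p, F (glue e p q) := by
    simp only [← sum_glue]
    rw [Finset.sum_comm]
    simp
  have h3 : ∀ q p, F (glue e p q) = if q = pk then (if p ∘ dec.out = m then runGates dec.gates
      (pad Function.Embedding.inl (tensor (basis (k pk)) ρ)) p p else 0) else 0 := fun q p => by
    simp only [F, glue_inl]
    rw [runGates_decoderGates dec.gates k pk q ρ p]
    split_ifs <;> first | rfl | contradiction
  rw [h1, h2]
  simp only [h3]
  rw [Fintype.sum_eq_single pk fun q hq => by simp [hq], Circuit.run, reduce]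
  refine Finset.sum_congr rfl fun z _ => ?_
  rw [if_pos rfl, tensor_basis_zero]
  split_ifs with h
  · rw [← h, extend_comp_eq]
  · rfl

end Decoder

end Device

open MeasureTheory

/-! ## Random tables -/

/-- The entries of a sequence of tables with inputs of length `r κ` and outputs of length `m κ`. -/
abbrev Coord (r m : ℕ → ℕ) : Type := Σ κ : ℕ, Bits (r κ) × Fin (m κ)

/-- The fair coin. -/
def coinMeasure : Measure Bool := (PMF.uniformOfFintype Bool).toMeasure

instance : IsProbabilityMeasure coinMeasure := by
  unfold coinMeasure; infer_instance

/-- The distribution of a sequence of independent fair coins. -/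
def coinsMeasure (J : Type) : Measure (J → Bool) := Measure.infinitePi fun _ => coinMeasure

instance (J : Type) : IsProbabilityMeasure (coinsMeasure J) := by
  unfold coinsMeasure; infer_instance

theorem coinMeasure_map_xor (b : Bool) : coinMeasure.map (xor b) = coinMeasure := by
  have h : (PMF.uniformOfFintype Bool).map (xor b) = PMF.uniformOfFintype Bool := by
    ext a
    rw [PMF.map_apply, tsum_fintype]
    cases a <;> cases b <;> simp
  rw [coinMeasure, PMF.toMeasure_map _ _ (measurable_of_countable _), h]

/-- This translation invariance is what makes the masks at unrepeated seeds uniform and independent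
of everything else. -/
theorem coinsMeasure_map_xor {J : Type} (c : J → Bool) :
    (coinsMeasure J).map (fun ω j => xor (c j) (ω j)) = coinsMeasure J := by
  rw [coinsMeasure, Measure.infinitePi_map_pi _ fun j => measurable_of_countable _]
  simp only [coinMeasure_map_xor]

theorem measurable_xor {J : Type} (c : J → Bool) :
    Measurable fun (ω : J → Bool) j => xor (c j) (ω j) :=
  measurable_pi_lambda _ fun j => (measurable_of_countable (xor (c j))).comp (measurable_pi_apply j)

theorem integral_xor {J : Type} (c : J → Bool) {G : (J → Bool) → ℝ} (hG : Measurable G) :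
    ∫ ω, G (fun j => xor (c j) (ω j)) ∂coinsMeasure J = ∫ ω, G ω ∂coinsMeasure J := by
  conv_rhs => rw [← coinsMeasure_map_xor c]
  rw [integral_map (measurable_xor c).aemeasurable hG.aestronglyMeasurable]

/-! ### Uniform averages over finite families of strings -/

section Expect

theorem expect_sumPi {Q Q' : Type} [Fintype Q] [DecidableEq Q] [Fintype Q'] [DecidableEq Q']
    {α : Q ⊕ Q' → Type} [∀ p, Fintype (α p)]
    (f : (∀ i, α (.inl i)) → (∀ j, α (.inr j)) → ℝ) :
    Finset.expect Finset.univ (fun y : ∀ p, α p => f (fun i => y (.inl i)) fun j => y (.inr j)) =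
      Finset.expect Finset.univ fun a => Finset.expect Finset.univ fun b => f a b := by
  rw [← Finset.expect_product', Finset.univ_product_univ]
  exact Fintype.expect_equiv (Equiv.sumPiEquivProdPi α) _ _ fun y => rfl

/-- Resampling one coordinate preserves the uniform distribution, by the involution that swaps the
old and the new value. -/
theorem expect_update {Q : Type} [Fintype Q] [DecidableEq Q] {α : Q → Type} [∀ p, Fintype (α p)]
    [∀ p, Nonempty (α p)] (p : Q) (H : (∀ p, α p) → ℝ) :
    Finset.expect Finset.univ H = Finset.expect Finset.univ fun y =>
      Finset.expect Finset.univ fun a => H (Function.update y p a) := by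
  rw [← Finset.expect_product' Finset.univ Finset.univ fun y a => H (Function.update y p a),
    Finset.univ_product_univ]
  let φ : (∀ p, α p) × α p → (∀ p, α p) × α p := fun z => (Function.update z.1 p z.2, z.1 p)
  have hφ : Function.Involutive φ := by
    rintro ⟨y, a⟩
    simp [φ]
  have h1 : Finset.expect Finset.univ H =
      Finset.expect Finset.univ fun z : (∀ p, α p) × α p => H z.1 := by
    rw [← Finset.univ_product_univ, Finset.expect_product' Finset.univ Finset.univ fun y _ => H y]
    simp
  rw [h1]
  exact (Fintype.expect_equiv hφ.toPerm _ _ fun z => rfl).symm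

/-- Resample the string at `p` with the others fixed: at most one value collides with the string at
`p'`, and none if the security parameters differ. -/
theorem expect_collision_le {Q : Type} [Fintype Q] [DecidableEq Q] (r : ℕ → ℕ) (κ : Q → ℕ)
    {p p' : Q} (hp : p ≠ p') : (Finset.expect Finset.univ fun y : ∀ i, Bits (r (κ i)) =>
      if (⟨κ p, y p⟩ : Σ k, Bits (r k)) = ⟨κ p', y p'⟩ then (1 : ℝ) else 0) ≤
        1 / 2 ^ r (κ p) := by
  rw [expect_update p]
  refine Finset.expect_le Finset.univ_nonempty fun y _ => ?_
  simp only [Function.update_self, Function.update_of_ne hp.symm]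
  rw [Fintype.expect_eq_sum_div_card, Finset.sum_boole]
  simp only [Fintype.card_fun, Fintype.card_bool, Fintype.card_fin, Nat.cast_pow, Nat.cast_ofNat]
  gcongr
  exact_mod_cast Finset.card_le_one.mpr fun a ha b hb => by
    simp only [Finset.mem_filter, Finset.mem_univ, true_and] at ha hb
    have h := ha.trans hb.symm
    simpa using h

end Expect

/-! ### Replacing table entries by fresh strings -/

section Table
variable {r m : ℕ → ℕ} {Q : Type} [Fintype Q] [DecidableEq Q] (κ : Q → ℕ) (Λ : ℕ → Prop)
  [DecidablePred Λ]

/-- The answers at the positions `Q`: fresh strings `u` at the positions with `Λ`, and the entries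
of the table `ω` at the inputs `x` at the other positions. -/
def answers (ω : Coord r m → Bool) (x : ∀ i, Bits (r (κ i))) (u : ∀ i, Bits (m (κ i))) :
    ∀ i, Bits (m (κ i)) := fun i => if Λ (κ i) then u i else fun j => ω ⟨κ i, x i, j⟩

theorem answers_false (ω : Coord r m → Bool) (x : ∀ i, Bits (r (κ i)))
    (u : ∀ i, Bits (m (κ i))) :
    answers κ (fun _ => False) ω x u = fun i j => ω ⟨κ i, x i, j⟩ :=
  funext fun _ => if_neg not_false

theorem measurable_answers (x : ∀ i, Bits (r (κ i))) (u : ∀ i, Bits (m (κ i))) :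
    Measurable fun ω : Coord r m → Bool => answers κ Λ ω x u := by
  refine measurable_pi_lambda _ fun i => measurable_pi_lambda _ fun j => ?_
  unfold answers
  by_cases h : Λ (κ i)
  · simp only [h, if_true]
    exact measurable_const
  · simp only [h, if_false]
    exact measurable_pi_apply _

theorem measurable_comp_answers (x : ∀ i, Bits (r (κ i))) (u : ∀ i, Bits (m (κ i)))
    {g : (∀ i, Bits (m (κ i))) → (Coord r m → Bool) → ℝ} (hg : ∀ v, Measurable (g v)) :
    Measurable fun ω : Coord r m → Bool => g (answers κ Λ ω x u) ω := by
  have h : Measurable fun p : (∀ i, Bits (m (κ i))) × (Coord r m → Bool) => g p.1 p.2 :=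
    measurable_from_prod_countable_right hg
  exact h.comp ((measurable_answers κ Λ x u).prodMk measurable_id)

/-- If no position with `Λ` collides with another position, then the entries of a random table at
the positions with `Λ` can be replaced by fresh random strings. -/
theorem integral_answers {g : (∀ i, Bits (m (κ i))) → (Coord r m → Bool) → ℝ}
    (hg : ∀ v, Measurable (g v)) (hb : ∀ v ω, |g v ω| ≤ 1)
    (hinv : ∀ (c : Coord r m → Bool), (∀ j, c j = true → Λ j.1) → ∀ v ω,
      g v (fun j => xor (c j) (ω j)) = g v ω)
    (x : ∀ i, Bits (r (κ i)))
    (hx : ∀ i i', i ≠ i' → Λ (κ i) → (⟨κ i, x i⟩ : Σ k, Bits (r k)) ≠ ⟨κ i', x i'⟩) :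
    ∫ ω, g (fun i j => ω ⟨κ i, x i, j⟩) ω ∂coinsMeasure (Coord r m) =
      ∫ ω, (Finset.expect Finset.univ fun v => g (answers κ Λ ω x v) ω)
        ∂coinsMeasure (Coord r m) := by
  -- The coins read at the positions with `Λ`. By `hx` they are distinct, and no other position
  -- reads them.
  let E : (Σ i : {i // Λ (κ i)}, Fin (m (κ i))) → Coord r m := fun p => ⟨κ p.1, x p.1, p.2⟩
  have hE : Function.Injective E := by
    rintro ⟨⟨i, hi⟩, a⟩ ⟨⟨i', hi'⟩, a'⟩ h
    have h1 : (⟨κ i, x i⟩ : Σ k, Bits (r k)) = ⟨κ i', x i'⟩ :=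
      congrArg (fun j : Coord r m => (⟨j.1, j.2.1⟩ : Σ k, Bits (r k))) h
    have h2 : i = i' := by
      by_contra hne
      exact hx i i' hne hi h1
    subst h2
    simpa [E] using h
  -- The translation of the table that adds `v` at exactly these coins. It preserves the measure and
  -- does not affect the explicit dependence of `g` on the table; averaging over `v` introduces the
  -- fresh strings.
  let c : (∀ i, Bits (m (κ i))) → Coord r m → Bool := fun v =>
    Function.extend E (fun p => v p.1 p.2) fun _ => false
  have hc1 : ∀ v j, c v j = true → Λ j.1 := fun v j hj => by
    by_cases h : ∃ p, E p = j
    · obtain ⟨p, rfl⟩ := h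
      exact p.1.2
    · simp [c, Function.extend_apply' _ _ _ h] at hj
  have hc2 : ∀ v i (_ : Λ (κ i)) a, c v ⟨κ i, x i, a⟩ = v i a := fun v i hi a =>
    hE.extend_apply _ _ ⟨⟨i, hi⟩, a⟩
  have hc3 : ∀ v i (_ : ¬Λ (κ i)) a, c v ⟨κ i, x i, a⟩ = false := fun v i hi a => by
    by_contra h
    exact hi (hc1 v ⟨κ i, x i, a⟩ (by simpa using h))
  let f : (Coord r m → Bool) → ∀ i, Bits (m (κ i)) := fun ω i j => ω ⟨κ i, x i, j⟩
  have hf : Measurable f :=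
    measurable_pi_lambda _ fun i => measurable_pi_lambda _ fun j => measurable_pi_apply _
  have hgm : Measurable fun p : (∀ i, Bits (m (κ i))) × (Coord r m → Bool) => g p.1 p.2 :=
    measurable_from_prod_countable_right hg
  have hG : Measurable fun ω => g (f ω) ω := hgm.comp (hf.prodMk measurable_id)
  have h1 : ∀ v : (∀ i, Bits (m (κ i))), ∫ ω, g (f ω) ω ∂coinsMeasure (Coord r m) =
      ∫ ω, g (answers κ Λ ω x fun i j => xor (v i j) (ω ⟨κ i, x i, j⟩)) ω
        ∂coinsMeasure (Coord r m) := fun v => by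
    rw [← integral_xor (c v) hG]
    congr 1
    funext ω
    rw [hinv (c v) (hc1 v)]
    congr 1
    funext i
    unfold answers
    split_ifs with h
    · funext j
      simp only [f, hc2 v i h]
    · funext j
      simp only [f, hc3 v i h, Bool.false_xor]
  have hmeas : ∀ v : (∀ i, Bits (m (κ i))), Measurable fun ω : Coord r m → Bool =>
      g (answers κ Λ ω x fun i j => xor (v i j) (ω ⟨κ i, x i, j⟩)) ω := fun v => by
    have hij : ∀ i j, Measurable fun ω : Coord r m → Bool =>
        answers κ Λ ω x (fun i j => xor (v i j) (ω ⟨κ i, x i, j⟩)) i j := fun i j => by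
      unfold answers
      by_cases h : Λ (κ i)
      · simp only [h, if_true]
        exact (measurable_of_countable (xor (v i j))).comp (measurable_pi_apply _)
      · simp only [h, if_false]
        exact measurable_pi_apply _
    exact hgm.comp (Measurable.prodMk (measurable_pi_lambda _ fun i =>
      measurable_pi_lambda _ fun j => hij i j) measurable_id)
  have hint : ∀ v : (∀ i, Bits (m (κ i))), Integrable (fun ω : Coord r m → Bool =>
      g (answers κ Λ ω x fun i j => xor (v i j) (ω ⟨κ i, x i, j⟩)) ω)
        (coinsMeasure (Coord r m)) := fun v =>
    Integrable.of_bound (hmeas v).aestronglyMeasurable 1 (.of_forall fun ω => hb _ _)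
  calc ∫ ω, g (f ω) ω ∂coinsMeasure (Coord r m)
      = Finset.expect Finset.univ fun _v : ∀ i, Bits (m (κ i)) =>
          ∫ ω, g (f ω) ω ∂coinsMeasure (Coord r m) := (Fintype.expect_const _).symm
    _ = Finset.expect Finset.univ fun v : ∀ i, Bits (m (κ i)) =>
          ∫ ω, g (answers κ Λ ω x fun i j => xor (v i j) (ω ⟨κ i, x i, j⟩)) ω
            ∂coinsMeasure (Coord r m) := Finset.expect_congr rfl fun v _ => h1 v
    _ = ∫ ω, (Finset.expect Finset.univ fun v : ∀ i, Bits (m (κ i)) =>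
          g (answers κ Λ ω x fun i j => xor (v i j) (ω ⟨κ i, x i, j⟩)) ω)
            ∂coinsMeasure (Coord r m) := by
        simp only [Fintype.expect_eq_sum_div_card]
        rw [integral_div, integral_finsetSum _ fun v _ => hint v]
    _ = _ := by
        congr 1
        funext ω
        -- For a fixed table, adding its entries permutes the strings `v`, so masked fresh strings
        -- are fresh.
        let φ : (∀ i, Bits (m (κ i))) → ∀ i, Bits (m (κ i)) := fun v i j =>
          xor (v i j) (ω ⟨κ i, x i, j⟩)
        have hφ : Function.Involutive φ := fun v => by
          funext i j
          simp [φ]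
        exact Fintype.expect_equiv hφ.toPerm _ _ fun v => rfl

/-- The expectation of `w` for random inputs, with fresh answers at the positions with `Λ`. -/
def tableExpect (w : (∀ i, Bits (r (κ i))) → (∀ i, Bits (m (κ i))) → ℝ)
    (ω : Coord r m → Bool) : ℝ :=
  Finset.expect Finset.univ fun x => Finset.expect Finset.univ fun u => w x (answers κ Λ ω x u)

variable {w : (∀ i, Bits (r (κ i))) → (∀ i, Bits (m (κ i))) → ℝ}

theorem measurable_tableExpect : Measurable (tableExpect (r := r) (m := m) κ Λ w) := by
  unfold tableExpect
  simp only [Fintype.expect_eq_sum_div_card]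
  refine Measurable.div_const (Finset.measurable_sum _ fun x _ => Measurable.div_const
    (Finset.measurable_sum _ fun u _ => ?_) _) _
  exact measurable_comp_answers κ Λ x u (g := fun v _ => w x v) fun v => measurable_const

theorem tableExpect_mem_Icc (hw : ∀ x u, w x u ∈ Set.Icc (0 : ℝ) 1) (ω : Coord r m → Bool) :
    tableExpect κ Λ w ω ∈ Set.Icc (0 : ℝ) 1 :=
  ⟨Finset.expect_nonneg fun _ _ => Finset.expect_nonneg fun _ _ => (hw _ _).1,
    Finset.expect_le Finset.univ_nonempty fun _ _ =>
      Finset.expect_le Finset.univ_nonempty fun _ _ => (hw _ _).2⟩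

/-- The answers with fresh strings depend only on the table entries without `Λ`. This gives the
invariance that `integral_answers` asks for when the simulated expectation itself occurs in `g`. -/
theorem answers_xor (c : Coord r m → Bool) (hc : ∀ j, c j = true → Λ j.1) (ω : Coord r m → Bool)
    (x : ∀ i, Bits (r (κ i))) (u : ∀ i, Bits (m (κ i))) :
    answers κ Λ (fun j => xor (c j) (ω j)) x u = answers κ Λ ω x u := by
  funext i
  unfold answers
  split_ifs with h
  · rfl
  · funext j
    have : c ⟨κ i, x i, j⟩ = false := by
      by_contra h'
      exact h (hc ⟨κ i, x i, j⟩ (by simpa using h'))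
    simp only [this, Bool.false_xor]

/-- The second moment of the error made by replacing the entries of a random table by fresh
random strings. -/
theorem integral_tableExpect_sub_sq_le (hw : ∀ x u, w x u ∈ Set.Icc (0 : ℝ) 1) {η : ℝ}
    (hη0 : 0 ≤ η) (hη : ∀ k, Λ k → 1 / 2 ^ r k ≤ η) :
    ∫ ω, (tableExpect κ (fun _ => False) w ω - tableExpect κ Λ w ω) ^ 2
      ∂coinsMeasure (Coord r m) ≤ 2 * ((2 * Fintype.card Q) ^ 2 * η) := by
  let s : (Coord r m → Bool) → ℝ := tableExpect κ Λ w
  have hs : Measurable s := measurable_tableExpect κ Λ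
  have hs01 : ∀ ω, s ω ∈ Set.Icc (0 : ℝ) 1 := tableExpect_mem_Icc κ Λ hw
  -- Two copies of all positions: the square of an average over seeds is an average over pairs of
  -- independent seed families that read the same table.
  let κ₂ : Q ⊕ Q → ℕ := Sum.elim κ κ
  let tab : (Coord r m → Bool) → (∀ p, Bits (r (κ₂ p))) → ∀ p, Bits (m (κ₂ p)) :=
    fun ω y p j => ω ⟨κ₂ p, y p, j⟩
  let g : (∀ p, Bits (r (κ₂ p))) → (∀ p, Bits (m (κ₂ p))) → (Coord r m → Bool) → ℝ :=
    fun y v ω => (w (fun i => y (.inl i)) (fun i => v (.inl i)) - s ω) *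
      (w (fun i => y (.inr i)) (fun i => v (.inr i)) - s ω)
  have hg : ∀ y v, Measurable (g y v) := fun y v =>
    (measurable_const.sub hs).mul (measurable_const.sub hs)
  have hgb : ∀ y v ω, |g y v ω| ≤ 1 := fun y v ω => by
    have h : ∀ a ∈ Set.Icc (0 : ℝ) 1, |a - s ω| ≤ 1 := fun a ha => by
      have := hs01 ω
      rw [abs_le]
      constructor <;> linarith [ha.1, ha.2, this.1, this.2]
    rw [abs_mul]
    exact mul_le_one₀ (h _ (hw _ _)) (abs_nonneg _) (h _ (hw _ _))
  -- `P` is the product of the centred values of the two copies with the true table, and `P'` is its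
  -- average with fresh strings at the positions with `Λ`.
  let P : (∀ p, Bits (r (κ₂ p))) → (Coord r m → Bool) → ℝ := fun y ω => g y (tab ω y) ω
  let P' : (∀ p, Bits (r (κ₂ p))) → (Coord r m → Bool) → ℝ := fun y ω =>
    Finset.expect Finset.univ fun v => g y (answers κ₂ Λ ω y v) ω
  have hP : ∀ y, Measurable (P y) := fun y => by
    have := measurable_comp_answers (r := r) κ₂ (fun _ => False) y (fun _ _ => false) (hg y)
    simpa only [answers_false] using this
  have hP' : ∀ y, Measurable (P' y) := fun y => by
    simp only [P', Fintype.expect_eq_sum_div_card]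
    exact Measurable.div_const (Finset.measurable_sum _ fun v _ =>
      measurable_comp_answers κ₂ Λ y v (hg y)) _
  have hPb : ∀ y ω, |P y ω| ≤ 1 := fun y ω => hgb _ _ _
  have hP'b : ∀ y ω, |P' y ω| ≤ 1 := fun y ω =>
    (Finset.abs_expect_le _ _).trans (Finset.expect_le Finset.univ_nonempty fun v _ => hgb _ _ _)
  have hPi : ∀ y, Integrable (P y) (coinsMeasure (Coord r m)) := fun y =>
    Integrable.of_bound (hP y).aestronglyMeasurable 1 (.of_forall fun ω => hPb y ω)
  have hP'i : ∀ y, Integrable (P' y) (coinsMeasure (Coord r m)) := fun y =>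
    Integrable.of_bound (hP' y).aestronglyMeasurable 1 (.of_forall fun ω => hP'b y ω)
  have hsq : ∀ ω, (tableExpect κ (fun _ => False) w ω - s ω) ^ 2 =
      Finset.expect Finset.univ fun y => P y ω := fun ω => by
    have h1 : tableExpect κ (fun _ => False) w ω - s ω = Finset.expect Finset.univ
        fun x : ∀ i, Bits (r (κ i)) => (w x (fun i j => ω ⟨κ i, x i, j⟩) - s ω) := by
      rw [Finset.expect_sub_distrib, Fintype.expect_const]
      simp only [tableExpect, answers_false, Fintype.expect_const]
    rw [h1, sq, Fintype.expect_mul_expect]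
    exact (expect_sumPi (α := fun p => Bits (r (κ₂ p))) fun x x' =>
      (w x (fun i j => ω ⟨κ i, x i, j⟩) - s ω) * (w x' (fun i j => ω ⟨κ i, x' i, j⟩) - s ω)).symm
  have hP'eq : ∀ y ω, P' y ω =
      ((Finset.expect Finset.univ fun u => w (fun i => y (.inl i))
        (answers κ Λ ω (fun i => y (.inl i)) u)) - s ω) *
      ((Finset.expect Finset.univ fun u => w (fun i => y (.inr i))
        (answers κ Λ ω (fun i => y (.inr i)) u)) - s ω) := fun y ω => by
    have h1 : ∀ x : (∀ i, Bits (r (κ i))), (Finset.expect Finset.univ fun u =>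
        w x (answers κ Λ ω x u)) - s ω = Finset.expect Finset.univ
          fun u => (w x (answers κ Λ ω x u) - s ω) := fun x => by
      rw [Finset.expect_sub_distrib, Fintype.expect_const]
    refine Eq.trans ?_ (congrArg₂ (· * ·) (h1 fun i => y (.inl i)) (h1 fun i => y (.inr i))).symm
    refine Eq.trans ?_ (Fintype.expect_mul_expect _ _).symm
    exact expect_sumPi (α := fun p => Bits (m (κ₂ p))) fun u u' =>
      (w (fun i => y (.inl i)) (answers κ Λ ω (fun i => y (.inl i)) u) - s ω) *
        (w (fun i => y (.inr i)) (answers κ Λ ω (fun i => y (.inr i)) u') - s ω)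
  -- For a fixed table the two copies with fresh strings are independent, and each is centred at its
  -- own mean `s ω`.
  have hP'0 : ∀ ω, Finset.expect Finset.univ (fun y => P' y ω) = 0 := fun ω => by
    simp only [hP'eq]
    refine (expect_sumPi (α := fun p => Bits (r (κ₂ p))) fun x x' =>
      ((Finset.expect Finset.univ fun u => w x (answers κ Λ ω x u)) - s ω) *
        ((Finset.expect Finset.univ fun u => w x' (answers κ Λ ω x' u)) - s ω)).trans ?_
    have h0 : (Finset.expect Finset.univ fun x : ∀ i, Bits (r (κ i)) =>
        (Finset.expect Finset.univ fun u => w x (answers κ Λ ω x u)) - s ω) = 0 := by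
      rw [Finset.expect_sub_distrib, Fintype.expect_const]
      exact sub_self (s ω)
    refine (Fintype.expect_mul_expect _ _).symm.trans ?_
    exact (congrArg (· * _) h0).trans (zero_mul _)
  let coll : (∀ p, Bits (r (κ₂ p))) → Prop := fun y => ∃ p p', p ≠ p' ∧ Λ (κ₂ p) ∧
    (⟨κ₂ p, y p⟩ : Σ k, Bits (r k)) = ⟨κ₂ p', y p'⟩
  let W : (∀ p, Bits (r (κ₂ p))) → ℝ := fun y => ∑ p, ∑ p', if p ≠ p' ∧ Λ (κ₂ p) then
    (if (⟨κ₂ p, y p⟩ : Σ k, Bits (r k)) = ⟨κ₂ p', y p'⟩ then (1 : ℝ) else 0) else 0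
  -- Without a collision that involves a position with `Λ`, the two integrals agree. With one, `W y`
  -- is at least 1, and the integrals lie between -1 and 1; hence the factor 2.
  have hdiff : ∀ y, ∫ ω, P y ω ∂coinsMeasure (Coord r m) ≤
      ∫ ω, P' y ω ∂coinsMeasure (Coord r m) + 2 * W y := fun y => by
    have hnn : ∀ p p', (0 : ℝ) ≤ if p ≠ p' ∧ Λ (κ₂ p) then
        (if (⟨κ₂ p, y p⟩ : Σ k, Bits (r k)) = ⟨κ₂ p', y p'⟩ then (1 : ℝ) else 0) else 0 :=
      fun p p' => by split_ifs <;> norm_num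
    by_cases hy : coll y
    · have hW : 1 ≤ W y := by
        obtain ⟨p, p', hp, hΛ, heq⟩ := hy
        refine le_trans ?_ (Finset.single_le_sum (fun p _ => Finset.sum_nonneg fun p' _ =>
          hnn p p') (Finset.mem_univ p))
        refine le_trans ?_ (Finset.single_le_sum (fun p' _ => hnn p p') (Finset.mem_univ p'))
        rw [if_pos ⟨hp, hΛ⟩, if_pos heq]
      have h1 : ∫ ω, P y ω ∂coinsMeasure (Coord r m) ≤ 1 := by
        refine (integral_mono (hPi y) (integrable_const (1 : ℝ))
          fun ω => (abs_le.mp (hPb y ω)).2).trans ?_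
        simp
      have h2 : -1 ≤ ∫ ω, P' y ω ∂coinsMeasure (Coord r m) := by
        refine le_trans ?_ (integral_mono (integrable_const (-1 : ℝ)) (hP'i y)
          fun ω => (abs_le.mp (hP'b y ω)).1)
        simp
      linarith
    · have hW : 0 ≤ W y := Finset.sum_nonneg fun p _ => Finset.sum_nonneg fun p' _ => hnn p p'
      have h1 : ∫ ω, P y ω ∂coinsMeasure (Coord r m) = ∫ ω, P' y ω ∂coinsMeasure (Coord r m) := by
        refine integral_answers κ₂ Λ (hg y) (hgb y) (fun c hc v ω => ?_) y
          fun p p' hp hΛ heq => hy ⟨p, p', hp, hΛ, heq⟩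
        have : s (fun j => xor (c j) (ω j)) = s ω := by
          simp only [s, tableExpect, answers_xor κ Λ c hc]
        simp only [g, this]
      linarith
  -- A union bound over the ordered pairs among the `2 * |Q|` positions of both copies.
  have hWle : Finset.expect Finset.univ W ≤ (2 * Fintype.card Q) ^ 2 * η := by
    have hη' : ∀ p p', (Finset.expect Finset.univ fun y : ∀ p, Bits (r (κ₂ p)) =>
        if p ≠ p' ∧ Λ (κ₂ p) then (if (⟨κ₂ p, y p⟩ : Σ k, Bits (r k)) = ⟨κ₂ p', y p'⟩ then (1 : ℝ)
          else 0) else 0) ≤ η := fun p p' => by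
      by_cases h : p ≠ p' ∧ Λ (κ₂ p)
      · simp only [if_pos h]
        exact (expect_collision_le r κ₂ h.1).trans (hη _ h.2)
      · simp only [if_neg h, Fintype.expect_const]
        exact hη0
    simp only [W]
    rw [Finset.expect_sum_comm]
    simp only [Finset.expect_sum_comm]
    refine (Finset.sum_le_sum fun p _ => Finset.sum_le_sum fun p' _ => hη' p p').trans ?_
    simp only [Finset.sum_const, Finset.card_univ, Fintype.card_sum, nsmul_eq_mul]
    push_cast
    apply le_of_eq
    ring
  calc ∫ ω, (tableExpect κ (fun _ => False) w ω - s ω) ^ 2 ∂coinsMeasure (Coord r m)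
      = Finset.expect Finset.univ fun y => ∫ ω, P y ω ∂coinsMeasure (Coord r m) := by
        simp only [hsq, Fintype.expect_eq_sum_div_card]
        rw [integral_div, integral_finsetSum _ fun y _ => hPi y]
    _ ≤ Finset.expect Finset.univ fun y => (∫ ω, P' y ω ∂coinsMeasure (Coord r m) + 2 * W y) :=
        Finset.expect_le_expect fun y _ => hdiff y
    _ = ∫ ω, (Finset.expect Finset.univ fun y => P' y ω) ∂coinsMeasure (Coord r m) +
          2 * Finset.expect Finset.univ W := by
        rw [Finset.expect_add_distrib, ← Finset.mul_expect]
        congr 1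
        simp only [Fintype.expect_eq_sum_div_card]
        rw [integral_div, integral_finsetSum _ fun y _ => hP'i y]
    _ ≤ 2 * ((2 * Fintype.card Q) ^ 2 * η) := by
        simp only [hP'0, integral_zero, zero_add]
        exact mul_le_mul_of_nonneg_left hWle (by norm_num)

end Table

/-! ## Runs with an oracle that is a mixture of oracles -/

section Mixture
variable {T : OracleType} {W : Type} [Fintype W] [DecidableEq W]

theorem toEnd_gate (O O' : Oracle T) (g : Gate W) :
    (Instr.gate g : Instr T W).toEnd O = (Instr.gate g : Instr T W).toEnd O' := rfl

theorem queryMap_sum {A B ι : Type} [Fintype A] [DecidableEq A] [Fintype B] [DecidableEq B]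
    [Fintype ι] (inp : A ↪ W) (ans : B ↪ W) (c : ℂ) (M : ι → (B → Bool) → Op A) (ρ : Op W) :
    queryMap inp ans (fun s => c • ∑ a, M a s) ρ = c • ∑ a, queryMap inp ans (M a) ρ := by
  ext x y
  rw [Matrix.smul_apply, Matrix.sum_apply, smul_eq_mul]
  simp only [queryMap]
  split_ifs with h
  · simp only [Matrix.smul_apply, Matrix.sum_apply, smul_eq_mul, Finset.sum_mul, Finset.mul_sum]
    simp only [Finset.sum_comm (s := (Finset.univ : Finset ι)), mul_assoc]
  · simp

/-- The operators of a list of instructions, each with its own oracle, multiply to the mixture of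
the products. -/
theorem prod_toEnd_mixture (is : List (Instr T W)) (O : Oracle T) {α : Fin is.length → Type}
    [∀ i, Fintype (α i)] (F : ∀ i, α i → Oracle T)
    (h : ∀ i, (is.get i).toEnd O =
      ((Fintype.card (α i) : ℂ))⁻¹ • ∑ a, (is.get i).toEnd (F i a)) :
    (is.map (Instr.toEnd O)).prod = ((Fintype.card (∀ i, α i) : ℂ))⁻¹ •
      ∑ a : ∀ i, α i, (List.ofFn fun i => (is.get i).toEnd (F i (a i))).prod := by
  have h1 : is.map (Instr.toEnd O) = List.ofFn fun i : Fin is.length => (is.get i).toEnd O := by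
    rw [List.ofFn_comp' is.get (Instr.toEnd O), List.ofFn_get]
  -- The product is multilinear in its factors, so a product of averages expands into an average of
  -- products.
  have key := MultilinearMap.mkPiAlgebraFin_apply (R := ℂ) (n := is.length)
    (A := Module.End ℂ (Op W)) fun i => (is.get i).toEnd O
  rw [h1, ← key]
  simp only [h]
  rw [MultilinearMap.map_smul_univ, MultilinearMap.map_sum, Fintype.card_pi]
  push_cast
  rw [Finset.prod_inv_distrib]
  simp only [MultilinearMap.mkPiAlgebraFin_apply]

theorem prod_toEnd_posSemidef {q : ℕ} (F : Fin q → Oracle T) (hF : ∀ i, (F i).IsMeasurement)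
    (is : Fin q → Instr T W) {ρ : Op W} (hρ : ρ.PosSemidef) :
    ((List.ofFn fun i => (is i).toEnd (F i)).prod ρ).PosSemidef := by
  induction q with
  | zero => simpa using hρ
  | succ q ih =>
    rw [List.ofFn_succ, List.prod_cons, Module.End.mul_apply]
    exact (is 0).apply_posSemidef (fun k s => (hF 0 k).1 s)
      (ih (fun i => F i.succ) (fun i => hF _) fun i => is i.succ)

theorem prod_toEnd_trace {q : ℕ} (F : Fin q → Oracle T) (hF : ∀ i, (F i).IsMeasurement)
    (is : Fin q → Instr T W) (ρ : Op W) :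
    ∑ x, (List.ofFn fun i => (is i).toEnd (F i)).prod ρ x x = ∑ x, ρ x x := by
  induction q with
  | zero => simp
  | succ q ih =>
    rw [List.ofFn_succ, List.prod_cons, Module.End.mul_apply]
    exact ((is 0).trace_apply (hF 0) _).trans (ih (fun i => F i.succ) (fun i => hF _)
      fun i => is i.succ)

/-- `probOne` as a linear map. -/
def probOneₗ (i : W) : Op W →ₗ[ℝ] ℝ where
  toFun := probOne i
  map_add' ρ σ := by
    simp only [probOne, ← Finset.sum_add_distrib, Matrix.add_apply, Complex.add_re]
    exact Finset.sum_congr rfl fun z _ => by split_ifs <;> simp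
  map_smul' c ρ := by
    simp only [probOne, Finset.mul_sum, Matrix.smul_apply, smul_eq_mul, RingHom.id_apply,
      Complex.real_smul, Complex.re_ofReal_mul]
    exact Finset.sum_congr rfl fun z _ => by split_ifs <;> simp

theorem probOne_mixture {ι : Type} [Fintype ι] (i : W) (ρ : ι → Op W) :
    probOne i (((Fintype.card ι : ℂ))⁻¹ • ∑ a, ρ a) =
      Finset.expect Finset.univ fun a => probOne i (ρ a) := by
  have h : ((Fintype.card ι : ℂ))⁻¹ • ∑ a, ρ a = ((Fintype.card ι : ℝ))⁻¹ • ∑ a, ρ a := by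
    ext x y
    simp only [Matrix.smul_apply, Complex.real_smul, smul_eq_mul]
    push_cast
    rfl
  rw [h, Fintype.expect_eq_sum_div_card]
  change probOneₗ i _ = _
  rw [map_smul, map_sum, smul_eq_mul, div_eq_inv_mul]
  rfl

end Mixture

/-! ## Masked answers -/

section Masked
variable (S : UTPKE) (r : ℕ → ℕ)

/-- The interface of telegraphers that output a seed and a masked message. -/
abbrev maskedType : OracleType := S.telegrapherType fun κ => r κ + S.msgLen κ

variable {S r}
variable (M : ∀ κ, Bits (S.msgLen κ) → Op (Fin (S.pkLen κ) ⊕ Fin (S.ctLen κ)))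

/-- The oracle with seeds `x` and masks `v`. -/
def pointOracle (x : ∀ κ, Bits (r κ)) (v : ∀ κ, Bits (S.msgLen κ)) : Oracle (maskedType S r) :=
  fun (κ : ℕ) (st : Bits (r κ + S.msgLen κ)) => if (fun j => st (Fin.castAdd (S.msgLen κ) j)) = x κ then
    M κ (fun j => xor (st (Fin.natAdd (r κ) j)) (v κ j)) else 0

/-- The oracle with random seeds that takes the masks from the table `ω`; for security parameters
with `Λ`, the answers are uniformly random. -/
def tableOracle (Λ : ℕ → Prop) [DecidablePred Λ] (ω : Coord r S.msgLen → Bool) :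
    Oracle (maskedType S r) := fun (κ : ℕ) (st : Bits (r κ + S.msgLen κ)) =>
  if Λ κ then (1 / 2 ^ (r κ + S.msgLen κ) : ℂ) • (1 : Op (Fin (S.pkLen κ) ⊕ Fin (S.ctLen κ)))
  else (1 / 2 ^ r κ : ℂ) • M κ (fun j => xor (st (Fin.natAdd (r κ) j))
    (ω ⟨κ, fun i => st (Fin.castAdd (S.msgLen κ) i), j⟩))

theorem sum_bits_add {E : Type*} [AddCommMonoid E] (a b : ℕ) (F : Bits (a + b) → E) :
    ∑ st, F st = ∑ x : Bits a, ∑ y : Bits b, F (Fin.append x y) := by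
  rw [← Fintype.sum_prod_type']
  exact (Fintype.sum_equiv (Fin.appendEquiv a b) _ _ fun p => rfl).symm

theorem sum_xor {E : Type*} [AddCommMonoid E] {m : ℕ} (v : Bits m) (F : Bits m → E) :
    ∑ y : Bits m, F (fun j => xor (y j) (v j)) = ∑ y, F y := by
  have h : Function.Involutive fun (y : Bits m) j => xor (y j) (v j) := fun y => by
    funext j
    simp
  exact Fintype.sum_equiv h.toPerm _ _ fun y => rfl

variable {M}

theorem pointOracle_isMeasurement (hM : ∀ κ, (∀ s, (M κ s).PosSemidef) ∧ ∑ s, M κ s = 1)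
    (x : ∀ κ, Bits (r κ)) (v : ∀ κ, Bits (S.msgLen κ)) :
    (pointOracle M x v).IsMeasurement := by
  intro (κ : ℕ)
  constructor
  · intro st
    change Matrix.PosSemidef (if (fun j => st (Fin.castAdd (S.msgLen κ) j)) = x κ then
      M κ (fun j => xor (st (Fin.natAdd (r κ) j)) (v κ j)) else 0)
    split_ifs
    · exact (hM κ).1 _
    · exact Matrix.PosSemidef.zero
  · refine (sum_bits_add (r κ) (S.msgLen κ) (pointOracle M x v κ)).trans ?_
    have h : ∀ (a : Bits (r κ)) (b : Bits (S.msgLen κ)), pointOracle M x v κ (Fin.append a b) =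
        if a = x κ then M κ (fun j => xor (b j) (v κ j)) else 0 := fun a b => by
      simp only [pointOracle, Fin.append_left, Fin.append_right]
      rfl
    refine (Finset.sum_congr rfl fun a _ => Finset.sum_congr rfl fun b _ => h a b).trans ?_
    refine Finset.sum_comm.trans ?_
    refine Eq.trans (Finset.sum_congr rfl fun b _ => ?_)
      ((sum_xor (v κ) (M κ)).trans (hM κ).2)
    exact Finset.sum_ite_eq' _ _ _ |>.trans (if_pos (Finset.mem_univ _))

/-- Averaging over the seed contributes `2 ^ (-a)`. A mask from the table leaves the operator of the
unmasked string. A fresh mask sums over all strings; for a measurement that sum is the identity, so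
the answer is uniform and independent of the query. -/
theorem mixture_answers {E : Type*} [AddCommGroup E] [Module ℂ E] {a b : ℕ} (x : Bits a) (y : Bits b)
    (N : Bits b → E) (P : Prop) [Decidable P] (g : Bits a → Bits b) :
    ((Fintype.card (Bits a × Bits b) : ℂ))⁻¹ • ∑ p : Bits a × Bits b,
      (if x = p.1 then N (fun j => xor (y j) ((if P then p.2 else g p.1) j)) else 0) =
    if P then (1 / 2 ^ (a + b) : ℂ) • ∑ s, N s
      else (1 / 2 ^ a : ℂ) • N (fun j => xor (y j) (g x j)) := by
  have hcard : (Fintype.card (Bits a × Bits b) : ℂ) = 2 ^ a * 2 ^ b := by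
    simp [Fintype.card_prod]
  rw [hcard, Fintype.sum_prod_type, Finset.sum_comm]
  simp only [Finset.sum_ite_eq, Finset.mem_univ, if_true]
  split_ifs
  · have : ∑ z : Bits b, N (fun j => xor (y j) (z j)) = ∑ z, N z := by
      simp only [Bool.xor_comm (y _)]
      exact sum_xor y N
    rw [this, pow_add, one_div]
  · rw [Finset.sum_const, Finset.card_univ, ← Nat.cast_smul_eq_nsmul ℂ, smul_smul]
    congr 1
    simp only [Fintype.card_fun, Fintype.card_bool, Fintype.card_fin]
    push_cast
    field_simp

/-- A query at `κ` reads the seeds and masks at `κ` only, so `x₀` and `v₀` merely fill the other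
components. -/
theorem tableOracle_eq (hM : ∀ κ, (∀ s, (M κ s).PosSemidef) ∧ ∑ s, M κ s = 1)
    (Λ : ℕ → Prop) [DecidablePred Λ] (ω : Coord r S.msgLen → Bool) (κ : ℕ)
    (st : Bits (r κ + S.msgLen κ)) (x₀ : ∀ κ, Bits (r κ)) (v₀ : ∀ κ, Bits (S.msgLen κ)) :
    tableOracle M Λ ω κ st = ((Fintype.card (Bits (r κ) × Bits (S.msgLen κ)) : ℂ))⁻¹ •
      ∑ p : Bits (r κ) × Bits (S.msgLen κ), pointOracle M (Function.update x₀ κ p.1)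
        (Function.update v₀ κ (if Λ κ then p.2 else fun j => ω ⟨κ, p.1, j⟩)) κ st := by
  have h := mixture_answers (fun i => st (Fin.castAdd (S.msgLen κ) i))
    (fun j => st (Fin.natAdd (r κ) j)) (M κ) (Λ κ) fun x j => ω ⟨κ, x, j⟩
  rw [(hM κ).2] at h
  refine h.symm.trans ?_
  simp only [pointOracle, Function.update_self]
  rfl

variable {W : Type} [Fintype W] [DecidableEq W]

theorem queryMap_tableOracle (hM : ∀ κ, (∀ s, (M κ s).PosSemidef) ∧ ∑ s, M κ s = 1)
    (Λ : ℕ → Prop) [DecidablePred Λ] (ω : Coord r S.msgLen → Bool) (k : ℕ)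
    (inp : Fin (S.pkLen k) ⊕ Fin (S.ctLen k) ↪ W) (ans : Fin (r k + S.msgLen k) ↪ W)
    (x₀ : ∀ κ, Bits (r κ)) (v₀ : ∀ κ, Bits (S.msgLen κ)) (ρ : Op W) :
    queryMap inp ans (tableOracle M Λ ω k) ρ =
      ((Fintype.card (Bits (r k) × Bits (S.msgLen k)) : ℂ))⁻¹ •
      ∑ p : Bits (r k) × Bits (S.msgLen k), queryMap inp ans
        (pointOracle M (Function.update x₀ k p.1)
          (Function.update v₀ k (if Λ k then p.2 else fun j => ω ⟨k, p.1, j⟩)) k) ρ := by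
  refine Eq.trans ?_ (queryMap_sum (A := Fin (S.pkLen k) ⊕ Fin (S.ctLen k))
    (B := Fin (r k + S.msgLen k)) inp ans _
    (fun p : Bits (r k) × Bits (S.msgLen k) => pointOracle M (Function.update x₀ k p.1)
      (Function.update v₀ k (if Λ k then p.2 else fun j => ω ⟨k, p.1, j⟩)) k) ρ)
  exact congrArg (fun N : Bits (r k + S.msgLen k) → Op (Fin (S.pkLen k) ⊕ Fin (S.ctLen k)) => queryMap inp ans N ρ)
    (funext fun st => tableOracle_eq hM Λ ω k st x₀ v₀)

/-- The security parameter of a query. -/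
def queryKey : Instr (maskedType S r) W → ℕ
  | .gate _ => 0
  | .query k _ _ _ => k

/-- A gate ignores the oracle, so averaging it over dummy seeds at parameter 0 changes nothing.
Every instruction can thus count as one position. -/
theorem toEnd_tableOracle (hM : ∀ κ, (∀ s, (M κ s).PosSemidef) ∧ ∑ s, M κ s = 1)
    (Λ : ℕ → Prop) [DecidablePred Λ] (ω : Coord r S.msgLen → Bool)
    (i : Instr (maskedType S r) W) (x₀ : ∀ κ, Bits (r κ)) (v₀ : ∀ κ, Bits (S.msgLen κ)) :
    i.toEnd (tableOracle M Λ ω) =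
      ((Fintype.card (Bits (r (queryKey i)) × Bits (S.msgLen (queryKey i))) : ℂ))⁻¹ •
      ∑ p : Bits (r (queryKey i)) × Bits (S.msgLen (queryKey i)),
        i.toEnd (pointOracle M (Function.update x₀ (queryKey i) p.1)
          (Function.update v₀ (queryKey i)
            (if Λ (queryKey i) then p.2 else fun j => ω ⟨queryKey i, p.1, j⟩))) := by
  cases i with
  | gate g =>
    rw [Finset.sum_congr rfl fun p _ => toEnd_gate _ (tableOracle M Λ ω) g, Finset.sum_const,
      Finset.card_univ, ← Nat.cast_smul_eq_nsmul ℂ, smul_smul, inv_mul_cancel₀, one_smul]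
    exact Nat.cast_ne_zero.mpr Fintype.card_ne_zero
  | query k inp ans h =>
    refine LinearMap.ext fun ρ => ?_
    rw [LinearMap.smul_apply, LinearMap.sum_apply]
    exact queryMap_tableOracle hM Λ ω k inp ans x₀ v₀ ρ

/-- The probability of the output `1` with seeds `x` and masks `v`. -/
def pointProb (M : ∀ κ, Bits (S.msgLen κ) → Op (Fin (S.pkLen κ) ⊕ Fin (S.ctLen κ)))
    (L : List (Instr (maskedType S r) W)) (o : W) (ρ : Op W)
    (x : ∀ i : Fin L.length, Bits (r (queryKey (L.get i))))
    (v : ∀ i : Fin L.length, Bits (S.msgLen (queryKey (L.get i)))) : ℝ :=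
  probOne o ((List.ofFn fun i => (L.get i).toEnd (pointOracle M
    (Function.update (fun _ _ => false) (queryKey (L.get i)) (x i))
    (Function.update (fun _ _ => false) (queryKey (L.get i)) (v i)))).prod ρ)

theorem pointProb_mem_Icc (hM : ∀ κ, (∀ s, (M κ s).PosSemidef) ∧ ∑ s, M κ s = 1)
    (L : List (Instr (maskedType S r) W)) (o : W) {ρ : Op W} (hρ : ρ.PosSemidef)
    (h1 : ∑ x, ρ x x = 1) (x : ∀ i : Fin L.length, Bits (r (queryKey (L.get i))))
    (v : ∀ i : Fin L.length, Bits (S.msgLen (queryKey (L.get i)))) :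
    pointProb M L o ρ x v ∈ Set.Icc (0 : ℝ) 1 := by
  have hp := prod_toEnd_posSemidef (fun i => pointOracle M
    (Function.update (fun _ _ => false) (queryKey (L.get i)) (x i))
    (Function.update (fun _ _ => false) (queryKey (L.get i)) (v i)))
    (fun i => pointOracle_isMeasurement hM _ _) L.get hρ
  exact ⟨probOne_nonneg o hp, probOne_le_one o hp ((prod_toEnd_trace _
    (fun i => pointOracle_isMeasurement hM _ _) L.get ρ).trans h1)⟩

/-- A run with a table oracle is a mixture of runs with fixed seeds and masks. -/
theorem probOne_runInstrs_tableOracle (hM : ∀ κ, (∀ s, (M κ s).PosSemidef) ∧ ∑ s, M κ s = 1)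
    (Λ : ℕ → Prop) [DecidablePred Λ] (ω : Coord r S.msgLen → Bool)
    (is : List (Instr (maskedType S r) W)) (o : W) (ρ : Op W) :
    probOne o (runInstrs (tableOracle M Λ ω) is ρ) =
      tableExpect (fun i => queryKey (is.reverse.get i)) Λ (pointProb M is.reverse o ρ) ω := by
  rw [← toEnd_prod_reverse, prod_toEnd_mixture is.reverse _ _ fun i =>
    toEnd_tableOracle hM Λ ω (is.reverse.get i) (fun _ _ => false) (fun _ _ => false),
    LinearMap.smul_apply, LinearMap.sum_apply, probOne_mixture, tableExpect,
    ← Finset.expect_product', Finset.univ_product_univ]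
  exact Fintype.expect_equiv (Equiv.arrowProdEquivProdArrow _ _ _) _ _ fun a => rfl

end Masked

/-! ## Interactions as lists of instructions -/

namespace InteractiveAlg
variable {T : OracleType} {C : Challenger} (A : InteractiveAlg T C)

/-- The wires of the algorithm among the wires of the interaction. -/
def algWires (n : ℕ) : Fin (A.memLen n) ⊕ Fin (C.msgLen n (A.len n)) ↪ A.Wires n :=
  Function.Embedding.sumMap (Function.Embedding.refl _) Function.Embedding.inl

/-- All instructions of an interaction. -/
def allInstrs (n : ℕ) : List (Instr T (A.Wires n)) :=
  (List.finRange (C.rounds n (A.len n))).flatMap (fun i =>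
    ((C.circ n (A.len n) i.castSucc).map (Gate.map Function.Embedding.inr)).map Instr.gate ++
      (A.circ n i).map (Instr.map (A.algWires n))) ++
  ((C.circ n (A.len n) (Fin.last _)).map (Gate.map Function.Embedding.inr)).map Instr.gate

theorem winProb_eq_runInstrs (O : Oracle T) (n : ℕ) : A.winProb O n =
    probOne (Sum.inr (Sum.inr (C.win n (A.len n))))
      (runInstrs O (A.allInstrs n) (basis fun _ => false)) := by
  rw [allInstrs, runInstrs_append, runInstrs_gate, winProb, challengerMove]
  congr 2
  generalize (basis fun _ => false : Op (A.Wires n)) = ρ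
  generalize List.finRange (C.rounds n (A.len n)) = l
  induction l generalizing ρ with
  | nil => rfl
  | cons i l ih =>
    rw [List.flatMap_cons, runInstrs_append, runInstrs_append, runInstrs_gate, List.foldl_cons, ih]
    rfl

theorem winProb_mem_Icc {O : Oracle T} (hO : O.IsMeasurement) (n : ℕ) :
    A.winProb O n ∈ Set.Icc (0 : ℝ) 1 := by
  rw [winProb_eq_runInstrs]
  have hp := runInstrs_posSemidef (fun k s => (hO k).1 s) (A.allInstrs n)
    (basis_posSemidef fun _ => false)
  exact ⟨probOne_nonneg _ hp, probOne_le_one _ hp ((runInstrs_trace hO _ _).trans (trace_basis _))⟩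

end InteractiveAlg

theorem length_le_gatesCost {W : Type} (gs : List (Gate W)) : gs.length ≤ gatesCost gs := by
  induction gs with
  | nil => simp
  | cons g gs ih =>
    have : 1 ≤ g.cost := by cases g <;> simp [Gate.cost]
    simp only [gatesCost, List.map_cons, List.sum_cons, List.length_cons] at ih ⊢
    omega

theorem length_le_instrsCost {T : OracleType} {W : Type} (is : List (Instr T W)) :
    is.length ≤ instrsCost is := by
  induction is with
  | nil => simp
  | cons i is ih =>
    have : 1 ≤ i.cost := by rcases i with (_ | _ | _ | _ | _) | _ <;> simp [Instr.cost, Gate.cost]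
    simp only [instrsCost, List.map_cons, List.sum_cons, List.length_cons] at ih ⊢
    omega

/-- This bounds the number of positions in the collision estimate, because every gate and query
costs at least 1. -/
theorem InteractiveAlg.length_allInstrs_le {T : OracleType} {C : Challenger}
    (A : InteractiveAlg T C) (n : ℕ) : (A.allInstrs n).length ≤
      ∑ i, gatesCost (C.circ n (A.len n) i) + ∑ i, instrsCost (A.circ n i) := by
  rw [allInstrs, List.length_append, List.length_flatMap, Fin.sum_univ_castSucc]
  simp only [List.length_append, List.length_map]
  have h := length_le_gatesCost (C.circ n (A.len n) (Fin.last _))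
  have h2 : ((List.finRange (C.rounds n (A.len n))).map fun i =>
      (C.circ n (A.len n) i.castSucc).length + (A.circ n i).length).sum ≤
      ∑ i : Fin (C.rounds n (A.len n)), gatesCost (C.circ n (A.len n) i.castSucc) +
        ∑ i, instrsCost (A.circ n i) := by
    rw [← Finset.sum_add_distrib, ← List.ofFn_eq_map, List.sum_ofFn]
    exact Finset.sum_le_sum fun i _ => add_le_add (length_le_gatesCost _) (length_le_instrsCost _)
  omega

/-! ## Replacing queries by gates -/

theorem Gate.map_map {U V W : Type} (f : U ↪ V) (g : V ↪ W) (h : Gate U) :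
    (h.map f).map g = h.map (f.trans g) := by
  cases h <;> simp [Gate.map, Finset.map_map]

theorem Gate.map_map_list {U V W : Type} (f : U ↪ V) (g : V ↪ W) (l : List (Gate U)) :
    (l.map (Gate.map f)).map (Gate.map g) = l.map (Gate.map (f.trans g)) := by
  rw [List.map_map]
  exact List.map_congr_left fun h _ => h.map_map f g

section Compile
variable {V W : Type} {a : ℕ}

/-- The wires of a query together with the work wires `z`. -/
def queryWires {A B N : Type} [Fintype N] (inp : A ↪ V) (ans : B ↪ V) (h : ∀ a b, inp a ≠ ans b)
    (e : V ↪ W) (z : Fin a ↪ W) (hz : ∀ j v, z j ≠ e v) (hN : Fintype.card N ≤ a) :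
    (A ⊕ B) ⊕ N ↪ W :=
  ⟨Sum.elim (Sum.elim (fun i => e (inp i)) fun i => e (ans i))
    fun i => z (Fin.castLE hN (Fintype.equivFin N i)), by
      refine Function.Injective.sumElim (Function.Injective.sumElim
        (e.injective.comp inp.injective) (e.injective.comp ans.injective)
        fun i j hij => h i j (e.injective hij))
        (z.injective.comp ((Fin.castLE_injective hN).comp (Fintype.equivFin N).injective)) ?_
      rintro (i | i) j <;> exact fun hij => hz _ _ hij.symm⟩

variable {T : OracleType} (D : ∀ k, Device (T.In k) (T.Out k))

/-- Gates that perform an instruction, where queries are answered by devices. -/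
def compileInstr (e : V ↪ W) (z : Fin a ↪ W) (hz : ∀ j v, z j ≠ e v) :
    Instr T V → List (Gate W)
  | .gate g => [g.map e]
  | .query k inp ans h =>
    -- The empty list is a default that does not occur under `QueriesBounded`.
    if hN : Fintype.card (D k).Anc ≤ a then
      (D k).queryGates.map (Gate.map (queryWires inp ans h e z hz hN)) else []

/-- The queries of a list of instructions need at most `a` work wires and cost at most `b`. -/
def QueriesBounded (a b : ℕ) (is : List (Instr T V)) : Prop :=
  ∀ k inp ans h, Instr.query k inp ans h ∈ is →
    Fintype.card (D k).Anc ≤ a ∧ gatesCost (D k).queryGates ≤ b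

variable {D} [Fintype W] [DecidableEq W]

theorem gatesCost_compileInstr {e : V ↪ W} {z : Fin a ↪ W} {hz : ∀ j v, z j ≠ e v} {b : ℕ}
    {is : List (Instr T V)} (h : QueriesBounded D a b is) :
    gatesCost (is.flatMap (compileInstr D e z hz)) ≤ instrsCost is * (b + 1) := by
  induction is with
  | nil => simp [gatesCost]
  | cons i is ih =>
    have hi : gatesCost (compileInstr D e z hz i) ≤ i.cost * (b + 1) := by
      cases i with
      | gate g =>
        simp only [compileInstr, gatesCost, List.map_cons, List.map_nil, List.sum_cons,
          List.sum_nil, Gate.cost_map, Instr.cost, add_zero]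
        exact Nat.le_mul_of_pos_right _ (Nat.succ_pos b)
      | query k inp ans hk =>
        obtain ⟨h1, h2⟩ := h k inp ans hk (by simp)
        simp only [compileInstr, dif_pos h1, gatesCost_map, Instr.cost]
        omega
    rw [List.flatMap_cons, gatesCost_append]
    refine (add_le_add hi (ih fun k inp ans hk hm => h k inp ans hk (by simp [hm]))).trans ?_
    rw [← add_mul]
    simp [instrsCost]

variable [DecidableEq V]

/-- The compiled instructions simulate the instructions, also on larger registers. -/
theorem runGates_compileInstr {V' W' : Type} [DecidableEq V'] [DecidableEq W'] {e : V ↪ W}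
    {z : Fin a ↪ W} {hz : ∀ j v, z j ≠ e v} {b : ℕ} {is : List (Instr T V)}
    (h : QueriesBounded D a b is) (f : V ↪ V') (g : W ↪ W') (e' : V' ↪ W')
    (hsq : e.trans g = f.trans e') (hz' : ∀ j v, g (z j) ≠ e' v) (ρ : Op V') :
    runGates ((is.flatMap (compileInstr D e z hz)).map (Gate.map g)) (pad e' ρ) =
      pad e' (runInstrs (fun k => (D k).povm) (is.map (Instr.map f)) ρ) := by
  have hsq' : ∀ v, g (e v) = e' (f v) := fun v => DFunLike.congr_fun hsq v
  induction is generalizing ρ with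
  | nil => rfl
  | cons i is ih =>
    have hi : ∀ ρ : Op V', runGates ((compileInstr D e z hz i).map (Gate.map g)) (pad e' ρ) =
        pad e' ((i.map f).apply (fun k => (D k).povm) ρ) := fun ρ => by
      cases i with
      | gate q =>
        have := runGates_map_pad e' [q.map f] ρ
        simp only [List.map_cons, List.map_nil, Gate.map_map] at this
        simp only [compileInstr, List.map_cons, List.map_nil, Gate.map_map, hsq]
        exact this
      | query k inp ans hk =>
        obtain ⟨h1, h2⟩ := h k inp ans hk (by simp)
        rw [compileInstr, dif_pos h1, Gate.map_map_list]
        exact (D k).runGates_queryGates_map (inp.trans f) (ans.trans f) (by simpa using hk) e' _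
          (fun i => hsq' (inp i)) (fun i => hsq' (ans i)) (fun n v => hz' _ v) ρ
    rw [List.flatMap_cons, List.map_append, runGates_append, hi,
      ih fun k inp ans hk hm => h k inp ans hk (by simp [hm])]
    rfl

end Compile

/-! ## Algorithms without oracle -/

namespace InteractiveAlg
variable {T : OracleType} {C : Challenger} (A : InteractiveAlg T C)
  (D : ∀ (_n : ℕ) (k : T.Idx), Device (T.In k) (T.Out k)) (a : ℕ → ℕ)

/-- The wires of the algorithm among those of the simulation. -/
def simWires (n : ℕ) : Fin (A.memLen n) ⊕ Fin (C.msgLen n (A.len n)) ↪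
    Fin (A.memLen n + a n) ⊕ Fin (C.msgLen n (A.len n)) :=
  Function.Embedding.sumMap (Fin.castAddEmb (a n)) (Function.Embedding.refl _)

/-- The work wires of the simulation. -/
def simAnc (n : ℕ) : Fin (a n) ↪ Fin (A.memLen n + a n) ⊕ Fin (C.msgLen n (A.len n)) :=
  (Fin.natAddEmb (A.memLen n)).trans Function.Embedding.inl

theorem castAdd_ne_natAdd {p q : ℕ} (i : Fin p) (j : Fin q) : Fin.natAdd p j ≠ Fin.castAdd q i := by
  intro h
  have := congrArg Fin.val h
  simp only [Fin.val_natAdd, Fin.val_castAdd] at this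
  omega

theorem simAnc_ne (n : ℕ) (j : Fin (a n)) (v : Fin (A.memLen n) ⊕ Fin (C.msgLen n (A.len n))) :
    A.simAnc a n j ≠ A.simWires a n v := by
  rcases v with v | v
  · intro h
    exact castAdd_ne_natAdd v j (Sum.inl_injective h)
  · simp [simAnc, simWires]

/-- The algorithm that answers the queries of `A` with devices. -/
def simulate : InteractiveAlg OracleType.none C where
  len := A.len
  memLen n := A.memLen n + a n
  circ n i := ((A.circ n i).flatMap
    (compileInstr (D n) (A.simWires a n) (A.simAnc a n) (A.simAnc_ne a n))).map Instr.gate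

/-- All wires of the interaction among those of the simulation. -/
def simAllWires (n : ℕ) : A.Wires n ↪ Fin (A.memLen n + a n) ⊕
    (Fin (C.msgLen n (A.len n)) ⊕ Fin (C.memLen n (A.len n))) :=
  Function.Embedding.sumMap (Fin.castAddEmb (a n)) (Function.Embedding.refl _)

variable {D a}

/-- Padding with zero work wires intertwines every move of the original interaction with the
corresponding move of the simulation. The length parameter is unchanged, so both face the same
challenger. -/
theorem winProb_simulate {n b : ℕ} (h : ∀ i, QueriesBounded (D n) (a n) b (A.circ n i)) :
    (A.simulate D a).winProb Oracle.none n = A.winProb (fun k => (D n k).povm) n := by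
  have hch : ∀ i (ρ : Op (A.Wires n)), runGates ((C.circ n (A.len n) i).map
      (Gate.map Function.Embedding.inr)) (pad (A.simAllWires a n) ρ) =
        pad (A.simAllWires a n) (A.challengerMove n i ρ) := fun i ρ => by
    rw [challengerMove, ← runGates_map_pad, Gate.map_map_list]
    rfl
  let g : Fin (A.memLen n + a n) ⊕ Fin (C.msgLen n (A.len n)) ↪ Fin (A.memLen n + a n) ⊕
      (Fin (C.msgLen n (A.len n)) ⊕ Fin (C.memLen n (A.len n))) :=
    Function.Embedding.sumMap (Function.Embedding.refl _) Function.Embedding.inl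
  have halg : ∀ i (ρ : Op (A.Wires n)), runInstrs Oracle.none
      ((((A.circ n i).flatMap (compileInstr (D n) (A.simWires a n) (A.simAnc a n)
        (A.simAnc_ne a n))).map Instr.gate).map (Instr.map g)) (pad (A.simAllWires a n) ρ) =
      pad (A.simAllWires a n) (A.algMove (fun k => (D n k).povm) n i ρ) := fun i ρ => by
    refine Eq.trans ?_ (runGates_compileInstr (e := A.simWires a n) (z := A.simAnc a n)
      (hz := A.simAnc_ne a n) (h i) (A.algWires n) g (A.simAllWires a n) ?_ ?_ ρ)
    · rw [← runInstrs_gate Oracle.none, List.map_map, List.map_map]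
      rfl
    · ext (v | v) <;> rfl
    · rintro j (v | v)
      · intro h
        exact castAdd_ne_natAdd v j (Sum.inl_injective h)
      · simp [g, simAnc, simAllWires]
  have hfold := List.foldl_hom (l := List.finRange (C.rounds n (A.len n)))
    (init := (basis fun _ => false : Op (A.Wires n))) (pad (A.simAllWires a n))
    (g₁ := fun ρ i => A.algMove (fun k => (D n k).povm) n i (A.challengerMove n i.castSucc ρ))
    (g₂ := fun ρ i => runInstrs Oracle.none ((((A.circ n i).flatMap (compileInstr (D n)
      (A.simWires a n) (A.simAnc a n) (A.simAnc_ne a n))).map Instr.gate).map (Instr.map g))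
        (runGates ((C.circ n (A.len n) i.castSucc).map (Gate.map Function.Embedding.inr)) ρ))
    fun ρ i => by rw [hch, halg]
  rw [pad_basis_zero] at hfold
  have hlast := hch (Fin.last _) ((List.finRange (C.rounds n (A.len n))).foldl
    (fun ρ i => A.algMove (fun k => (D n k).povm) n i (A.challengerMove n i.castSucc ρ))
    (basis fun _ => false))
  rw [← hfold] at hlast
  exact (congrArg (probOne (A.simAllWires a n (Sum.inr (Sum.inr (C.win n (A.len n)))))) hlast).trans
    (probOne_pad _ _ _)

theorem instrsCost_simulate_le {n b : ℕ} (h : ∀ i, QueriesBounded (D n) (a n) b (A.circ n i)) :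
    ∑ i, instrsCost ((A.simulate D a).circ n i) ≤ (∑ i, instrsCost (A.circ n i)) * (b + 1) := by
  rw [Finset.sum_mul]
  refine Finset.sum_le_sum fun i _ => le_trans (le_of_eq ?_) (gatesCost_compileInstr (h i)
    (e := A.simWires a n) (z := A.simAnc a n) (hz := A.simAnc_ne a n))
  simp only [simulate, instrsCost, gatesCost, List.map_map]
  rfl

end InteractiveAlg

/-! ## Polynomially bounded and negligible functions -/

theorem eval_mono_nat (p : Polynomial ℕ) {x y : ℕ} (h : x ≤ y) : p.eval x ≤ p.eval y := by
  rw [Polynomial.eval_eq_sum_range, Polynomial.eval_eq_sum_range]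
  exact Finset.sum_le_sum fun i _ => Nat.mul_le_mul_left _ (Nat.pow_le_pow_left h i)

namespace PolyBounded
variable {f g : ℕ → ℕ}

theorem mono (hg : PolyBounded g) (h : ∀ n, f n ≤ g n) : PolyBounded f :=
  hg.imp fun _ hp n => (h n).trans (hp n)

theorem const (a : ℕ) : PolyBounded fun _ => a := ⟨Polynomial.C a, fun n => by simp⟩

protected theorem id : PolyBounded fun n => n := ⟨Polynomial.X, fun n => by simp⟩

theorem add (hf : PolyBounded f) (hg : PolyBounded g) : PolyBounded fun n => f n + g n := by
  obtain ⟨p, hp⟩ := hf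
  obtain ⟨q, hq⟩ := hg
  exact ⟨p + q, fun n => by rw [Polynomial.eval_add]; exact add_le_add (hp n) (hq n)⟩

theorem mul (hf : PolyBounded f) (hg : PolyBounded g) : PolyBounded fun n => f n * g n := by
  obtain ⟨p, hp⟩ := hf
  obtain ⟨q, hq⟩ := hg
  exact ⟨p * q, fun n => by rw [Polynomial.eval_mul]; exact Nat.mul_le_mul (hp n) (hq n)⟩

theorem pow (hf : PolyBounded f) (k : ℕ) : PolyBounded fun n => f n ^ k := by
  obtain ⟨p, hp⟩ := hf
  exact ⟨p ^ k, fun n => by rw [Polynomial.eval_pow]; exact Nat.pow_le_pow_left (hp n) k⟩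

theorem eval_comp (hf : PolyBounded f) (p : Polynomial ℕ) : PolyBounded fun n => p.eval (f n) := by
  obtain ⟨q, hq⟩ := hf
  exact ⟨p.comp q, fun n => by rw [Polynomial.eval_comp]; exact eval_mono_nat p (hq n)⟩

theorem eventually_le_pow (hf : PolyBounded f) : ∃ d : ℕ, ∀ᶠ n : ℕ in Filter.atTop, f n ≤ n ^ d := by
  obtain ⟨p, hp⟩ := hf
  suffices h : ∃ d : ℕ, ∀ᶠ n : ℕ in Filter.atTop, p.eval n ≤ n ^ d by
    obtain ⟨d, hd⟩ := h
    exact ⟨d, hd.mono fun n hn => (hp n).trans hn⟩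
  clear hp
  induction p using Polynomial.induction_on' with
  | add p q hp hq =>
    obtain ⟨d, hd⟩ := hp
    obtain ⟨e, he⟩ := hq
    refine ⟨max d e + 1, ?_⟩
    filter_upwards [hd, he, Filter.eventually_ge_atTop 2] with n h1 h2 h3
    have h1' := h1.trans (Nat.pow_le_pow_right (by omega) (le_max_left d e))
    have h2' := h2.trans (Nat.pow_le_pow_right (by omega) (le_max_right d e))
    rw [Polynomial.eval_add, pow_succ]
    nlinarith
  | monomial k a =>
    refine ⟨k + 1, ?_⟩
    filter_upwards [Filter.eventually_ge_atTop a] with n hn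
    rw [Polynomial.eval_monomial, pow_succ']
    exact Nat.mul_le_mul_right _ hn

end PolyBounded

theorem Negligible.tendsto_zero {f : ℕ → ℝ} (hf : Negligible f) :
    Filter.Tendsto f Filter.atTop (nhds 0) := by
  simpa using hf 0

/-- A nonnegative function is negligible if it is bounded by negligible functions up to every
inverse power. -/
theorem negligible_of_forall_pow {f : ℕ → ℝ} (h0 : ∀ n, 0 ≤ f n)
    (h : ∀ k : ℕ, ∃ ε : ℕ → ℝ, Negligible ε ∧
      ∀ᶠ n : ℕ in Filter.atTop, (n : ℝ) ^ k * (f n - |ε n|) ≤ 1) : Negligible f := by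
  intro k
  -- The additional power of `n` improves the bound 1 to `1 / n`, which tends to zero.
  obtain ⟨ε, hε, hle⟩ := h (k + 1)
  have h1 : Filter.Tendsto (fun n : ℕ => |(n : ℝ) ^ k * ε n| + 1 / (n : ℝ)) Filter.atTop (nhds 0) := by
    have := (hε k).abs.add (tendsto_one_div_atTop_nhds_zero_nat (𝕜 := ℝ))
    simpa using this
  refine squeeze_zero' (.of_forall fun n => mul_nonneg (pow_nonneg (Nat.cast_nonneg n) k) (h0 n))
    ?_ h1
  filter_upwards [hle, Filter.eventually_gt_atTop 0] with n hn hpos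
  have hn0 : (0 : ℝ) < n := Nat.cast_pos.mpr hpos
  rw [abs_mul, abs_of_nonneg (pow_nonneg hn0.le k), ← sub_le_iff_le_add', ← mul_sub,
    le_div_iff₀ hn0]
  calc (n : ℝ) ^ k * (f n - |ε n|) * n = (n : ℝ) ^ (k + 1) * (f n - |ε n|) := by ring
    _ ≤ 1 := hn

/-! ## The telegrapher -/

namespace Device
variable {A B B' : Type} [Fintype A] [DecidableEq A] [Fintype B] [DecidableEq B] [Fintype B']
  [DecidableEq B']

/-- Relabelling of the output wires. -/
def relabel (D : Device A B) (σ : B' ≃ B) : Device A B' where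
  Anc := D.Anc
  gates := D.gates
  out := σ.toEmbedding.trans D.out

theorem weight_relabel (D : Device A B) (σ : B' ≃ B) (s : B' → Bool) (ρ : Op A) :
    (D.relabel σ).weight s ρ = D.weight (s ∘ σ.symm) ρ := by
  refine Finset.sum_congr rfl fun z _ => ?_
  have h : (z ∘ (D.relabel σ).out = s) ↔ z ∘ D.out = s ∘ σ.symm := by
    rw [Equiv.eq_comp_symm]
    rfl
  exact if_congr h rfl rfl

theorem povm_relabel (D : Device A B) (σ : B' ≃ B) (s : B' → Bool) :
    (D.relabel σ).povm s = D.povm (s ∘ σ.symm) := by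
  ext u v
  exact weight_relabel D σ s _

end Device

theorem Circuit.prob_nonneg {V U : Type} [Fintype V] [DecidableEq V] [Fintype U] [DecidableEq U]
    (C : Circuit V U) (x : V → Bool) (y : U → Bool) : 0 ≤ C.prob x y := by
  have hp := runGates_posSemidef C.gates (Device.pad_posSemidef
    (Function.Embedding.inl : V ↪ V ⊕ Fin C.anc) (basis_posSemidef x))
  rw [← tensor_basis_zero] at hp
  simp only [Circuit.prob, Circuit.run, reduce, Complex.re_sum]
  refine Finset.sum_nonneg fun z _ => ?_
  split_ifs with h
  · rw [← h, extend_comp_eq]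
    exact (Complex.le_def.mp (hp.diag_nonneg (i := z))).1
  · exact le_rfl

namespace UTPKE
variable (S : UTPKE)

/-- The length of the seeds of the telegrapher. -/
def seedLen (n : ℕ) : ℕ := n + ((S.gen n).size + (S.enc n).size + (S.dec n).size)

/-- Because the seeds are this long, a bound on `2 ^ seedLen` also bounds the size of the lookup
table for keys and the cost of the masks. -/
theorem lengths_le_seedLen (n : ℕ) : S.pkLen n + S.msgLen n + S.skLen n + S.ctLen n +
    (S.dec n).anc + gatesCost (S.dec n).gates ≤ S.seedLen n := by
  simp only [seedLen, Circuit.size, Fintype.card_sum, Fintype.card_fin]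
  omega

/-- The quality of the secret key `sk` for decrypting ciphertexts under `pk`. -/
def keyScore (n : ℕ) (pk : Bits (S.pkLen n)) (sk : Bits (S.skLen n)) : ℝ :=
  ∑ m ∈ S.msg n, S.decProb n sk (S.encState n pk m) m

/-- A best secret key for decrypting ciphertexts under `pk`. -/
def bestKey (n : ℕ) (pk : Bits (S.pkLen n)) : Bits (S.skLen n) :=
  (Finite.exists_max (S.keyScore n pk)).choose

theorem keyScore_le_bestKey (n : ℕ) (pk : Bits (S.pkLen n)) (sk : Bits (S.skLen n)) :
    S.keyScore n pk sk ≤ S.keyScore n pk (S.bestKey n pk) :=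
  (Finite.exists_max (S.keyScore n pk)).choose_spec sk

/-- The device that decrypts with the best key. -/
def decryptor (n : ℕ) : Device (Fin (S.pkLen n) ⊕ Fin (S.ctLen n)) (Fin (S.msgLen n)) :=
  Device.decoder (S.dec n) (S.bestKey n)

/-- The device that decrypts and masks the message with an entry of the table. -/
def maskDevice (ω : Coord S.seedLen S.msgLen → Bool) (n : ℕ) :
    Device (Fin (S.pkLen n) ⊕ Fin (S.ctLen n)) (Fin (S.seedLen n + S.msgLen n)) :=
  ((S.decryptor n).mask fun (x : Bits (S.seedLen n)) j => ω ⟨n, x, j⟩).relabel finSumFinEquiv.symm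

/-- The device that answers randomly for security parameters with `Λ`. -/
def tableDevice (Λ : ℕ → Prop) [DecidablePred Λ] (ω : Coord S.seedLen S.msgLen → Bool) (n : ℕ) :
    Device (Fin (S.pkLen n) ⊕ Fin (S.ctLen n)) (Fin (S.seedLen n + S.msgLen n)) :=
  if Λ n then Device.uniform _ _ else S.maskDevice ω n

theorem elim_append_comp {a b : ℕ} (st : Bits (a + b)) : st ∘ finSumFinEquiv =
    Sum.elim (fun i => st (Fin.castAdd b i)) fun j => st (Fin.natAdd a j) := by
  funext i
  rcases i with i | i <;> simp

theorem povm_maskDevice (ω : Coord S.seedLen S.msgLen → Bool) (n : ℕ)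
    (st : Bits (S.seedLen n + S.msgLen n)) : (S.maskDevice ω n).povm st =
      (1 / 2 ^ S.seedLen n : ℂ) • (S.decryptor n).povm (fun j =>
        xor (st (Fin.natAdd (S.seedLen n) j))
          (ω ⟨n, fun i => st (Fin.castAdd (S.msgLen n) i), j⟩)) := by
  rw [maskDevice, Device.povm_relabel, Equiv.symm_symm, elim_append_comp, Device.povm_mask,
    Fintype.card_fin]

/-- The same oracle in its two roles: the formula is averaged over seeds, and the devices are
compiled into circuits. -/
theorem tableOracle_eq_povm (Λ : ℕ → Prop) [DecidablePred Λ]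
    (ω : Coord S.seedLen S.msgLen → Bool) :
    tableOracle (fun n => (S.decryptor n).povm) Λ ω = fun k =>
      Device.povm (A := (maskedType S S.seedLen).In k) (B := (maskedType S S.seedLen).Out k)
        (S.tableDevice Λ ω k) := by
  funext (n : ℕ) (st : Bits (S.seedLen n + S.msgLen n))
  by_cases h : Λ n
  · refine (if_pos h).trans ?_
    have h1 : S.tableDevice Λ ω n = Device.uniform _ _ := if_pos h
    refine Eq.trans ?_ (congrArg (fun D => D.povm st) h1).symm
    refine Eq.trans ?_ (Device.povm_uniform (A := Fin (S.pkLen n) ⊕ Fin (S.ctLen n)) st).symm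
    rw [Fintype.card_fin]
  · refine (if_neg h).trans ?_
    have h1 : S.tableDevice Λ ω n = S.maskDevice ω n := if_neg h
    exact (S.povm_maskDevice ω n st).symm.trans (congrArg (fun D => D.povm st) h1).symm

theorem tableOracle_isMeasurement (Λ : ℕ → Prop) [DecidablePred Λ]
    (ω : Coord S.seedLen S.msgLen → Bool) :
    (tableOracle (fun n => (S.decryptor n).povm) Λ ω).IsMeasurement := by
  rw [tableOracle_eq_povm]
  exact fun n => ⟨fun st => (S.tableDevice Λ ω n).povm_posSemidef st, (S.tableDevice Λ ω n).sum_povm⟩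

/-- The telegrapher with table `ω`. -/
def tableTelegrapher (ω : Coord S.seedLen S.msgLen → Bool) :
    S.Telegrapher fun n => S.seedLen n + S.msgLen n where
  oracle := tableOracle (fun n => (S.decryptor n).povm) (fun _ => False) ω
  isMeasurement := S.tableOracle_isMeasurement _ ω

/-- The receiver that unmasks the message. -/
def tableReceiver (ω : Coord S.seedLen S.msgLen → Bool) :
    S.Receiver fun n => S.seedLen n + S.msgLen n := fun n st _ =>
  PMF.pure fun j => xor (st (Fin.natAdd (S.seedLen n) j))
    (ω ⟨n, fun i => st (Fin.castAdd (S.msgLen n) i), j⟩)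

theorem tableTelegrapher_prob (ω : Coord S.seedLen S.msgLen → Bool) (n : ℕ)
    (pk : Bits (S.pkLen n)) (ρ : Op (Fin (S.ctLen n))) (st : Bits (S.seedLen n + S.msgLen n)) :
    (S.tableTelegrapher ω).prob n pk ρ st = 1 / 2 ^ S.seedLen n *
      S.decProb n (S.bestKey n pk) ρ (fun j => xor (st (Fin.natAdd (S.seedLen n) j))
        (ω ⟨n, fun i => st (Fin.castAdd (S.msgLen n) i), j⟩)) := by
  have h1 : (show Op (Fin (S.pkLen n) ⊕ Fin (S.ctLen n)) from (S.tableTelegrapher ω).oracle n st) =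
      (S.maskDevice ω n).povm st :=
    congrFun (congrFun (S.tableOracle_eq_povm (fun _ => False) ω) n) st
  have h2 : (Matrix.trace ((S.maskDevice ω n).povm st * tensor (basis pk) ρ)) =
      (S.maskDevice ω n).weight st (tensor (basis pk) ρ) := by
    rw [Device.weight_eq, Finset.sum_comm]
    rfl
  have h3 : (S.maskDevice ω n).weight st (tensor (basis pk) ρ) = (1 / 2 ^ S.seedLen n : ℂ) *
      (S.dec n).run (tensor (basis (S.bestKey n pk)) ρ) (fun j => xor (st (Fin.natAdd (S.seedLen n) j))
        (ω ⟨n, fun i => st (Fin.castAdd (S.msgLen n) i), j⟩)) (fun j =>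
          xor (st (Fin.natAdd (S.seedLen n) j))
            (ω ⟨n, fun i => st (Fin.castAdd (S.msgLen n) i), j⟩)) := by
    rw [maskDevice, Device.weight_relabel, Equiv.symm_symm, elim_append_comp, Device.weight_mask,
      Fintype.card_fin, decryptor, Device.weight_decoder]
  rw [Telegrapher.prob, h1, h2, h3, decProb]
  have h4 : (1 / 2 ^ S.seedLen n : ℂ) = ((1 / 2 ^ S.seedLen n : ℝ) : ℂ) := by push_cast; rfl
  rw [h4, Complex.re_ofReal_mul]

/-- For each seed the masking and unmasking cancel, so the pair outputs `m` with the probability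
that the best key decrypts to `m`, for every table. -/
theorem sum_tableTelegrapher (ω : Coord S.seedLen S.msgLen → Bool) (n : ℕ)
    (pk : Bits (S.pkLen n)) (sk : Bits (S.skLen n)) (ρ : Op (Fin (S.ctLen n)))
    (m : Bits (S.msgLen n)) :
    ∑ st, (S.tableTelegrapher ω).prob n pk ρ st * (S.tableReceiver ω n st sk m).toReal =
      S.decProb n (S.bestKey n pk) ρ m := by
  rw [sum_bits_add]
  have h : ∀ (x : Bits (S.seedLen n)) (y : Bits (S.msgLen n)),
      (S.tableTelegrapher ω).prob n pk ρ (Fin.append x y) *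
        (S.tableReceiver ω n (Fin.append x y) sk m).toReal = 1 / 2 ^ S.seedLen n *
      if m = (fun j => xor (y j) (ω ⟨n, x, j⟩)) then S.decProb n (S.bestKey n pk) ρ m else 0 := by
    intro x y
    rw [tableTelegrapher_prob]
    simp only [tableReceiver, Fin.append_left, Fin.append_right, PMF.pure_apply]
    have hx : (fun i => x i) = x := rfl
    rw [mul_assoc]
    congr 1
    by_cases hm : m = fun j => xor (y j) (ω ⟨n, x, j⟩)
    · rw [if_pos hm, if_pos hm, ENNReal.toReal_one, mul_one]
      exact congrArg _ hm.symm
    · rw [if_neg hm, if_neg hm, ENNReal.toReal_zero, mul_zero]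
  simp only [h, ← Finset.mul_sum]
  have h2 : ∀ x : Bits (S.seedLen n), (∑ y : Bits (S.msgLen n),
      if m = (fun j => xor (y j) (ω ⟨n, x, j⟩)) then S.decProb n (S.bestKey n pk) ρ m else 0) =
        S.decProb n (S.bestKey n pk) ρ m := fun x => by
    rw [sum_xor (fun j => ω ⟨n, x, j⟩) fun y => if m = y then
      S.decProb n (S.bestKey n pk) ρ m else 0]
    simp
  rw [Finset.sum_congr rfl fun x _ => h2 x, Finset.sum_const, Finset.card_univ, nsmul_eq_mul,
    Fintype.card_fun, Fintype.card_bool, Fintype.card_fin]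
  push_cast
  field_simp

/-- The telegrapher and the receiver win if decryption is correct. -/
theorem le_winProb_table {ε : ℕ → ℝ} {n : ℕ} (hε : ∀ m ∈ S.msg n, 1 - ε n ≤
      ∑ pk, ∑ sk, S.genProb n pk sk * S.decProb n sk (S.encState n pk m) m)
    (ω : Coord S.seedLen S.msgLen → Bool) :
    1 - ε n ≤ S.winProb (S.tableTelegrapher ω) (S.tableReceiver ω) n := by
  have hcard : (0 : ℝ) < (S.msg n).card := Nat.cast_pos.mpr (S.msg_nonempty n).card_pos
  -- The receiver's success does not involve `sk`, and for each `pk` the best key scores at least as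
  -- high as the sampled `sk`.
  have h1 : ∑ pk, ∑ sk, S.genProb n pk sk * ((1 / ((S.msg n).card : ℝ)) * S.keyScore n pk sk) ≤
      S.winProb (S.tableTelegrapher ω) (S.tableReceiver ω) n := by
    simp only [winProb, sum_tableTelegrapher]
    refine Finset.sum_le_sum fun pk _ => Finset.sum_le_sum fun sk _ =>
      mul_le_mul_of_nonneg_left (mul_le_mul_of_nonneg_left (S.keyScore_le_bestKey n pk sk) ?_)
        (Circuit.prob_nonneg _ _ _)
    positivity
  refine le_trans ?_ h1
  have h2 : ∑ pk, ∑ sk, S.genProb n pk sk * ((1 / ((S.msg n).card : ℝ)) * S.keyScore n pk sk) =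
      (1 / ((S.msg n).card : ℝ)) * ∑ m ∈ S.msg n, ∑ pk, ∑ sk, S.genProb n pk sk *
        S.decProb n sk (S.encState n pk m) m := by
    simp only [keyScore, Finset.mul_sum]
    refine ((Finset.sum_congr rfl fun pk _ => Finset.sum_comm).trans Finset.sum_comm).trans ?_
    refine Finset.sum_congr rfl fun m _ => Finset.sum_congr rfl fun pk _ =>
      Finset.sum_congr rfl fun sk _ => ?_
    ring
  rw [h2, one_div, le_inv_mul_iff₀ hcard]
  calc ((S.msg n).card : ℝ) * (1 - ε n) = ∑ _m ∈ S.msg n, (1 - ε n) := by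
        rw [Finset.sum_const, nsmul_eq_mul]
    _ ≤ _ := Finset.sum_le_sum hε

theorem not_negligible_winProb_table (hS : S.Correct) (ω : Coord S.seedLen S.msgLen → Bool) :
    ¬ Negligible (S.winProb (S.tableTelegrapher ω) (S.tableReceiver ω)) := by
  intro h
  obtain ⟨ε, hε, hle⟩ := hS
  have h1 := h.tendsto_zero.add hε.tendsto_zero
  rw [add_zero] at h1
  have h2 : (1 : ℝ) ≤ 0 := ge_of_tendsto' h1 fun n => by
    have := S.le_winProb_table (hle n) ω
    linarith
  norm_num at h2

end UTPKE

/-! ## The simulation is efficient -/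

namespace Device

theorem gatesCost_maskGates {A N R M : Type} [Fintype A] [DecidableEq A] [Fintype N]
    [DecidableEq N] [Fintype R] [DecidableEq R] [Fintype M] [DecidableEq M]
    (gs : List (Gate (A ⊕ N))) (o : M ↪ A ⊕ N) (g : (R → Bool) → M → Bool) :
    gatesCost (maskGates gs o g) ≤ gatesCost gs + (Fintype.card R +
      Fintype.card M * 2 ^ (Fintype.card R + Fintype.card M) *
        (1 + (Fintype.card R + Fintype.card M))) := by
  rw [maskGates, gatesCost_append, gatesCost_append, gatesCost_map, gatesCost_coinAll,
    ← Fintype.card_sum (α := R) (β := M)]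
  refine Nat.add_le_add_left (Nat.add_le_add_left ?_ _) _
  apply gatesCost_tableGates

theorem gatesCost_decoderGates {PK SK CT N : Type} [Fintype PK] [DecidableEq PK] [Fintype SK]
    [DecidableEq SK] [Fintype CT] [DecidableEq CT] [Fintype N] [DecidableEq N]
    (gs : List (Gate ((SK ⊕ CT) ⊕ N))) (k : (PK → Bool) → SK → Bool) :
    gatesCost (decoderGates gs k) ≤
      Fintype.card SK * 2 ^ Fintype.card PK * (1 + Fintype.card PK) + gatesCost gs := by
  rw [decoderGates, gatesCost_append, gatesCost_map]
  exact Nat.add_le_add_right (gatesCost_tableGates _ _ _ _) _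

end Device

namespace UTPKE
variable (S : UTPKE)

theorem gatesCost_maskDevice (ω : Coord S.seedLen S.msgLen → Bool) (n : ℕ) :
    gatesCost (S.maskDevice ω n).gates ≤
      S.skLen n * 2 ^ S.pkLen n * (1 + S.pkLen n) + gatesCost (S.dec n).gates +
      (S.seedLen n + S.msgLen n * 2 ^ (S.seedLen n + S.msgLen n) *
        (1 + (S.seedLen n + S.msgLen n))) := by
  have h := (Device.gatesCost_maskGates (S.decryptor n).gates (S.decryptor n).out
    fun (x : Bits (S.seedLen n)) j => ω ⟨n, x, j⟩).trans (Nat.add_le_add_right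
      (Device.gatesCost_decoderGates (S.dec n).gates (S.bestKey n)) _)
  simp only [Fintype.card_fin] at h
  exact h

theorem card_maskDevice_anc (ω : Coord S.seedLen S.msgLen → Bool) (n : ℕ) :
    Fintype.card (S.maskDevice ω n).Anc =
      S.skLen n + (S.dec n).anc + (S.seedLen n + S.msgLen n) := by
  change Fintype.card ((Fin (S.skLen n) ⊕ Fin (S.dec n).anc) ⊕
    (Fin (S.seedLen n) ⊕ Fin (S.msgLen n))) = _
  simp only [Fintype.card_sum, Fintype.card_fin]

/-- The cost of the answer to a query whose answer has length at most `N`, where tables may have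
size `b`. -/
def queryCost (N b : ℕ) : ℕ := 10 * N + N * b * (1 + N) + N * (b * b) * (1 + N)

/-- All lengths of the scheme are at most `N`. The key table has `2 ^ pkLen ≤ b` inputs; the mask
table is controlled by seed and message together, which gives `b * b`. For large parameters there is
no table. -/
theorem tableDevice_bounded (Λ : ℕ → Prop) [DecidablePred Λ]
    (ω : Coord S.seedLen S.msgLen → Bool) {n N b : ℕ} (hN : S.seedLen n + S.msgLen n ≤ N)
    (hb : ¬Λ n → 2 ^ S.seedLen n ≤ b) :
    Fintype.card (S.tableDevice Λ ω n).Anc ≤ 4 * N ∧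
      gatesCost (S.tableDevice Λ ω n).queryGates ≤ queryCost N b := by
  have hl := S.lengths_le_seedLen n
  by_cases h : Λ n
  · have h1 : S.tableDevice Λ ω n = Device.uniform _ _ := if_pos h
    rw [h1, Device.gatesCost_queryGates]
    have h2 : Fintype.card (Device.uniform (Fin (S.pkLen n) ⊕ Fin (S.ctLen n))
        (Fin (S.seedLen n + S.msgLen n))).Anc = S.seedLen n + S.msgLen n := Fintype.card_fin _
    have h3 : gatesCost (Device.uniform (Fin (S.pkLen n) ⊕ Fin (S.ctLen n))
        (Fin (S.seedLen n + S.msgLen n))).gates = S.seedLen n + S.msgLen n :=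
      (gatesCost_coinAll _).trans (Fintype.card_fin _)
    rw [h2, h3]
    simp only [Fintype.card_sum, Fintype.card_fin, queryCost]
    constructor
    · omega
    · have : 0 ≤ N * b * (1 + N) + N * (b * b) * (1 + N) := Nat.zero_le _
      omega
  · have h1 : S.tableDevice Λ ω n = S.maskDevice ω n := if_neg h
    have hb' := hb h
    rw [h1, Device.gatesCost_queryGates, card_maskDevice_anc]
    have h3 := S.gatesCost_maskDevice ω n
    have h4 : S.skLen n * 2 ^ S.pkLen n * (1 + S.pkLen n) ≤ N * b * (1 + N) := by
      refine Nat.mul_le_mul (Nat.mul_le_mul (by omega)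
        ((Nat.pow_le_pow_right (by norm_num) ?_).trans hb')) (by omega)
      omega
    have h5 : S.msgLen n * 2 ^ (S.seedLen n + S.msgLen n) * (1 + (S.seedLen n + S.msgLen n)) ≤
        N * (b * b) * (1 + N) := by
      refine Nat.mul_le_mul (Nat.mul_le_mul (by omega) ?_) (by omega)
      rw [pow_add]
      exact Nat.mul_le_mul hb' ((Nat.pow_le_pow_right (by norm_num) (by omega)).trans hb')
    simp only [Fintype.card_sum, Fintype.card_fin, queryCost]
    omega

variable {S} {C : Challenger} (A : InteractiveAlg (maskedType S S.seedLen) C)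

/-- The security parameters whose queries are answered randomly by the simulation. -/
abbrev LargeKey (S : UTPKE) (K n k : ℕ) : Prop := n ^ K < 2 ^ S.seedLen k

/-- The number of wires of an algorithm. -/
abbrev width (n : ℕ) : ℕ := A.memLen n + C.msgLen n (A.len n)

/-- The algorithm that answers queries with large security parameters randomly and the others with
the telegrapher. -/
def simulator (K : ℕ) (ω : Coord S.seedLen S.msgLen → Bool) : InteractiveAlg OracleType.none C :=
  A.simulate (fun n k => S.tableDevice (LargeKey S K n) ω k) fun n => 4 * width A n

/-- The answer register embeds into the wires of the algorithm, so the lengths at the queried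
parameter are at most the width, whatever parameter is queried. -/
theorem queriesBounded_tableDevice (K : ℕ) (ω : Coord S.seedLen S.msgLen → Bool) (n : ℕ)
    (i : Fin (C.rounds n (A.len n))) :
    QueriesBounded (T := maskedType S S.seedLen) (fun k => S.tableDevice (LargeKey S K n) ω k)
      (4 * width A n) (queryCost (width A n) (n ^ K)) (A.circ n i) := by
  intro (k : ℕ) inp ans hk hmem
  refine S.tableDevice_bounded (LargeKey S K n) ω ?_ fun h => not_lt.mp h
  have := Fintype.card_le_of_embedding (α := Fin (S.seedLen k + S.msgLen k)) ans
  simpa only [Fintype.card_sum, Fintype.card_fin] using this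

theorem winProb_simulator (K : ℕ) (ω : Coord S.seedLen S.msgLen → Bool) (n : ℕ) :
    (simulator A K ω).winProb Oracle.none n =
      A.winProb (tableOracle (fun n => (S.decryptor n).povm) (LargeKey S K n) ω) n := by
  rw [tableOracle_eq_povm]
  exact A.winProb_simulate (queriesBounded_tableDevice A K ω n)

/-- Only tables with at most `n ^ K` seeds are compiled. Their entries and the best keys are
hardwired, for which non-uniformity suffices. -/
theorem simulator_efficient (hA : A.Efficient) (K : ℕ) (ω : Coord S.seedLen S.msgLen → Bool) :
    (simulator A K ω).Efficient := by
  have hw : PolyBounded (width A) := hA.mono fun n => by unfold width; omega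
  have hq : PolyBounded fun n => queryCost (width A n) (n ^ K) := by
    have hb : PolyBounded fun n => n ^ K := PolyBounded.id.pow K
    exact (((PolyBounded.const 10).mul hw).add ((hw.mul hb).mul ((PolyBounded.const 1).add hw))).add
      ((hw.mul (hb.mul hb)).mul ((PolyBounded.const 1).add hw))
  refine ((hA.add ((PolyBounded.const 4).mul hw)).add
    (hA.mul (hq.add (PolyBounded.const 1)))).mono fun n => ?_
  have h1 := A.instrsCost_simulate_le
    (D := fun n k => S.tableDevice (LargeKey S K n) ω k) (a := fun n => 4 * width A n)
    (queriesBounded_tableDevice A K ω n)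
  have h2 : (∑ i, instrsCost (A.circ n i)) * (queryCost (width A n) (n ^ K) + 1) ≤
      (A.len n + A.memLen n + C.msgLen n (A.len n) + ∑ i, instrsCost (A.circ n i)) *
        (queryCost (width A n) (n ^ K) + 1) := Nat.mul_le_mul_right _ (by omega)
  have h3 : (simulator A K ω).len n = A.len n := rfl
  have h4 : (simulator A K ω).memLen n = A.memLen n + 4 * width A n := rfl
  have h5 : ∑ i, instrsCost ((simulator A K ω).circ n i) ≤
      (∑ i, instrsCost (A.circ n i)) * (queryCost (width A n) (n ^ K) + 1) := h1
  have h6 : C.msgLen n ((simulator A K ω).len n) = C.msgLen n (A.len n) := rfl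
  omega

/-! ## The simulation is accurate -/

theorem decryptor_isMeasurement (n : ℕ) : (∀ s, ((S.decryptor n).povm s).PosSemidef) ∧
    ∑ s, (S.decryptor n).povm s = 1 :=
  ⟨(S.decryptor n).povm_posSemidef, (S.decryptor n).sum_povm⟩

theorem winProb_eq_tableExpect (n : ℕ) (Λ : ℕ → Prop) [DecidablePred Λ]
    (ω : Coord S.seedLen S.msgLen → Bool) :
    A.winProb (tableOracle (fun n => (S.decryptor n).povm) Λ ω) n =
      tableExpect (fun i => queryKey ((A.allInstrs n).reverse.get i)) Λ
        (pointProb (fun n => (S.decryptor n).povm) (A.allInstrs n).reverse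
          (Sum.inr (Sum.inr (C.win n (A.len n)))) (basis fun _ => false)) ω := by
  rw [InteractiveAlg.winProb_eq_runInstrs]
  exact probOne_runInstrs_tableOracle decryptor_isMeasurement Λ ω _ _ _

/-- The error of the simulation. -/
def simError (K n : ℕ) (ω : Coord S.seedLen S.msgLen → Bool) : ℝ :=
  A.winProb (S.tableTelegrapher ω).oracle n - (simulator A K ω).winProb Oracle.none n

theorem simError_eq (K n : ℕ) (ω : Coord S.seedLen S.msgLen → Bool) : simError A K n ω =
    tableExpect (fun i => queryKey ((A.allInstrs n).reverse.get i)) (fun _ => False)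
        (pointProb (fun n => (S.decryptor n).povm) (A.allInstrs n).reverse
          (Sum.inr (Sum.inr (C.win n (A.len n)))) (basis fun _ => false)) ω -
      tableExpect (fun i => queryKey ((A.allInstrs n).reverse.get i)) (LargeKey S K n)
        (pointProb (fun n => (S.decryptor n).povm) (A.allInstrs n).reverse
          (Sum.inr (Sum.inr (C.win n (A.len n)))) (basis fun _ => false)) ω := by
  rw [simError, winProb_simulator, winProb_eq_tableExpect]
  exact congrArg (· - _) (winProb_eq_tableExpect A n (fun _ => False) ω)

theorem measurable_simError (K n : ℕ) : Measurable (simError A K n) := by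
  simp only [funext (simError_eq A K n)]
  exact (measurable_tableExpect _ _).sub (measurable_tableExpect _ _)

theorem abs_simError_le (K n : ℕ) (ω : Coord S.seedLen S.msgLen → Bool) :
    |simError A K n ω| ≤ 1 := by
  have h1 := A.winProb_mem_Icc (S.tableTelegrapher ω).isMeasurement n
  have h2 := A.winProb_mem_Icc (S.tableOracle_isMeasurement (LargeKey S K n) ω) n
  rw [simError, winProb_simulator, abs_le]
  constructor <;> linarith [h1.1, h1.2, h2.1, h2.2]

theorem integral_simError_sq_le (K : ℕ) {n q : ℕ} (hn : 0 < n) (hq : (A.allInstrs n).length ≤ q) :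
    ∫ ω, simError A K n ω ^ 2 ∂coinsMeasure (Coord S.seedLen S.msgLen) ≤
      8 * (q : ℝ) ^ 2 / (n : ℝ) ^ K := by
  have hn0 : (0 : ℝ) < (n : ℝ) ^ K := pow_pos (Nat.cast_pos.mpr hn) K
  simp only [simError_eq]
  refine (integral_tableExpect_sub_sq_le _ _ (fun x u => pointProb_mem_Icc decryptor_isMeasurement
    _ _ (basis_posSemidef _) (trace_basis _) x u) (one_div_nonneg.mpr hn0.le) fun k hk => ?_).trans ?_
  · refine one_div_le_one_div_of_le hn0 ?_
    exact_mod_cast hk.le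
  · rw [Fintype.card_fin, List.length_reverse]
    have : ((A.allInstrs n).length : ℝ) ^ 2 ≤ (q : ℝ) ^ 2 := by gcongr
    calc 2 * ((2 * ((A.allInstrs n).length : ℝ)) ^ 2 * (1 / (n : ℝ) ^ K))
        = 8 * ((A.allInstrs n).length : ℝ) ^ 2 / (n : ℝ) ^ K := by ring
      _ ≤ _ := by gcongr

/-- A form of the Borel–Cantelli lemma. -/
theorem ae_eventually_lt_one {Ω : Type*} [MeasurableSpace Ω] {μ : Measure Ω} [IsFiniteMeasure μ]
    {h : ℕ → Ω → ℝ} (h0 : ∀ n ω, 0 ≤ h n ω) (hi : ∀ n, Integrable (h n) μ) {a : ℕ → ℝ}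
    (ha : Summable a) (hle : ∀ᶠ n in Filter.atTop, ∫ ω, h n ω ∂μ ≤ a n) :
    ∀ᵐ ω ∂μ, ∀ᶠ n in Filter.atTop, h n ω < 1 := by
  obtain ⟨N, hN⟩ := Filter.eventually_atTop.mp hle
  let s : ℕ → Set Ω := fun n => if N ≤ n then {ω | 1 ≤ h n ω} else ∅
  have hs : ∀ n, μ (s n) ≤ ENNReal.ofReal (a n) := fun n => by
    by_cases hn : N ≤ n
    · simp only [s, if_pos hn]
      have h1 := mul_meas_ge_le_integral_of_nonneg (.of_forall (h0 n)) (hi n) 1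
      rw [one_mul] at h1
      rw [← ENNReal.ofReal_toReal (measure_ne_top μ {ω | 1 ≤ h n ω})]
      exact ENNReal.ofReal_le_ofReal (h1.trans (hN n hn))
    · simp [s, hn]
  have hsum : ∑' n, μ (s n) ≠ ⊤ := ne_top_of_le_ne_top ha.tsum_ofReal_ne_top (ENNReal.tsum_le_tsum hs)
  filter_upwards [ae_eventually_notMem hsum] with ω hω
  filter_upwards [hω, Filter.eventually_ge_atTop N] with n hn hge
  simpa [s, hge] using hn

theorem ae_eventually_simError (hC : C.Efficient) (hA : A.Efficient) (k : ℕ) :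
    ∃ K, ∀ᵐ ω ∂coinsMeasure (Coord S.seedLen S.msgLen), ∀ᶠ n : ℕ in Filter.atTop,
      (n : ℝ) ^ k * |simError A K n ω| ≤ 1 := by
  obtain ⟨p, hp⟩ := hC
  have hlen : PolyBounded fun n => (A.allInstrs n).length := by
    have hA' : PolyBounded A.len := hA.mono fun n => by omega
    refine (((PolyBounded.id.add hA').eval_comp p).add hA).mono fun n => ?_
    have h1 := A.length_allInstrs_le n
    have h2 := hp n (A.len n)
    omega
  obtain ⟨d, hd⟩ := hlen.eventually_le_pow
  -- With at most `n ^ d` instructions, the second moment of `n ^ k` times the error is at most `n ^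
  -- (2k) * 8 n ^ (2d) / n ^ (2k + 2d + 2) = 8 / n ^ 2`, which is summable.
  refine ⟨2 * k + 2 * d + 2, ?_⟩
  have key := ae_eventually_lt_one (μ := coinsMeasure (Coord S.seedLen S.msgLen))
    (h := fun n ω => ((n : ℝ) ^ k * simError A (2 * k + 2 * d + 2) n ω) ^ 2)
    (a := fun n => 8 * (1 / (n : ℝ) ^ 2)) (fun n ω => sq_nonneg _) (fun n => ?_)
    ((Real.summable_one_div_nat_pow.mpr one_lt_two).mul_left 8) ?_
  · filter_upwards [key] with ω hω
    filter_upwards [hω] with n hn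
    have := (sq_lt_one_iff_abs_lt_one _).mp hn
    rw [abs_mul, abs_of_nonneg (by positivity : (0 : ℝ) ≤ (n : ℝ) ^ k)] at this
    exact this.le
  · refine Integrable.of_bound (((measurable_simError A _ n).const_mul _).pow_const 2).aestronglyMeasurable
      (((n : ℝ) ^ k) ^ 2) (.of_forall fun ω => ?_)
    rw [Real.norm_eq_abs, abs_of_nonneg (sq_nonneg _), mul_pow]
    have := abs_simError_le A (2 * k + 2 * d + 2) n ω
    have h1 : simError A (2 * k + 2 * d + 2) n ω ^ 2 ≤ 1 := by
      rw [← sq_abs]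
      exact pow_le_one₀ (abs_nonneg _) this
    exact mul_le_of_le_one_right (sq_nonneg _) h1
  · filter_upwards [hd, Filter.eventually_gt_atTop 0] with n hn hpos
    have hn0 : (0 : ℝ) < n := Nat.cast_pos.mpr hpos
    simp only [mul_pow]
    rw [integral_const_mul]
    refine (mul_le_mul_of_nonneg_left (integral_simError_sq_le A _ hpos hn) (sq_nonneg _)).trans ?_
    apply le_of_eq
    push_cast
    field_simp
    ring

/-- If no simulation breaks the assumption, then some telegrapher does not help the reduction. -/
theorem exists_not_breaks (hC : C.Efficient) (hA : A.Efficient) {c : ℝ}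
    (hc : ¬ AssumptionFalse C c) :
    ∃ ω, ¬ A.Breaks (S.tableTelegrapher ω).oracle c := by
  choose K hK using ae_eventually_simError A hC hA
  -- The exponent `K k` and with it the simulator vary with `k`, but countably many almost sure
  -- events have a common point, so the table does not vary.
  obtain ⟨ω, hω⟩ := (ae_all_iff.mpr hK).exists
  -- The negligible function is the excess of the winning probability over `c`, cut off at zero.
  refine ⟨ω, not_not.mpr ⟨fun n => max (A.winProb (S.tableTelegrapher ω).oracle n - c) 0,
    negligible_of_forall_pow (fun n => le_max_right _ _) fun k => ?_, fun n => ?_⟩⟩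
  · have hsim : ¬ (simulator A (K k) ω).Breaks Oracle.none c := fun h =>
      hc ⟨_, simulator_efficient A hA (K k) ω, h⟩
    obtain ⟨ε, hε, hle⟩ := not_not.mp hsim
    refine ⟨ε, hε, ?_⟩
    filter_upwards [hω k] with n hn
    refine le_trans (mul_le_mul_of_nonneg_left ?_ (by positivity)) hn
    rw [sub_le_iff_le_add]
    refine max_le ?_ (by positivity)
    have h1 : A.winProb (S.tableTelegrapher ω).oracle n -
      (simulator A (K k) ω).winProb Oracle.none n ≤ |simError A (K k) n ω| := le_abs_self _
    have h2 := le_abs_self (ε n)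
    have h3 := hle n
    linarith
  · have := le_max_left (A.winProb (S.tableTelegrapher ω).oracle n - c) 0
    linarith

theorem polyBounded_seedLen_add (hS : S.Efficient) :
    PolyBounded fun n => S.seedLen n + S.msgLen n := by
  have h : PolyBounded S.seedLen := PolyBounded.id.add hS
  exact (h.add h).mono fun n => by
    have := S.lengths_le_seedLen n
    omega

/-- A falsifiable assumption with a black-box reduction is false. -/
theorem assumptionFalse_of_isBlackBoxReduction (hS : S.Efficient) (hcorrect : S.Correct)
    (hC : C.Efficient) {c : ℝ} (h : ∃ R, IsBlackBoxReduction S C c R) : AssumptionFalse C c := by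
  by_contra hc
  obtain ⟨R, hR⟩ := h
  -- The output length is the same for all tables, so the reduction is a fixed algorithm before the
  -- table is chosen.
  obtain ⟨hA, hbreak⟩ := hR _ (polyBounded_seedLen_add hS)
  obtain ⟨ω, hω⟩ := exists_not_breaks (S := S) _ hC hA hc
  exact hω (hbreak (S.tableTelegrapher ω) (S.tableReceiver ω)
    (S.not_negligible_winProb_table hcorrect ω))

end UTPKE

end Telegraph

end

theorem mainTheorem9 (δ : ℝ) (hδ : δ ∈ Set.Ioo (0 : ℝ) 1)
    (S : Telegraph.UTPKE) (hS : S.Efficient) (hcorrect : S.Correct)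
    (C : Telegraph.Challenger) (hC : C.Efficient) (c : ℝ) (hc : c ∈ Set.Ico (0 : ℝ) 1) :
    ((∃ E : Telegraph.SKE, E.Efficient ∧ E.Correct ∧ E.CPASecure δ ∧ E.StatisticallyFar) →
      Telegraph.AssumptionFalse C c ∨ ¬ ∃ R, Telegraph.IsBlackBoxReduction S C c R) ∧
    ((∃ F : Telegraph.FunctionFamily, F.Efficient ∧ F.OneWay δ) →
      Telegraph.AssumptionFalse C c ∨ ¬ ∃ R, Telegraph.IsBlackBoxReduction S C c R) := by
  have h : Telegraph.AssumptionFalse C c ∨ ¬ ∃ R, Telegraph.IsBlackBoxReduction S C c R :=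
    (em (∃ R, Telegraph.IsBlackBoxReduction S C c R)).imp_left
      (Telegraph.UTPKE.assumptionFalse_of_isBlackBoxReduction hS hcorrect hC)
  exact ⟨fun _ => h, fun _ => h⟩
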